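/- A simplicial complex on a finite set $V$ is a family $K$ of subsets of $V$ closed under taking subsets; the void complex $\{\,\}$ and the complex $\{\emptyset\}$ are both allowed, and so are ghost vertices (elements $v\in V$ with $\{v\}\notin K$). Let $\Delta^{V}$ be the complex of all subsets of $V$, $\partial\Delta^{V}=\Delta^{V}\setminus\{V\}$, and ${\rm link}_K\sigma=\{\tau\mid\sigma\cup\tau\in K,\ \sigma\cap\tau=\emptyset\}$. Reduced homology $\tilde H_*$ and cohomology $\tilde H^*$ are the simplicial ones with coefficients in $\mathbb Z$ (so $\tilde H_{-1}(\{\emptyset\})=\mathbb Z$ and $\tilde H_*(\{\,\})=0$). A complex $L$ is called homology spherical if $\tilde H_*(L)\cong\mathbb Z$, that is, one reduced homology group is $\mathbb Z$ and all the others vanish. It is called a homological sphere if it is not void and ${\rm link}_L\sigma$ is homology spherical for all $\sigma\in L$ (including $\sigma=\emptyset$). Let $m\ge 0$ and $n_1,\dots,n_m>0$, let $K$ be a simplicial complex on $[m]$ and $L_k$ a simplicial complex on $[n_k]$ for $k=1,\dots,m$. The composition complex ${\cal S}(K;L_1,\dots,L_m)$ is the simplicial complex on the disjoint union $[n_1]\sqcup\dots\sqcup[n_m]$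 that consists of all $\sigma$ for which there is $\tau\in K$ with $\sigma\cap[n_k]\in L_k$ for all $k\notin\tau$. Then: (1) If all $\tilde H_*(L_k)$ are free, there are isomorphisms of graded groups $$\tilde H_{*-1}({\cal S}(K;L_1,\dots,L_m))\cong\tilde H_{*-1}(K)\otimes\tilde H_{*-1}(L_1)\otimes\cdots\otimes\tilde H_{*-1}(L_m),$$ $$\tilde H^{*-1}({\cal S}(K;L_1,\dots,L_m))\cong\tilde H^{*-1}(K)\otimes\tilde H^{*-1}(L_1)\otimes\cdots\otimes\tilde H^{*-1}(L_m).$$ (2) ${\cal S}(K;L_1,\dots,L_m)$ is homology spherical if and only if $K$ and all $L_k$ are homology spherical. (3) If $K$ has no ghost vertices (that is, $\{k\}\in K$ for all $k\in[m]$), then ${\cal S}(K;L_1,\dots,L_m)$ is a homological sphere if and only if $K$ is a homological sphere and $L_k=\partial\Delta^{[n_k]}$ for all $k$. (4) For every $K$, possibly with ghost vertices, ${\cal S}(K;L_1,\dots,L_m)$ is a homological sphere if and only if $K$ is a homological sphere, $L_k=\partial\Delta^{[n_k]}$ for every $k$ with $\{k\}\in K$, and $L_k$ is a homological sphere for every $k$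 with $\{k\}\notin K$. -/

import Mathlib

open CategoryTheory
open scoped TensorProduct DirectSum

noncomputable section

/-- A simplicial complex on the vertex set `V`: a family of finite subsets of `V` closed under
taking subsets. The void complex (`⊥`, no simplex at all) is allowed and differs from the complex
whose only simplex is `∅`; ghost vertices (`{v} ∉ K`) are allowed; `⊤` is the full simplex on `V`
when `V` is finite. -/
abbrev SimplicialCx (V : Type) : Type := LowerSet (Finset V)

namespace SimplicialCx

/-- The boundary of the full simplex on `V`: all subsets of `V` except `V` itself. -/
def simplexBoundary (V : Type) [Fintype V] : SimplicialCx V where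
  carrier := {τ | τ ≠ Finset.univ}
  lower' := by
    intro τ ρ hρ hτ h
    subst h
    exact hτ (Finset.univ_subset_iff.mp hρ)

/-- The link of `σ` in `K`. It is void if `σ ∉ K`. -/
def link {V : Type} [DecidableEq V] (K : SimplicialCx V) (σ : Finset V) : SimplicialCx V where
  carrier := {τ | σ ∪ τ ∈ K ∧ Disjoint σ τ}
  lower' := by
    intro τ ρ hρ hτ
    exact ⟨K.lower (Finset.union_subset_union_right hρ) hτ.1, hτ.2.mono_right hρ⟩

/-- The part of `σ` in the `k`-th block of a disjoint union of vertex sets. -/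
def block {ι : Type} {V : ι → Type} [DecidableEq ι] [∀ k, DecidableEq (V k)] [∀ k, Fintype (V k)]
    (σ : Finset (Σₗ k, V k)) (k : ι) : Finset (V k) :=
  Finset.univ.filter fun i => toLex (⟨k, i⟩ : Σ k, V k) ∈ σ

/-- The polyhedral join of the pairs `(X k, A k)` over `K`: the union over `τ ∈ K` of the joins
`Y 1 * ⋯ * Y m`, where `Y k = X k` for `k ∈ τ` and `Y k = A k` for `k ∉ τ`. Its vertex set is the
disjoint union of the vertex sets `V k`, one block after the other. -/
def polyhedralJoin {ι : Type} {V : ι → Type} [DecidableEq ι] [∀ k, DecidableEq (V k)]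
    [∀ k, Fintype (V k)] (K : SimplicialCx ι) (X A : ∀ k, SimplicialCx (V k)) :
    SimplicialCx (Σₗ k, V k) where
  carrier := {σ | ∃ τ ∈ K, ∀ k, block σ k ∈ if k ∈ τ then X k else A k}
  lower' := by
    rintro σ ρ hρ ⟨τ, hτ, h⟩
    refine ⟨τ, hτ, fun k => LowerSet.lower _ ?_ (h k)⟩
    exact Finset.monotone_filter_right _ fun i _ hi => hρ hi

/-- The composition complex `𝒮(K; L 1, …, L m)`: the polyhedral join of the pairs
(full simplex on `V k`, `L k`) over `K`. -/
def composition {ι : Type} {V : ι → Type} [DecidableEq ι] [∀ k, DecidableEq (V k)]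
    [∀ k, Fintype (V k)] (K : SimplicialCx ι) (L : ∀ k, SimplicialCx (V k)) :
    SimplicialCx (Σₗ k, V k) :=
  polyhedralJoin K (fun _ => ⊤) L

variable {V : Type} [LinearOrder V]

/-- The simplicial boundary of a formal sum of finite subsets of the ordered set `V`:
`∂ {v₀ < ⋯ < v_r} = ∑ i, (-1) ^ i {v₀, …, v_r} \ {v_i}`, and `∂ ∅ = 0`. -/
def simplexBdry (V : Type) [LinearOrder V] : (Finset V →₀ ℤ) →ₗ[ℤ] (Finset V →₀ ℤ) :=
  Finsupp.linearCombination ℤ fun σ : Finset V =>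
    ∑ v ∈ σ, Finsupp.single (σ.erase v) ((-1 : ℤ) ^ (σ.filter (· < v)).card)

theorem simplexBdry_single (σ : Finset V) (c : ℤ) :
    simplexBdry V (Finsupp.single σ c) =
      c • ∑ v ∈ σ, Finsupp.single (σ.erase v) ((-1 : ℤ) ^ (σ.filter (· < v)).card) := by
  simp [simplexBdry]

theorem simplexBdry_sign (σ : Finset V) {v w : V} (hv : v ∈ σ) (hvw : v < w) :
    (-1 : ℤ) ^ (σ.filter (· < v)).card * (-1 : ℤ) ^ ((σ.erase v).filter (· < w)).card
      + (-1 : ℤ) ^ (σ.filter (· < w)).card * (-1 : ℤ) ^ ((σ.erase w).filter (· < v)).card = 0 := by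
  have h1 : (σ.erase w).filter (· < v) = σ.filter (· < v) := by
    ext x
    simp only [Finset.mem_filter, Finset.mem_erase]
    exact ⟨fun h => ⟨h.1.2, h.2⟩, fun h => ⟨⟨(h.2.trans hvw).ne, h.1⟩, h.2⟩⟩
  have h2 : (σ.erase v).filter (· < w) = (σ.filter (· < w)).erase v := by
    ext x
    simp only [Finset.mem_filter, Finset.mem_erase]
    tauto
  have h3 : ((σ.filter (· < w)).erase v).card + 1 = (σ.filter (· < w)).card :=
    Finset.card_erase_add_one (Finset.mem_filter.mpr ⟨hv, hvw⟩)
  rw [h1, h2, ← h3, pow_succ]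
  ring

theorem simplexBdry_simplexBdry (x : Finset V →₀ ℤ) : simplexBdry V (simplexBdry V x) = 0 := by
  induction x using Finsupp.induction_linear with
  | zero => simp
  | add x y hx hy => simp [hx, hy]
  | single σ c =>
    rw [simplexBdry_single, map_smul, map_sum]
    simp only [simplexBdry_single, Finset.smul_sum, Finsupp.smul_single, smul_eq_mul]
    rw [Finset.sum_sigma']
    refine Finset.sum_involution (fun p _ => ⟨p.2, p.1⟩) ?_ ?_ ?_ ?_
    · rintro ⟨v, w⟩ h
      simp only [Finset.mem_sigma, Finset.mem_erase] at h
      obtain ⟨hv, hwv, hw⟩ := h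
      simp only
      rw [Finset.erase_right_comm, ← Finsupp.single_add, ← mul_add]
      rcases lt_or_gt_of_ne hwv with hlt | hlt
      · rw [add_comm, simplexBdry_sign σ hw hlt]; simp
      · rw [simplexBdry_sign σ hv hlt]; simp
    · rintro ⟨v, w⟩ h _ heq
      simp only [Finset.mem_sigma, Finset.mem_erase] at h
      exact h.2.1 (congrArg Sigma.fst heq)
    · rintro ⟨v, w⟩ h
      simp only [Finset.mem_sigma, Finset.mem_erase] at h ⊢
      exact ⟨h.2.2, h.2.1.symm, h.1⟩
    · rintro ⟨v, w⟩ _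
      rfl

/-- The group of simplicial chains of `K` spanned by the simplices with exactly `q` vertices,
that is, the reduced simplicial chains of dimension `q - 1`. -/
def chains (K : SimplicialCx V) (q : ℕ) : Submodule ℤ (Finset V →₀ ℤ) :=
  Finsupp.supported ℤ ℤ {σ | σ ∈ K ∧ σ.card = q}

theorem simplexBdry_mem (K : SimplicialCx V) (q : ℕ) (x : Finset V →₀ ℤ)
    (hx : x ∈ K.chains (q + 1)) : simplexBdry V x ∈ K.chains q := by
  classical
  rw [simplexBdry, Finsupp.linearCombination_apply]
  refine Submodule.sum_mem _ fun σ hσ => Submodule.smul_mem _ _ (Submodule.sum_mem _ fun v hv => ?_)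
  have h := (Finsupp.mem_supported ℤ x).mp hx hσ
  refine Finsupp.single_mem_supported ℤ _ ⟨K.lower (Finset.erase_subset v σ) h.1, ?_⟩
  rw [Finset.card_erase_of_mem hv, h.2, Nat.add_sub_cancel]

/-- The boundary homomorphism of `K` from chains on `q + 1` vertices to chains on `q` vertices;
for `q = 0` it is the augmentation. -/
def boundary (K : SimplicialCx V) (q : ℕ) : K.chains (q + 1) →ₗ[ℤ] K.chains q :=
  (simplexBdry V).restrict (simplexBdry_mem K q)

theorem boundary_comp_boundary (K : SimplicialCx V) (q : ℕ) :
    K.boundary q ∘ₗ K.boundary (q + 1) = 0 := by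
  ext1 x
  exact Subtype.ext (simplexBdry_simplexBdry x.1)

/-- The reduced (augmented) simplicial chain complex of `K`, graded by the number of vertices. -/
def chainComplex (K : SimplicialCx V) : ChainComplex (ModuleCat.{0} ℤ) ℕ :=
  ChainComplex.of (fun q => ModuleCat.of ℤ (K.chains q))
    (fun q => ModuleCat.ofHom (K.boundary q)) fun q => by
      rw [← ModuleCat.ofHom_comp, boundary_comp_boundary]
      rfl

/-- The reduced simplicial cochain complex of `K`: the `ℤ`-dual of the reduced chain complex,
graded by the number of vertices. -/
def cochainComplex (K : SimplicialCx V) : CochainComplex (ModuleCat.{0} ℤ) ℕ :=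
  CochainComplex.of (fun q => ModuleCat.of ℤ (Module.Dual ℤ (K.chains q)))
    (fun q => ModuleCat.ofHom (K.boundary q).dualMap) fun q => by
      rw [← ModuleCat.ofHom_comp, LinearMap.dualMap_comp_dualMap, boundary_comp_boundary]
      ext x y
      exact map_zero x

/-- `redHomology K q` is the reduced integral homology group of `K` of degree `q - 1`.
(There is no reduced homology below degree `-1`.) -/
def redHomology (K : SimplicialCx V) (q : ℕ) : ModuleCat.{0} ℤ :=
  K.chainComplex.homology q

/-- `redCohomology K q` is the reduced integral cohomology group of `K` of degree `q - 1`. -/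
def redCohomology (K : SimplicialCx V) (q : ℕ) : ModuleCat.{0} ℤ :=
  K.cochainComplex.homology q

/-- `K` is homology spherical: its total reduced homology is `ℤ`, that is, one reduced homology
group is isomorphic to `ℤ` and all the others vanish. -/
def HomologySpherical (K : SimplicialCx V) : Prop :=
  ∃ d : ℕ, Nonempty (K.redHomology d ≃ₗ[ℤ] ℤ) ∧ ∀ q, q ≠ d → Subsingleton (K.redHomology q)

/-- `K` is a homological sphere: it is not void, and the link of each of its simplices
(including `∅`, whose link is `K`) is homology spherical. -/
def HomologicalSphere (K : SimplicialCx V) : Prop :=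
  K ≠ ⊥ ∧ ∀ σ ∈ K, (K.link σ).HomologySpherical

end SimplicialCx

end

/-! ### Based complexes over ℤ as square matrices, and their homotopy equivalences -/

noncomputable section

open Matrix
open scoped Kronecker

/-! Fix a block `k` of a polyhedral join of pairs `(X k, A k)` with `A k ≤ X k`. The simplices whose
part outside the block comes from some `τ ∈ K` containing `k`, and whose part in the block lies in
`X k`, form a subcomplex, which is a cone as soon as `X k` is one. Removing it does not change the
homotopy type of the chain complex (`hEquiv_diff`). What remains is a product: the outside part runs
through a difference of two complexes that do not see the pair at `k`, and the part in the block
runs through `A k`. Hence the chain complex is `P ⊗ C(A k)` up to homotopy, with `P` independent of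
`X k` and `A k` (`hEquiv_polyhedralJoin`). For the pair (point, `{∅}`) the second factor is ℤ in
degree zero, and if all pairs are of this kind the join is a copy of `K`. Exchanging these pairs for
the given ones, block by block, costs a tensor factor `C(A k)` each time
(`hEquiv_partialJoin_insert`). Degrees count vertices, which is the shift by one in the statement.

For (1), a free complex with free homology is homotopy equivalent to its homology with zero
differential (`HEquiv.of_basis`), and tensoring with the latter only produces shifted copies.
Transposing all matrices gives cohomology from the same data.

For (2), the total homology of `P ⊗ Q` is infinite cyclic if and only if that of `P` and of `Q` is
(`sph_tens_iff`). The hard direction, where no freeness is known, uses the Smith normal form to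
split `Q` into pieces with at most two generators (`Sph.of_tens`).

For (3) and (4), the link of `σ` in a composition complex is again a polyhedral join
(`lk_composition`), taken over the link in `K` of the set of blocks where `σ` leaves `L k`. By the
criterion behind (2) it is spherical exactly when this link is, the links in the `L k` of the other
blocks of `σ` are, and `σ` fills every block where it leaves `L k` (`sph_lk_composition_iff`).
Letting `σ` vary gives the characterization: if `{k} ∈ K`, every subset of the block is a possible
block of `σ`, so only the full vertex set may be missing from `L k`. -/

/-- A finitely generated free chain complex over `ℤ`, given by a finite homogeneous basis and the
matrix of its differential, which lowers the degree by one. -/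
structure MatCx where
  ι : Type
  [fin : Fintype ι]
  [dec : DecidableEq ι]
  deg : ι → ℤ
  D : Matrix ι ι ℤ
  sq : D * D = 0
  homog : ∀ a b, D a b ≠ 0 → deg b = deg a + 1

attribute [instance] MatCx.fin MatCx.dec

namespace MatCx

/-- The vectors supported in degree `q`. -/
def degPart {β : Type} (deg : β → ℤ) (q : ℤ) : Submodule ℤ (β → ℤ) where
  carrier := {x | ∀ b, x b ≠ 0 → deg b = q}
  zero_mem' := by intro b h; simp at h
  add_mem' := by
    intro x y hx hy b h
    by_cases hxb : x b = 0
    · refine hy b fun hyb => h ?_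
      simp [hxb, hyb]
    · exact hx b hxb
  smul_mem' := by
    intro c x hx b h
    refine hx b fun hxb => h ?_
    simp [hxb]

/-- The homology in degree `q` of a square matrix that is homogeneous for the grading `deg`. -/
abbrev matHomology {β : Type} [Fintype β] (deg : β → ℤ) (D : Matrix β β ℤ) (q : ℤ) : Type :=
  ↥(LinearMap.ker D.mulVecLin ⊓ degPart deg q) ⧸
    (LinearMap.range D.mulVecLin).submoduleOf (LinearMap.ker D.mulVecLin ⊓ degPart deg q)

theorem mem_submoduleOf {M : Type*} [AddCommGroup M] {Z B : Submodule ℤ M} {x : Z} :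
    x ∈ B.submoduleOf Z ↔ (x : M) ∈ B := Iff.rfl

/-- A surjection whose kernel is `B` identifies the subquotient `Z ⧸ B` with its target. -/
theorem nonempty_subquotient_equiv {M Y : Type*} [AddCommGroup M] [AddCommGroup Y]
    (Z B : Submodule ℤ M) (f : Z →ₗ[ℤ] Y) (hf : Function.Surjective f)
    (hk : ∀ x : Z, f x = 0 ↔ (x : M) ∈ B) : Nonempty ((Z ⧸ B.submoduleOf Z) ≃ₗ[ℤ] Y) := by
  have h : B.submoduleOf Z = LinearMap.ker f := by
    ext x
    rw [LinearMap.mem_ker, hk, mem_submoduleOf]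
  exact ⟨(Submodule.quotEquivOfEq _ _ h).trans (f.quotKerEquivOfSurjective hf)⟩

section Homog

variable {α β γ : Type} {d : α → ℤ} {e : β → ℤ} {f : γ → ℤ}

/-- A matrix of degree `k`. -/
def Homog (d : α → ℤ) (e : β → ℤ) (k : ℤ) (F : Matrix α β ℤ) : Prop :=
  ∀ a b, F a b ≠ 0 → d a = e b + k

theorem Homog.transpose {k : ℤ} {F : Matrix α β ℤ} (h : Homog d e k F) : Homog e d (-k) Fᵀ := by
  intro a b hab
  have := h b a hab
  omega

theorem Homog.mul [Fintype β] {k l : ℤ} {F : Matrix α β ℤ} {G : Matrix β γ ℤ}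
    (hF : Homog d e k F) (hG : Homog e f l G) : Homog d f (k + l) (F * G) := by
  intro a c h
  rw [Matrix.mul_apply] at h
  obtain ⟨b, -, hb⟩ := Finset.exists_ne_zero_of_sum_ne_zero h
  have h1 := hF a b (left_ne_zero_of_mul hb)
  have h2 := hG b c (right_ne_zero_of_mul hb)
  omega

theorem homog_one [DecidableEq α] (d : α → ℤ) : Homog d d 0 (1 : Matrix α α ℤ) := by
  intro a b h
  have : a = b := by
    by_contra hab
    exact h (Matrix.one_apply_ne hab)
  simp [this]

theorem Homog.mulVec_mem [Fintype β] {k q : ℤ} {F : Matrix α β ℤ} (h : Homog d e k F)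
    {x : β → ℤ} (hx : x ∈ degPart e q) : F *ᵥ x ∈ degPart d (q + k) := by
  intro a ha
  obtain ⟨b, -, hb⟩ := Finset.exists_ne_zero_of_sum_ne_zero (s := Finset.univ)
    (f := fun b => F a b * x b) ha
  have h1 := h a b (left_ne_zero_of_mul hb)
  have h2 := hx b (right_ne_zero_of_mul hb)
  omega

/-- The component of degree `k` of a matrix. -/
def homogPart (d : α → ℤ) (e : β → ℤ) (k : ℤ) (F : Matrix α β ℤ) : Matrix α β ℤ :=
  fun a b => if d a = e b + k then F a b else 0

theorem homog_homogPart (k : ℤ) (F : Matrix α β ℤ) : Homog d e k (homogPart d e k F) := by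
  intro a b h
  by_contra hab
  exact h (if_neg hab)

theorem Homog.homogPart_eq {k : ℤ} {F : Matrix α β ℤ} (h : Homog d e k F) :
    homogPart d e k F = F := by
  ext a b
  unfold homogPart
  split_ifs with hab
  · rfl
  · by_contra h0
    exact hab (h a b (Ne.symm h0))

theorem homogPart_add (k : ℤ) (F G : Matrix α β ℤ) :
    homogPart d e k (F + G) = homogPart d e k F + homogPart d e k G := by
  ext a b
  simp only [homogPart, Matrix.add_apply]
  split_ifs <;> simp

theorem homogPart_zero (k : ℤ) : homogPart d e k (0 : Matrix α β ℤ) = 0 := by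
  ext a b
  simp [homogPart]

/-- Multiplication by a homogeneous matrix shifts degrees, so it commutes with taking components.
This makes a homotopy homogeneous after it was constructed without regard to the grading. -/
theorem Homog.homogPart_mul [Fintype β] {k l : ℤ} {F : Matrix α β ℤ} (hF : Homog d e k F)
    (G : Matrix β γ ℤ) : homogPart d f (k + l) (F * G) = F * homogPart e f l G := by
  ext a c
  simp only [homogPart, Matrix.mul_apply]
  split_ifs with h
  · refine Finset.sum_congr rfl fun b _ => ?_
    by_cases hb : F a b = 0
    · simp [hb]
    · have := hF a b hb
      rw [if_pos (by omega)]
  · refine (Finset.sum_eq_zero fun b _ => ?_).symm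
    by_cases hb : F a b = 0
    · simp [hb]
    · have := hF a b hb
      rw [if_neg (by omega), mul_zero]

theorem Homog.homogPart_mul' [Fintype β] {k l : ℤ} {G : Matrix β γ ℤ} (hG : Homog e f l G)
    (F : Matrix α β ℤ) : homogPart d f (k + l) (F * G) = homogPart d e k F * G := by
  ext a c
  simp only [homogPart, Matrix.mul_apply]
  split_ifs with h
  · refine Finset.sum_congr rfl fun b _ => ?_
    by_cases hb : G b c = 0
    · simp [hb]
    · have := hG b c hb
      rw [if_pos (by omega)]
  · refine (Finset.sum_eq_zero fun b _ => ?_).symm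
    by_cases hb : G b c = 0
    · simp [hb]
    · have := hG b c hb
      rw [if_neg (by omega), zero_mul]

end Homog

theorem homog_D (C : MatCx) : Homog C.deg C.deg (-1) C.D := by
  intro a b h
  have := C.homog a b h
  omega

theorem D_mulVec_D (C : MatCx) (x : C.ι → ℤ) : C.D *ᵥ (C.D *ᵥ x) = 0 := by
  rw [Matrix.mulVec_mulVec, C.sq, Matrix.zero_mulVec]

/-- Homotopy equivalence of complexes: mutually inverse up to homotopy chain maps of degree zero. -/
def HEquiv (C C' : MatCx) : Prop :=
  ∃ (F : Matrix C'.ι C.ι ℤ) (G : Matrix C.ι C'.ι ℤ) (h : Matrix C.ι C.ι ℤ)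
    (h' : Matrix C'.ι C'.ι ℤ), F * C.D = C'.D * F ∧ G * C'.D = C.D * G ∧
    G * F = 1 + (C.D * h + h * C.D) ∧ F * G = 1 + (C'.D * h' + h' * C'.D) ∧
    Homog C'.deg C.deg 0 F ∧ Homog C.deg C'.deg 0 G

theorem HEquiv.symm {C C' : MatCx} (H : HEquiv C C') : HEquiv C' C := by
  obtain ⟨F, G, h, h', h1, h2, h3, h4, h5, h6⟩ := H
  exact ⟨G, F, h', h, h2, h1, h4, h3, h6, h5⟩

theorem HEquiv.trans {C C' C'' : MatCx} (H : HEquiv C C') (H' : HEquiv C' C'') :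
    HEquiv C C'' := by
  obtain ⟨F, G, h, k, h1, h2, h3, h4, h5, h6⟩ := H
  obtain ⟨F', G', h', k', h1', h2', h3', h4', h5', h6'⟩ := H'
  -- The inner homotopy is transported to the outer complex by conjugation with the chain maps.
  refine ⟨F' * F, G * G', h + G * h' * F, k' + F' * k * G', ?_, ?_, ?_, ?_, ?_, ?_⟩
  · rw [Matrix.mul_assoc, h1, ← Matrix.mul_assoc, h1', Matrix.mul_assoc]
  · rw [Matrix.mul_assoc, h2', ← Matrix.mul_assoc, h2, Matrix.mul_assoc]
  · calc G * G' * (F' * F) = G * (G' * F') * F := by simp only [Matrix.mul_assoc]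
      _ = G * F + ((G * C'.D) * h' * F + G * h' * (C'.D * F)) := by
        rw [h3']; simp only [Matrix.mul_add, Matrix.add_mul, Matrix.mul_one, Matrix.mul_assoc]
      _ = _ := by
        rw [h2, ← h1, h3]
        simp only [Matrix.mul_add, Matrix.add_mul, Matrix.mul_assoc]
        abel
  · calc F' * F * (G * G') = F' * (F * G) * G' := by simp only [Matrix.mul_assoc]
      _ = F' * G' + ((F' * C'.D) * k * G' + F' * k * (C'.D * G')) := by
        rw [h4]; simp only [Matrix.mul_add, Matrix.add_mul, Matrix.mul_one, Matrix.mul_assoc]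
      _ = _ := by
        rw [h1', ← h2', h4']
        simp only [Matrix.mul_add, Matrix.add_mul, Matrix.mul_assoc]
        abel
  · simpa using h5'.mul h5
  · simpa using h6.mul h6'

/-- Matrices `F` and `G` that commute with the differentials and are inverse up to homotopy
identify the homology groups. -/
theorem matHomology_equiv {β γ : Type} [Fintype β] [DecidableEq β] [Fintype γ] [DecidableEq γ]
    {d : β → ℤ} {e : γ → ℤ} {D : Matrix β β ℤ} {E : Matrix γ γ ℤ}
    {F : Matrix γ β ℤ} {G : Matrix β γ ℤ} {h : Matrix β β ℤ} {h' : Matrix γ γ ℤ}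
    (h1 : F * D = E * F) (h2 : G * E = D * G) (h3 : G * F = 1 + (D * h + h * D))
    (h4 : F * G = 1 + (E * h' + h' * E)) (h5 : Homog e d 0 F) (h6 : Homog d e 0 G) (q : ℤ) :
    Nonempty (matHomology d D q ≃ₗ[ℤ] matHomology e E q) := by
  have hF : ∀ x ∈ LinearMap.ker D.mulVecLin ⊓ degPart d q,
      F.mulVecLin x ∈ LinearMap.ker E.mulVecLin ⊓ degPart e q := by
    rintro x ⟨hx, hq⟩
    simp only [SetLike.mem_coe, LinearMap.mem_ker, Matrix.mulVecLin_apply] at hx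
    refine ⟨?_, ?_⟩
    · simp only [SetLike.mem_coe, LinearMap.mem_ker, Matrix.mulVecLin_apply]
      rw [Matrix.mulVec_mulVec, ← h1, ← Matrix.mulVec_mulVec, hx, Matrix.mulVec_zero]
    · simpa using h5.mulVec_mem hq
  refine nonempty_subquotient_equiv _ _
    ((Submodule.mkQ _).comp (F.mulVecLin.restrict hF)) ?_ ?_
  · intro y
    obtain ⟨⟨y, hy, hq⟩, rfl⟩ := Submodule.mkQ_surjective _ y
    simp only [SetLike.mem_coe, LinearMap.mem_ker, Matrix.mulVecLin_apply] at hy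
    have hGy : G *ᵥ y ∈ LinearMap.ker D.mulVecLin ⊓ degPart d q := by
      refine ⟨?_, by simpa using h6.mulVec_mem hq⟩
      simp only [SetLike.mem_coe, LinearMap.mem_ker, Matrix.mulVecLin_apply]
      rw [Matrix.mulVec_mulVec, ← h2, ← Matrix.mulVec_mulVec, hy, Matrix.mulVec_zero]
    refine ⟨⟨G *ᵥ y, hGy⟩, ?_⟩
    rw [LinearMap.comp_apply, ← sub_eq_zero, ← map_sub, Submodule.mkQ_apply,
      Submodule.Quotient.mk_eq_zero, mem_submoduleOf]
    -- On the cycle `y` the term `h' * E` vanishes. The homotopy need not be homogeneous, because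
    -- the quotient is by everything in the range.
    refine ⟨h' *ᵥ y, ?_⟩
    have := congrArg (· *ᵥ y) h4
    simp only [Matrix.add_mulVec, Matrix.one_mulVec, ← Matrix.mulVec_mulVec, hy,
      Matrix.mulVec_zero, add_zero] at this
    simp [LinearMap.restrict_apply, this]
  · rintro ⟨x, hx, hq⟩
    simp only [SetLike.mem_coe, LinearMap.mem_ker, Matrix.mulVecLin_apply] at hx
    rw [LinearMap.comp_apply, Submodule.mkQ_apply,
      Submodule.Quotient.mk_eq_zero, mem_submoduleOf]
    simp only [LinearMap.restrict_apply, LinearMap.mem_range, Matrix.mulVecLin_apply]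
    constructor
    · rintro ⟨y, hy⟩
      -- If `F x = E y`, then `D (G y) = G (F x) = x + D (h x)`.
      refine ⟨G *ᵥ y - h *ᵥ x, ?_⟩
      have := congrArg (· *ᵥ x) h3
      simp only [Matrix.add_mulVec, Matrix.one_mulVec, ← Matrix.mulVec_mulVec, hx,
        Matrix.mulVec_zero, add_zero] at this
      rw [Matrix.mulVec_sub, Matrix.mulVec_mulVec y, ← h2, ← Matrix.mulVec_mulVec, hy, this]
      abel
    · rintro ⟨y, rfl⟩
      exact ⟨F *ᵥ y, by rw [Matrix.mulVec_mulVec, ← h1, ← Matrix.mulVec_mulVec]⟩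

theorem HEquiv.homology {C C' : MatCx} (H : HEquiv C C') (q : ℤ) :
    Nonempty (matHomology C.deg C.D q ≃ₗ[ℤ] matHomology C'.deg C'.D q) := by
  obtain ⟨F, G, h, h', h1, h2, h3, h4, h5, h6⟩ := H
  exact matHomology_equiv h1 h2 h3 h4 h5 h6 q

/-- A homotopy equivalence transposes to one between the transposed matrices, with the two chain
maps exchanging roles. -/
theorem HEquiv.cohomology {C C' : MatCx} (H : HEquiv C C') (q : ℤ) :
    Nonempty (matHomology C.deg C.Dᵀ q ≃ₗ[ℤ] matHomology C'.deg C'.Dᵀ q) := by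
  obtain ⟨F, G, h, h', h1, h2, h3, h4, h5, h6⟩ := H
  refine matHomology_equiv (F := Gᵀ) (G := Fᵀ) (h := hᵀ) (h' := h'ᵀ) ?_ ?_ ?_ ?_
    (by simpa using h6.transpose) (by simpa using h5.transpose) q
  · rw [← Matrix.transpose_mul, ← h2, Matrix.transpose_mul]
  · rw [← Matrix.transpose_mul, ← h1, Matrix.transpose_mul]
  · rw [← Matrix.transpose_mul, h3]
    simp only [Matrix.transpose_add, Matrix.transpose_one, Matrix.transpose_mul]
    abel
  · rw [← Matrix.transpose_mul, h4]
    simp only [Matrix.transpose_add, Matrix.transpose_one, Matrix.transpose_mul]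
    abel

/-- A bijection between the bases that carries one differential to the other up to signs. -/
theorem HEquiv.of_signed {C C' : MatCx} (e : C.ι ≃ C'.ι) (s : C.ι → ℤ) (hs : ∀ a, s a * s a = 1)
    (hdeg : ∀ a, C'.deg (e a) = C.deg a)
    (hD : ∀ a b, C'.D (e a) (e b) = s a * C.D a b * s b) : HEquiv C C' := by
  have hC' : C'.D = Matrix.reindex e e (Matrix.diagonal s * C.D * Matrix.diagonal s) := by
    ext a b
    obtain ⟨a, rfl⟩ := e.surjective a
    obtain ⟨b, rfl⟩ := e.surjective b
    simp [hD, Matrix.diagonal_mul, Matrix.mul_diagonal]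
  have hss : Matrix.diagonal s * Matrix.diagonal s = 1 := by
    rw [Matrix.diagonal_mul_diagonal, ← Matrix.diagonal_one]
    exact congrArg _ (funext hs)
  refine ⟨(Matrix.diagonal s).submatrix e.symm id, (Matrix.diagonal s).submatrix id e.symm, 0, 0,
    ?_, ?_, ?_, ?_, ?_, ?_⟩
  · rw [hC', Matrix.reindex_apply, Matrix.submatrix_mul_equiv, Matrix.mul_assoc, hss,
      Matrix.mul_one]
    change (Matrix.diagonal s).submatrix e.symm (Equiv.refl _) *
      C.D.submatrix (Equiv.refl _) (Equiv.refl _) = _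
    rw [Matrix.submatrix_mul_equiv]
    rfl
  · rw [hC', Matrix.reindex_apply, Matrix.submatrix_mul_equiv, ← Matrix.mul_assoc,
      ← Matrix.mul_assoc, hss, Matrix.one_mul]
    change _ = C.D.submatrix (Equiv.refl _) (Equiv.refl _) *
      (Matrix.diagonal s).submatrix (Equiv.refl _) e.symm
    rw [Matrix.submatrix_mul_equiv]
    rfl
  · rw [Matrix.submatrix_mul_equiv, hss]
    simp
  · change (Matrix.diagonal s).submatrix _ (Equiv.refl _) *
      (Matrix.diagonal s).submatrix (Equiv.refl _) _ = _
    rw [Matrix.submatrix_mul_equiv, hss]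
    simp
  · intro a b h
    have : e.symm a = b := by
      by_contra hab
      exact h (Matrix.diagonal_apply_ne _ hab)
    rw [← this, ← hdeg]
    simp
  · intro a b h
    have : a = e.symm b := by
      by_contra hab
      exact h (Matrix.diagonal_apply_ne _ hab)
    rw [this, ← hdeg]
    simp

/-! ### Tensor products of complexes -/

/-- The sign operator of a grading. -/
def sgn (C : MatCx) : Matrix C.ι C.ι ℤ := Matrix.diagonal fun a => ((C.deg a).negOnePow : ℤ)

theorem sgn_mul_sgn (C : MatCx) : C.sgn * C.sgn = 1 := by
  rw [sgn, Matrix.diagonal_mul_diagonal, ← Matrix.diagonal_one]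
  refine congrArg _ (funext fun a => ?_)
  rw [← Units.val_mul, Int.units_mul_self, Units.val_one]

/-- The differential changes the parity of the degree. This is the Koszul sign rule that makes the
tensor differential square to zero. -/
theorem D_mul_sgn (C : MatCx) : C.D * C.sgn = -(C.sgn * C.D) := by
  ext a b
  rw [sgn, Matrix.neg_apply, Matrix.mul_diagonal, Matrix.diagonal_mul]
  by_cases h : C.D a b = 0
  · simp [h]
  · rw [C.homog a b h, Int.negOnePow_succ]
    simp [mul_comm]

/-- The tensor product of two complexes. -/
abbrev tens (P Q : MatCx) : MatCx where
  ι := P.ι × Q.ι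
  deg p := P.deg p.1 + Q.deg p.2
  D := P.D ⊗ₖ 1 + P.sgn ⊗ₖ Q.D
  sq := by
    rw [Matrix.add_mul, Matrix.mul_add, Matrix.mul_add, ← Matrix.mul_kronecker_mul,
      ← Matrix.mul_kronecker_mul, ← Matrix.mul_kronecker_mul, ← Matrix.mul_kronecker_mul,
      P.sq, Q.sq, P.D_mul_sgn]
    ext ⟨a, b⟩ ⟨c, d⟩
    simp [Matrix.kroneckerMap_apply]
  homog := by
    rintro ⟨a, b⟩ ⟨c, d⟩ h
    simp only [Matrix.add_apply, Matrix.kroneckerMap_apply] at h ⊢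
    by_cases h1 : P.D a c * (1 : Matrix Q.ι Q.ι ℤ) b d = 0
    · rw [h1, zero_add] at h
      have h2 := Q.homog b d (right_ne_zero_of_mul h)
      have h3 : a = c := by
        by_contra hac
        exact left_ne_zero_of_mul h (Matrix.diagonal_apply_ne _ hac)
      rw [h2, h3]; ring
    · have h2 := P.homog a c (left_ne_zero_of_mul h1)
      have h3 : b = d := by
        by_contra hac
        exact right_ne_zero_of_mul h1 (Matrix.one_apply_ne hac)
      rw [h2, h3]; ring

theorem homog_one_kronecker (P : MatCx) {β γ : Type} {d : β → ℤ} {e : γ → ℤ} {F : Matrix β γ ℤ}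
    (h : Homog d e 0 F) : Homog (fun p : P.ι × β => P.deg p.1 + d p.2)
      (fun p : P.ι × γ => P.deg p.1 + e p.2) 0 ((1 : Matrix P.ι P.ι ℤ) ⊗ₖ F) := by
  rintro ⟨a, b⟩ ⟨c, g⟩ hab
  rw [Matrix.kroneckerMap_apply] at hab
  have h2 := h b g (right_ne_zero_of_mul hab)
  have h3 : a = c := by
    by_contra hac
    exact left_ne_zero_of_mul hab (Matrix.one_apply_ne hac)
  simp only
  rw [h2, h3]; ring

/-- The homotopy on the product is `P.sgn ⊗ h`: the sign makes its products with `P.D ⊗ 1` cancel,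
and it squares to one against the sign in front of the second differential. -/
theorem HEquiv.tens_left (P : MatCx) {C C' : MatCx} (H : HEquiv C C') :
    HEquiv (P.tens C) (P.tens C') := by
  obtain ⟨F, G, h, h', h1, h2, h3, h4, h5, h6⟩ := H
  have e1 : ((1 : Matrix P.ι P.ι ℤ) ⊗ₖ F) * (P.D ⊗ₖ 1 + P.sgn ⊗ₖ C.D) =
      (P.D ⊗ₖ 1 + P.sgn ⊗ₖ C'.D) * ((1 : Matrix P.ι P.ι ℤ) ⊗ₖ F) := by
    simp only [Matrix.mul_add, Matrix.add_mul, ← Matrix.mul_kronecker_mul, Matrix.mul_one,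
      Matrix.one_mul, h1]
  have e2 : ((1 : Matrix P.ι P.ι ℤ) ⊗ₖ G) * (P.D ⊗ₖ 1 + P.sgn ⊗ₖ C'.D) =
      (P.D ⊗ₖ 1 + P.sgn ⊗ₖ C.D) * ((1 : Matrix P.ι P.ι ℤ) ⊗ₖ G) := by
    simp only [Matrix.mul_add, Matrix.add_mul, ← Matrix.mul_kronecker_mul, Matrix.mul_one,
      Matrix.one_mul, h2]
  have e3 : ((1 : Matrix P.ι P.ι ℤ) ⊗ₖ G) * ((1 : Matrix P.ι P.ι ℤ) ⊗ₖ F) =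
      1 + ((P.D ⊗ₖ 1 + P.sgn ⊗ₖ C.D) * (P.sgn ⊗ₖ h) +
        (P.sgn ⊗ₖ h) * (P.D ⊗ₖ 1 + P.sgn ⊗ₖ C.D)) := by
    simp only [Matrix.mul_add, Matrix.add_mul, ← Matrix.mul_kronecker_mul, Matrix.mul_one,
      Matrix.one_mul, h3, Matrix.kronecker_add, sgn_mul_sgn, D_mul_sgn,
      Matrix.one_kronecker_one]
    ext ⟨a, b⟩ ⟨c, d⟩
    simp only [Matrix.add_apply, Matrix.kroneckerMap_apply, Matrix.neg_apply]
    ring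
  have e4 : ((1 : Matrix P.ι P.ι ℤ) ⊗ₖ F) * ((1 : Matrix P.ι P.ι ℤ) ⊗ₖ G) =
      1 + ((P.D ⊗ₖ 1 + P.sgn ⊗ₖ C'.D) * (P.sgn ⊗ₖ h') +
        (P.sgn ⊗ₖ h') * (P.D ⊗ₖ 1 + P.sgn ⊗ₖ C'.D)) := by
    simp only [Matrix.mul_add, Matrix.add_mul, ← Matrix.mul_kronecker_mul, Matrix.mul_one,
      Matrix.one_mul, h4, Matrix.kronecker_add, sgn_mul_sgn, D_mul_sgn,
      Matrix.one_kronecker_one]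
    ext ⟨a, b⟩ ⟨c, d⟩
    simp only [Matrix.add_apply, Matrix.kroneckerMap_apply, Matrix.neg_apply]
    ring
  exact ⟨1 ⊗ₖ F, 1 ⊗ₖ G, P.sgn ⊗ₖ h, P.sgn ⊗ₖ h', e1, e2, e3, e4,
    homog_one_kronecker P h5, homog_one_kronecker P h6⟩

/-- The complex with vanishing differential on a graded basis. -/
abbrev zeroCx (I : Type) [Fintype I] [DecidableEq I] (d : I → ℤ) : MatCx where
  ι := I
  deg := d
  D := 0
  sq := by simp
  homog := by intro a b h; simp at h

theorem kronecker_one_mulVec {β I : Type} [Fintype β] [Fintype I] [DecidableEq I]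
    (D : Matrix β β ℤ) (x : β × I → ℤ) (b : β) (i : I) :
    ((D ⊗ₖ (1 : Matrix I I ℤ)) *ᵥ x) (b, i) = (D *ᵥ fun a => x (a, i)) b := by
  simp only [Matrix.mulVec, dotProduct, Fintype.sum_prod_type, Matrix.kroneckerMap_apply,
    Matrix.one_apply, mul_ite, mul_one, mul_zero, ite_mul, zero_mul, Finset.sum_ite_eq,
    Finset.mem_univ, if_true]

/-- Homology of a direct sum of shifted copies of a complex. -/
theorem matHomology_kronecker_one {β I : Type} [Fintype β] [Fintype I] [DecidableEq I]
    (deg : β → ℤ) (d : I → ℤ) (D : Matrix β β ℤ) (N : ℤ) :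
    Nonempty (matHomology (fun p : β × I => deg p.1 + d p.2) (D ⊗ₖ 1) N ≃ₗ[ℤ]
      ∀ i, matHomology deg D (N - d i)) := by
  have hmem : ∀ i (x : β × I → ℤ),
      x ∈ LinearMap.ker (D ⊗ₖ (1 : Matrix I I ℤ)).mulVecLin ⊓
        degPart (fun p : β × I => deg p.1 + d p.2) N →
      LinearMap.funLeft ℤ ℤ (fun a : β => (a, i)) x ∈
        LinearMap.ker D.mulVecLin ⊓ degPart deg (N - d i) := by
    rintro i x ⟨hx, hq⟩
    refine ⟨?_, fun b hb => ?_⟩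
    · simp only [SetLike.mem_coe, LinearMap.mem_ker, Matrix.mulVecLin_apply] at hx ⊢
      ext b
      have := congrFun hx (b, i)
      rwa [kronecker_one_mulVec] at this
    · have := hq (b, i) hb
      simp only at this
      omega
  refine nonempty_subquotient_equiv _ _
    (LinearMap.pi fun i => (Submodule.mkQ _).comp ((LinearMap.funLeft ℤ ℤ _).restrict (hmem i)))
    ?_ ?_
  · intro y
    choose z hz using fun i => Submodule.mkQ_surjective _ (y i)
    refine ⟨⟨fun p => (z p.2).1 p.1, ?_, ?_⟩, ?_⟩
    · simp only [SetLike.mem_coe, LinearMap.mem_ker, Matrix.mulVecLin_apply]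
      ext ⟨b, i⟩
      rw [kronecker_one_mulVec]
      exact congrFun (z i).2.1 b
    · rintro ⟨b, i⟩ hb
      have := (z i).2.2 b hb
      simp only
      omega
    · ext i : 1
      rw [← hz]
      rfl
  · rintro ⟨x, hx⟩
    rw [funext_iff]
    simp only [LinearMap.pi_apply, LinearMap.comp_apply, Pi.zero_apply, Submodule.mkQ_apply,
      Submodule.Quotient.mk_eq_zero, mem_submoduleOf, LinearMap.coe_restrict_apply,
      LinearMap.mem_range, Matrix.mulVecLin_apply]
    constructor
    · intro h
      choose y hy using h
      refine ⟨fun p => y p.2 p.1, ?_⟩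
      ext ⟨b, i⟩
      rw [kronecker_one_mulVec]
      exact congrFun (hy i) b
    · rintro ⟨y, rfl⟩ i
      refine ⟨fun a => y (a, i), ?_⟩
      ext b
      exact (kronecker_one_mulVec D y b i).symm

theorem tens_zeroCx_D (P : MatCx) (I : Type) [Fintype I] [DecidableEq I] (d : I → ℤ) :
    (P.tens (zeroCx I d)).D = P.D ⊗ₖ (1 : Matrix I I ℤ) := by
  change P.D ⊗ₖ (1 : Matrix I I ℤ) + P.sgn ⊗ₖ (0 : Matrix I I ℤ) = _
  simp

theorem homology_tens_zeroCx (P : MatCx) (I : Type) [Fintype I] [DecidableEq I] (d : I → ℤ)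
    (N : ℤ) : Nonempty (matHomology (P.tens (zeroCx I d)).deg (P.tens (zeroCx I d)).D N ≃ₗ[ℤ]
      ∀ i, matHomology P.deg P.D (N - d i)) := by
  rw [tens_zeroCx_D]
  exact matHomology_kronecker_one P.deg d P.D N

theorem cohomology_tens_zeroCx (P : MatCx) (I : Type) [Fintype I] [DecidableEq I] (d : I → ℤ)
    (N : ℤ) : Nonempty (matHomology (P.tens (zeroCx I d)).deg (P.tens (zeroCx I d)).Dᵀ N ≃ₗ[ℤ]
      ∀ i, matHomology P.deg P.Dᵀ (N - d i)) := by
  have h : (P.tens (zeroCx I d)).Dᵀ = P.Dᵀ ⊗ₖ (1 : Matrix I I ℤ) := by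
    have h1 : (P.D ⊗ₖ (1 : Matrix I I ℤ))ᵀ = P.Dᵀ ⊗ₖ (1 : Matrix I I ℤ) := by
      rw [← Matrix.kroneckerMap_transpose, Matrix.transpose_one]
    exact (congrArg Matrix.transpose (tens_zeroCx_D P I d)).trans h1
  rw [h]
  exact matHomology_kronecker_one P.deg d P.Dᵀ N

end MatCx

/-! ### Infinite cyclic total homology, and complexes with free homology -/

namespace MatCx

/-- The vector `v` is a boundary for the square matrix `D`. -/
def Bdry {β : Type} [Fintype β] (D : Matrix β β ℤ) (v : β → ℤ) : Prop := ∃ w, D *ᵥ w = v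

section Bdry

variable {β : Type} [Fintype β] {D : Matrix β β ℤ} {v w : β → ℤ}

theorem bdry_mulVec (D : Matrix β β ℤ) (v : β → ℤ) : Bdry D (D *ᵥ v) := ⟨v, rfl⟩

theorem bdry_zero (D : Matrix β β ℤ) : Bdry D 0 := ⟨0, Matrix.mulVec_zero D⟩

theorem Bdry.add (hv : Bdry D v) (hw : Bdry D w) : Bdry D (v + w) := by
  obtain ⟨x, rfl⟩ := hv
  obtain ⟨y, rfl⟩ := hw
  exact ⟨x + y, Matrix.mulVec_add D x y⟩

theorem Bdry.smul (c : ℤ) (hv : Bdry D v) : Bdry D (c • v) := by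
  obtain ⟨x, rfl⟩ := hv
  exact ⟨c • x, Matrix.mulVec_smul D c x⟩

theorem Bdry.neg (hv : Bdry D v) : Bdry D (-v) := by
  simpa using hv.smul (-1)

theorem Bdry.sub (hv : Bdry D v) (hw : Bdry D w) : Bdry D (v - w) := by
  rw [sub_eq_add_neg]
  exact hv.add hw.neg

theorem Bdry.sum {J : Type} (s : Finset J) {f : J → β → ℤ} (h : ∀ j ∈ s, Bdry D (f j)) :
    Bdry D (∑ j ∈ s, f j) :=
  Finset.sum_induction f (Bdry D) (fun _ _ => Bdry.add) (bdry_zero D) h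

end Bdry

/-- The class of the cycle `x` is a basis of the total homology. -/
def IsGen {β : Type} [Fintype β] (D : Matrix β β ℤ) (x : β → ℤ) : Prop :=
  D *ᵥ x = 0 ∧ (∀ c : ℤ, Bdry D (c • x) → c = 0) ∧
    ∀ y, D *ᵥ y = 0 → ∃ c : ℤ, Bdry D (y - c • x)

/-- The total homology is infinite cyclic. -/
def Sph (C : MatCx) : Prop := ∃ x, IsGen C.D x

theorem HEquiv.sph {C C' : MatCx} (H : HEquiv C C') (hC : C.Sph) : C'.Sph := by
  obtain ⟨F, G, h, h', h1, h2, h3, h4, -, -⟩ := H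
  obtain ⟨x, hx, hx1, hx2⟩ := hC
  have hF : ∀ y, F *ᵥ (C.D *ᵥ y) = C'.D *ᵥ (F *ᵥ y) := fun y => by
    rw [Matrix.mulVec_mulVec, h1, ← Matrix.mulVec_mulVec]
  have hG : ∀ y, G *ᵥ (C'.D *ᵥ y) = C.D *ᵥ (G *ᵥ y) := fun y => by
    rw [Matrix.mulVec_mulVec, h2, ← Matrix.mulVec_mulVec]
  refine ⟨F *ᵥ x, ?_, fun c hc => hx1 c ?_, fun y hy => ?_⟩
  · rw [← hF, hx, Matrix.mulVec_zero]
  · obtain ⟨w, hw⟩ := hc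
    have hcx : C.D *ᵥ (c • x) = 0 := by rw [Matrix.mulVec_smul, hx, smul_zero]
    have := congrArg (· *ᵥ (c • x)) h3
    simp only [Matrix.add_mulVec, Matrix.one_mulVec, ← Matrix.mulVec_mulVec, hcx,
      Matrix.mulVec_zero, add_zero] at this
    rw [Matrix.mulVec_smul F, ← hw, hG] at this
    have h5 : c • x = C.D *ᵥ (G *ᵥ w) - C.D *ᵥ (h *ᵥ (c • x)) := by
      rw [this]
      abel
    rw [h5]
    exact (bdry_mulVec _ _).sub (bdry_mulVec _ _)
  · obtain ⟨c, w, hw⟩ := hx2 (G *ᵥ y) (by rw [← hG, hy, Matrix.mulVec_zero])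
    refine ⟨c, ?_⟩
    have := congrArg (· *ᵥ y) h4
    simp only [Matrix.add_mulVec, Matrix.one_mulVec, ← Matrix.mulVec_mulVec, hy,
      Matrix.mulVec_zero, add_zero] at this
    have h5 : y - c • (F *ᵥ x) = C'.D *ᵥ (F *ᵥ w) - C'.D *ᵥ (h' *ᵥ y) := by
      rw [← hF, hw, Matrix.mulVec_sub, this, Matrix.mulVec_smul]
      abel
    rw [h5]
    exact (bdry_mulVec _ _).sub (bdry_mulVec _ _)

theorem HEquiv.sph_iff {C C' : MatCx} (H : HEquiv C C') : C.Sph ↔ C'.Sph := ⟨H.sph, H.symm.sph⟩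

/-- The component of degree `r` of a vector. -/
def proj {β : Type} (deg : β → ℤ) (r : ℤ) (x : β → ℤ) : β → ℤ :=
  fun b => if deg b = r then x b else 0

theorem proj_mem {β : Type} (deg : β → ℤ) (r : ℤ) (x : β → ℤ) : proj deg r x ∈ degPart deg r := by
  intro b hb
  by_contra h
  exact hb (if_neg h)

theorem proj_of_mem {β : Type} {deg : β → ℤ} {r : ℤ} {x : β → ℤ} (h : x ∈ degPart deg r) :
    proj deg r x = x := by
  ext b
  unfold proj
  split_ifs with hb
  · rfl
  · by_contra h0
    exact hb (h b (Ne.symm h0))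

theorem proj_of_mem_ne {β : Type} {deg : β → ℤ} {r q : ℤ} {x : β → ℤ} (h : x ∈ degPart deg r)
    (hq : q ≠ r) : proj deg q x = 0 := by
  ext b
  unfold proj
  split_ifs with hb
  · by_contra h0
    exact hq (hb.symm.trans (h b h0))
  · rfl

theorem proj_sub {β : Type} (deg : β → ℤ) (r : ℤ) (x y : β → ℤ) :
    proj deg r (x - y) = proj deg r x - proj deg r y := by
  ext b
  simp only [proj, Pi.sub_apply]
  split_ifs <;> simp

theorem proj_smul {β : Type} (deg : β → ℤ) (r : ℤ) (c : ℤ) (x : β → ℤ) :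
    proj deg r (c • x) = c • proj deg r x := by
  ext b
  simp only [proj, Pi.smul_apply]
  split_ifs <;> simp

theorem sum_proj {β : Type} [Fintype β] (deg : β → ℤ) (x : β → ℤ) :
    ∑ r ∈ Finset.univ.image deg, proj deg r x = x := by
  ext b
  simp [proj, Finset.sum_apply]

theorem D_mulVec_proj (C : MatCx) (r : ℤ) (x : C.ι → ℤ) :
    C.D *ᵥ proj C.deg (r + 1) x = proj C.deg r (C.D *ᵥ x) := by
  ext a
  simp only [proj, Matrix.mulVec, dotProduct]
  split_ifs with h
  · refine Finset.sum_congr rfl fun b _ => ?_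
    by_cases hb : C.D a b = 0
    · simp [hb]
    · rw [if_pos (by rw [C.homog a b hb, h])]
  · refine Finset.sum_eq_zero fun b _ => ?_
    by_cases hb : C.D a b = 0
    · simp [hb]
    · have := C.homog a b hb
      rw [if_neg (by omega), mul_zero]

theorem Bdry.proj {C : MatCx} {x : C.ι → ℤ} (h : Bdry C.D x) (r : ℤ) :
    Bdry C.D (proj C.deg r x) := by
  obtain ⟨w, rfl⟩ := h
  exact ⟨_, D_mulVec_proj C r w⟩

theorem D_mulVec_proj_eq_zero {C : MatCx} {x : C.ι → ℤ} (h : C.D *ᵥ x = 0) (r : ℤ) :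
    C.D *ᵥ MatCx.proj C.deg r x = 0 := by
  have := D_mulVec_proj C (r - 1) x
  rw [sub_add_cancel, h] at this
  rw [this]
  ext b
  simp [MatCx.proj]

/-- The generator of an infinite cyclic total homology can be chosen homogeneous. -/
theorem Sph.exists_homog {C : MatCx} (h : C.Sph) : ∃ q, ∃ x ∈ degPart C.deg q, IsGen C.D x := by
  obtain ⟨x, hx, hx1, hx2⟩ := h
  -- Each homogeneous component of `x` is a cycle, homologous to `c r • x`. Summing over `r` gives
  -- `∑ c r = 1`, so some `c r` is nonzero.
  choose c hc using fun r => hx2 _ (D_mulVec_proj_eq_zero hx r)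
  have hsum : Bdry C.D ((1 - ∑ r ∈ Finset.univ.image C.deg, c r) • x) := by
    have := Bdry.sum (Finset.univ.image C.deg) fun r _ => hc r
    rwa [Finset.sum_sub_distrib, sum_proj, ← Finset.sum_smul, ← one_smul ℤ x, smul_smul, mul_one,
      ← sub_smul] at this
  have h1 := hx1 _ hsum
  obtain ⟨r, -, hr⟩ := Finset.exists_ne_zero_of_sum_ne_zero
    (s := Finset.univ.image C.deg) (f := c) (by intro h0; rw [h0] at h1; simp at h1)
  -- Projecting the relation for `r` to degree `r` once more shows that `c r` is idempotent, hence
  -- one.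
  have h2 : Bdry C.D ((1 - c r) • MatCx.proj C.deg r x) := by
    have := (hc r).proj r
    rwa [proj_sub, proj_smul, proj_of_mem (proj_mem _ _ _), ← one_smul ℤ (MatCx.proj C.deg r x),
      smul_smul, mul_one, ← sub_smul] at this
  have h3 : Bdry C.D (((1 - c r) * c r) • x) := by
    have := h2.sub ((hc r).smul (1 - c r))
    rwa [smul_sub, sub_sub_cancel, smul_smul] at this
  have h4 : c r = 1 := by
    rcases mul_eq_zero.mp (hx1 _ h3) with h | h
    · omega
    · exact absurd h hr
  have h5 : Bdry C.D (MatCx.proj C.deg r x - x) := by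
    have := hc r
    rwa [h4, one_smul] at this
  refine ⟨r, MatCx.proj C.deg r x, proj_mem _ _ _, D_mulVec_proj_eq_zero hx r, fun k hk => ?_,
    fun y hy => ?_⟩
  · refine hx1 k ?_
    have := hk.sub (h5.smul k)
    rwa [smul_sub, sub_sub_cancel] at this
  · obtain ⟨k, hk⟩ := hx2 y hy
    refine ⟨k, ?_⟩
    have := hk.sub (h5.smul k)
    convert this using 1
    rw [smul_sub]
    abel

/-- A complex whose homology has a basis of homogeneous cycles `z i` is homotopy equivalent to
its homology. -/
theorem HEquiv.of_basis (Q : MatCx) {I : Type} [Fintype I] [DecidableEq I] (d : I → ℤ)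
    (z : I → Q.ι → ℤ) (hz : ∀ i, z i ∈ degPart Q.deg (d i)) (hc : ∀ i, Q.D *ᵥ z i = 0)
    (hspan : ∀ x, Q.D *ᵥ x = 0 → ∃ c : I → ℤ, Bdry Q.D (x - ∑ i, c i • z i))
    (hind : ∀ c : I → ℤ, Bdry Q.D (∑ i, c i • z i) → c = 0) : HEquiv Q (zeroCx I d) := by
  set T := Q.D.mulVecLin with hT
  -- The boundaries form a submodule of a finitely generated free ℤ-module, hence are projective,
  -- and the differential has a section `t` over them.
  obtain ⟨t, ht⟩ := Module.projective_lifting_property T.rangeRestrict LinearMap.id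
    T.surjective_rangeRestrict
  have ht' : ∀ b : LinearMap.range T, Q.D *ᵥ (t b) = b := fun b =>
    congrArg Subtype.val (LinearMap.congr_fun ht b)
  let Z := LinearMap.ker T
  let G0 : (I → ℤ) →ₗ[ℤ] (Q.ι → ℤ) := Fintype.linearCombination ℤ z
  have hG0 : ∀ c, G0 c = ∑ i, c i • z i := fun c => rfl
  have hG0Z : ∀ c, G0 c ∈ Z := by
    intro c
    rw [hG0]
    exact Submodule.sum_mem _ fun i _ => Submodule.smul_mem _ _ (hc i)
  let e0 : (I → ℤ) →ₗ[ℤ] (Z ⧸ (LinearMap.range T).submoduleOf Z) :=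
    (Submodule.mkQ _).comp (G0.codRestrict Z hG0Z)
  have he0 : Function.Bijective e0 := by
    constructor
    · rw [injective_iff_map_eq_zero]
      intro c h
      rw [LinearMap.comp_apply, Submodule.mkQ_apply, Submodule.Quotient.mk_eq_zero,
        mem_submoduleOf] at h
      exact hind c h
    · intro y
      obtain ⟨⟨x, hx⟩, rfl⟩ := Submodule.mkQ_surjective _ y
      obtain ⟨c, hc⟩ := hspan x hx
      refine ⟨c, ?_⟩
      rw [LinearMap.comp_apply, eq_comm, ← sub_eq_zero, ← map_sub, Submodule.mkQ_apply,
        Submodule.Quotient.mk_eq_zero, mem_submoduleOf]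
      exact hc
  let e := LinearEquiv.ofBijective e0 he0
  let φ : Z →ₗ[ℤ] (I → ℤ) := e.symm.toLinearMap.comp (Submodule.mkQ _)
  have hφ : ∀ x : Z, (x : Q.ι → ℤ) - G0 (φ x) ∈ LinearMap.range T := by
    intro x
    have h1 : e0 (φ x) = Submodule.mkQ _ x := e.apply_symm_apply _
    rw [LinearMap.comp_apply, eq_comm, ← sub_eq_zero, ← map_sub, Submodule.mkQ_apply,
      Submodule.Quotient.mk_eq_zero, mem_submoduleOf] at h1
    exact h1
  have hφG : ∀ c, φ ⟨G0 c, hG0Z c⟩ = c := fun c => e.symm_apply_apply c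
  have hφB : ∀ x : Z, (x : Q.ι → ℤ) ∈ LinearMap.range T → φ x = 0 := by
    intro x hx
    have : Submodule.mkQ ((LinearMap.range T).submoduleOf Z) x = 0 := by
      rwa [Submodule.mkQ_apply, Submodule.Quotient.mk_eq_zero]
    simp only [φ, LinearMap.comp_apply, this, map_zero]
  -- The projection onto the cycles along the image of `t`.
  let u0 : (Q.ι → ℤ) →ₗ[ℤ] (Q.ι → ℤ) := LinearMap.id - t.comp T.rangeRestrict
  have hu0 : ∀ x, u0 x ∈ Z := by
    intro x
    simp only [Z, LinearMap.mem_ker, u0, LinearMap.sub_apply, LinearMap.id_apply, map_sub,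
      LinearMap.comp_apply]
    rw [sub_eq_zero]
    exact (ht' (T.rangeRestrict x)).symm
  let u := u0.codRestrict Z hu0
  have hu : ∀ x : Q.ι → ℤ, x ∈ Z → u0 x = x := by
    intro x hx
    have : T.rangeRestrict x = 0 := Subtype.ext hx
    simp [u0, this]
  -- A cycle minus the representative of its class is a boundary, and `t` lifts it. This is the
  -- homotopy `h1`.
  let ρ0 : Z →ₗ[ℤ] (Q.ι → ℤ) := Z.subtype - G0.comp φ
  let ρ := ρ0.codRestrict (LinearMap.range T) hφ
  let F1 := LinearMap.toMatrix' (φ.comp u)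
  let h1 := LinearMap.toMatrix' (t.comp (ρ.comp u))
  let G := LinearMap.toMatrix' G0
  have hDZ : ∀ x, T x ∈ Z := fun x => Q.D_mulVec_D x
  have hD : Q.D = LinearMap.toMatrix' T := by
    rw [hT, ← Matrix.toLin'_apply', LinearMap.toMatrix'_toLin']
  have hFG : F1 * G = 1 := by
    rw [← LinearMap.toMatrix'_comp, ← LinearMap.toMatrix'_id]
    congr 1
    refine LinearMap.ext fun c => ?_
    have : u (G0 c) = ⟨G0 c, hG0Z c⟩ := Subtype.ext (hu _ (hG0Z c))
    simp only [LinearMap.comp_apply, this, hφG, LinearMap.id_apply]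
  have hDG : Q.D * G = 0 := by
    rw [hD, ← LinearMap.toMatrix'_comp, ← map_zero (LinearMap.toMatrix' (R := ℤ))]
    congr 1
    exact LinearMap.ext fun c => hG0Z c
  have hFD : F1 * Q.D = 0 := by
    rw [hD, ← LinearMap.toMatrix'_comp, ← map_zero (LinearMap.toMatrix' (R := ℤ))]
    congr 1
    refine LinearMap.ext fun x => ?_
    refine hφB _ ?_
    change u0 (T x) ∈ _
    rw [hu _ (hDZ x)]
    exact ⟨x, rfl⟩
  have hGF : G * F1 + (Q.D * h1 + h1 * Q.D) = 1 := by
    rw [hD, ← LinearMap.toMatrix'_comp, ← LinearMap.toMatrix'_comp, ← LinearMap.toMatrix'_comp,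
      ← map_add, ← map_add, ← LinearMap.toMatrix'_id]
    congr 1
    refine LinearMap.ext fun x => ?_
    have e1 : T (t (ρ (u x))) = u0 x - G0 (φ (u x)) := ht' _
    have e2 : t (ρ (u (T x))) = x - u0 x := by
      have e3 : ρ (u (T x)) = T.rangeRestrict x := by
        refine Subtype.ext ?_
        change u0 (T x) - G0 (φ (u (T x))) = T x
        rw [hφB, map_zero, hu _ (hDZ x), sub_zero]
        change u0 (T x) ∈ _
        rw [hu _ (hDZ x)]
        exact ⟨x, rfl⟩
      rw [e3]
      simp [u0]
    simp only [LinearMap.add_apply, LinearMap.comp_apply, LinearMap.id_apply, e1, e2]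
    abel
  have hGh : Homog Q.deg d 0 G := by
    intro a i hai
    rw [add_zero]
    refine hz i a ?_
    have : G a i = z i a := by
      simp [G, LinearMap.toMatrix'_apply, hG0, Pi.single_apply, Finset.sum_apply, ite_apply]
    rwa [← this]
  -- The section `t` may mix degrees, and so may `F1` and `h1`. Since `G` and `Q.D` are homogeneous,
  -- all identities survive passing to the components of degree 0 and 1.
  let F := homogPart d Q.deg 0 F1
  let h := homogPart Q.deg Q.deg 1 h1
  have k1 : F * Q.D = 0 := by
    have := Q.homog_D.homogPart_mul' (d := d) (k := 0) F1
    rw [hFD, homogPart_zero] at this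
    exact this.symm
  have k2 : F * G = 1 := by
    have := hGh.homogPart_mul' (d := d) (k := 0) F1
    rw [hFG] at this
    exact this.symm.trans (homog_one d).homogPart_eq
  have k3 : G * F + (Q.D * h + h * Q.D) = 1 := by
    have a1 := hGh.homogPart_mul (f := Q.deg) (l := 0) F1
    have a2 := Q.homog_D.homogPart_mul (f := Q.deg) (l := 1) h1
    have a3 := Q.homog_D.homogPart_mul' (d := Q.deg) (k := 1) h1
    have a4 : homogPart Q.deg Q.deg 0 (1 : Matrix Q.ι Q.ι ℤ) = 1 := (homog_one _).homogPart_eq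
    rw [← hGF, homogPart_add, homogPart_add] at a4
    rw [hGF] at a4
    rw [← a4]
    exact (congrArg₂ _ a1 (congrArg₂ _ a2 a3)).symm
  have l1 : F * Q.D = (0 : Matrix I I ℤ) * F := by rw [k1, Matrix.zero_mul]
  have l2 : G * (0 : Matrix I I ℤ) = Q.D * G := by rw [hDG, Matrix.mul_zero]
  have l3 : G * F = 1 + (Q.D * (-h) + (-h) * Q.D) := by
    rw [← k3, Matrix.mul_neg, Matrix.neg_mul]
    abel
  have l4 : F * G = 1 + ((0 : Matrix I I ℤ) * (0 : Matrix I I ℤ) +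
      (0 : Matrix I I ℤ) * (0 : Matrix I I ℤ)) := by
    rw [k2]; simp
  exact ⟨F, G, -h, (0 : Matrix I I ℤ), l1, l2, l3, l4, homog_homogPart _ _, hGh⟩

/-- A complex with free homology is homotopy equivalent to its homology. -/
theorem exists_hEquiv_zeroCx (Q : MatCx)
    (hfree : ∀ q, Module.Free ℤ (matHomology Q.deg Q.D q)) :
    ∃ (I : Type) (_ : Fintype I) (_ : DecidableEq I) (d : I → ℤ), HEquiv Q (zeroCx I d) := by
  classical
  -- Only degrees that occur can carry homology; restricting to them keeps the basis finite.
  let S := Finset.univ.image Q.deg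
  let X : S → Type := fun q => Module.Free.ChooseBasisIndex ℤ (matHomology Q.deg Q.D q)
  let b : ∀ q : S, Module.Basis (X q) ℤ (matHomology Q.deg Q.D q) :=
    fun q => Module.Free.chooseBasis ℤ _
  have : ∀ q : S, Fintype (X q) := fun q => Module.Free.ChooseBasisIndex.fintype ℤ _
  choose z hz using fun (q : S) (j : X q) => Submodule.mkQ_surjective _ (b q j)
  have key : ∀ (q : S) (c : X q → ℤ), ∑ j, c j • b q j = Submodule.mkQ _ (∑ j, c j • z q j) := by
    intro q c
    rw [map_sum]
    exact Finset.sum_congr rfl fun j _ => by rw [map_smul, hz]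
  refine ⟨Σ q, X q, inferInstance, inferInstance, fun i => i.1,
    HEquiv.of_basis Q _ (fun i => z i.1 i.2) (fun i => (z i.1 i.2).2.2)
      (fun i => (z i.1 i.2).2.1) ?_ ?_⟩
  · intro x hx
    have hp : ∀ q : S, proj Q.deg q x ∈ LinearMap.ker Q.D.mulVecLin ⊓ degPart Q.deg q := fun q =>
      ⟨D_mulVec_proj_eq_zero hx _, proj_mem _ _ _⟩
    refine ⟨fun i => (b i.1).repr (Submodule.mkQ _ ⟨_, hp i.1⟩) i.2, ?_⟩
    rw [Fintype.sum_sigma]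
    nth_rewrite 1 [← sum_proj Q.deg x]
    rw [← Finset.sum_coe_sort S, ← Finset.sum_sub_distrib]
    refine Bdry.sum _ fun q _ => ?_
    have h1 := (b q).sum_repr (Submodule.mkQ _ ⟨_, hp q⟩)
    rw [key, eq_comm, ← sub_eq_zero, ← map_sub, Submodule.mkQ_apply,
      Submodule.Quotient.mk_eq_zero, mem_submoduleOf] at h1
    simp only [Submodule.coe_sub, Submodule.coe_sum, Submodule.coe_smul] at h1
    exact h1
  · intro c h
    rw [Fintype.sum_sigma] at h
    ext ⟨q, j⟩
    -- A relation between basis cycles splits into its degrees, where the chosen bases are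
    -- independent.
    have hq := Bdry.proj h q
    have h2 : proj Q.deg q (∑ r : S, ∑ j, c ⟨r, j⟩ • (z r j : Q.ι → ℤ)) =
        ∑ j, c ⟨q, j⟩ • (z q j : Q.ι → ℤ) := by
      have hm : ∀ r : S, ∑ j, c ⟨r, j⟩ • (z r j : Q.ι → ℤ) ∈ degPart Q.deg r := fun r =>
        Submodule.sum_mem _ fun j _ => Submodule.smul_mem _ _ (z r j).2.2
      ext a
      simp only [proj, Finset.sum_apply (a := a)]
      split_ifs with ha
      · rw [Finset.sum_eq_single q]
        · intro r _ hr
          by_contra h0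
          rw [← Finset.sum_apply] at h0
          exact hr (Subtype.ext ((hm r a h0).symm.trans ha))
        · simp
      · by_contra h0
        rw [← Finset.sum_apply] at h0
        exact ha (hm q a (Ne.symm h0))
    rw [h2] at hq
    have h3 : ∑ j, c ⟨q, j⟩ • b q j = 0 := by
      rw [key, Submodule.mkQ_apply, Submodule.Quotient.mk_eq_zero, mem_submoduleOf]
      simp only [Submodule.coe_sum, Submodule.coe_smul]
      exact hq
    exact Fintype.linearIndependent_iff.mp (b q).linearIndependent _ h3 j

end MatCx

/-! ### When a tensor product has infinite cyclic homology -/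

namespace MatCx

theorem tens_D_mulVec (P Q : MatCx) (w : P.ι × Q.ι → ℤ) (a : P.ι) (b : Q.ι) :
    ((P.tens Q).D *ᵥ w) (a, b) = (P.D *ᵥ fun a' => w (a', b)) a +
      ((P.deg a).negOnePow : ℤ) * (Q.D *ᵥ fun b' => w (a, b')) b := by
  have h : (P.sgn ⊗ₖ Q.D) *ᵥ w = fun p => ((P.deg p.1).negOnePow : ℤ) *
      (Q.D *ᵥ fun b' => w (p.1, b')) p.2 := by
    ext ⟨a, b⟩
    simp [Matrix.mulVec, dotProduct, Fintype.sum_prod_type, Matrix.kroneckerMap_apply, sgn,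
      Matrix.diagonal_apply, Finset.mul_sum, mul_assoc]
  change ((P.D ⊗ₖ (1 : Matrix Q.ι Q.ι ℤ) + P.sgn ⊗ₖ Q.D) *ᵥ w) (a, b) = _
  rw [Matrix.add_mulVec, Pi.add_apply, kronecker_one_mulVec, h]

/-- The tensor product of two vectors. -/
def tmul {β γ : Type} (x : β → ℤ) (y : γ → ℤ) : β × γ → ℤ := fun p => x p.1 * y p.2

/-- Contraction of the second tensor factor by a linear form. -/
def contract {β γ : Type} (φ : (γ → ℤ) →ₗ[ℤ] ℤ) (w : β × γ → ℤ) : β → ℤ :=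
  fun a => φ fun b => w (a, b)

section Contract

variable {β γ : Type} (φ : (γ → ℤ) →ₗ[ℤ] ℤ)

theorem tmul_smul_left (c : ℤ) (x : β → ℤ) (y : γ → ℤ) : tmul (c • x) y = c • tmul x y := by
  ext p
  simp [tmul, mul_assoc]

theorem tmul_smul_right (c : ℤ) (x : β → ℤ) (y : γ → ℤ) : tmul x (c • y) = c • tmul x y := by
  ext p
  simp [tmul, mul_left_comm]

theorem contract_sub (v w : β × γ → ℤ) : contract φ (v - w) = contract φ v - contract φ w :=
  funext fun _ => map_sub φ _ _

theorem contract_smul (c : ℤ) (v : β × γ → ℤ) : contract φ (c • v) = c • contract φ v :=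
  funext fun _ => map_smul φ _ _

theorem contract_tmul (x : β → ℤ) (y : γ → ℤ) : contract φ (tmul x y) = φ y • x := by
  ext a
  have h : (fun b => tmul x y (a, b)) = x a • y := rfl
  rw [contract, h, map_smul, smul_eq_mul, Pi.smul_apply, smul_eq_mul, mul_comm]

end Contract

variable {P Q : MatCx}

theorem sgn_mulVec_sgn (x : P.ι → ℤ) : P.sgn *ᵥ (P.sgn *ᵥ x) = x := by
  rw [Matrix.mulVec_mulVec, P.sgn_mul_sgn, Matrix.one_mulVec]

theorem D_mulVec_sgn (x : P.ι → ℤ) : P.D *ᵥ (P.sgn *ᵥ x) = -(P.sgn *ᵥ (P.D *ᵥ x)) := by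
  rw [Matrix.mulVec_mulVec, P.D_mul_sgn, Matrix.neg_mulVec, Matrix.mulVec_mulVec]

theorem tens_D_mulVec_tmul (x : P.ι → ℤ) (y : Q.ι → ℤ) :
    (P.tens Q).D *ᵥ tmul x y = tmul (P.D *ᵥ x) y + tmul (P.sgn *ᵥ x) (Q.D *ᵥ y) := by
  ext ⟨a, b⟩
  rw [tens_D_mulVec]
  have h1 : (fun a' => tmul x y (a', b)) = y b • x := by
    ext a'
    simp [tmul, mul_comm]
  have h2 : (fun b' => tmul x y (a, b')) = x a • y := rfl
  rw [h1, h2, Matrix.mulVec_smul, Matrix.mulVec_smul]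
  simp only [Pi.smul_apply, Pi.add_apply, tmul, sgn, Matrix.mulVec_diagonal, smul_eq_mul]
  ring

/-- Consequently contraction with a form that vanishes on the boundaries of `Q` is a chain map from
the tensor product to `P`. For other forms the last term measures the defect. -/
theorem contract_tens_D (φ : (Q.ι → ℤ) →ₗ[ℤ] ℤ) (w : P.ι × Q.ι → ℤ) :
    contract φ ((P.tens Q).D *ᵥ w) =
      P.D *ᵥ contract φ w + P.sgn *ᵥ contract (φ.comp Q.D.mulVecLin) w := by
  ext a
  have h : (fun b => ((P.tens Q).D *ᵥ w) (a, b)) =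
      (∑ a', P.D a a' • fun b => w (a', b)) +
        ((P.deg a).negOnePow : ℤ) • (Q.D *ᵥ fun b' => w (a, b')) := by
    ext b
    rw [tens_D_mulVec]
    simp [Matrix.mulVec, dotProduct, Finset.sum_apply, -Int.coe_negOnePow]
  refine (congrArg φ h).trans ?_
  rw [map_add, map_sum, map_smul, Pi.add_apply, sgn, Matrix.mulVec_diagonal]
  simp only [map_smul]
  rfl

theorem Sph.tens_zeroCx (h : P.Sph) (q : ℤ) : (P.tens (zeroCx Unit fun _ => q)).Sph := by
  obtain ⟨x, hx, hx1, hx2⟩ := h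
  have key : ∀ w : P.ι × Unit → ℤ, (P.tens (zeroCx Unit fun _ => q)).D *ᵥ w =
      fun p => (P.D *ᵥ fun a => w (a, ())) p.1 := by
    intro w
    ext ⟨a, b⟩
    rw [tens_zeroCx_D]
    exact kronecker_one_mulVec P.D w a b
  refine ⟨fun p : P.ι × Unit => x p.1, ?_, fun c hc => hx1 c ?_, fun y hy => ?_⟩
  · rw [key, hx]
    rfl
  · obtain ⟨w, hw⟩ := hc
    rw [key] at hw
    exact ⟨_, funext fun a => congrFun hw (a, ())⟩
  · rw [key] at hy
    obtain ⟨c, v, hv⟩ := hx2 (fun a => y (a, ())) (funext fun a => congrFun hy (a, ()))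
    refine ⟨c, fun p : P.ι × Unit => v p.1, ?_⟩
    rw [key, hv]
    rfl

theorem Sph.hEquiv_zeroCx (h : Q.Sph) : ∃ q : ℤ, HEquiv Q (zeroCx Unit fun _ => q) := by
  obtain ⟨q, x, hq, hx, hx1, hx2⟩ := h.exists_homog
  refine ⟨q, HEquiv.of_basis Q _ (fun _ => x) (fun _ => hq) (fun _ => hx) (fun y hy => ?_)
    fun c hc => ?_⟩
  · obtain ⟨c, hc⟩ := hx2 y hy
    exact ⟨fun _ => c, by simpa using hc⟩
  · ext
    exact hx1 _ (by simpa using hc)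

/-- Up to homotopy `Q` is ℤ in a single degree, and tensoring with that is a shift. -/
theorem Sph.tens (hP : P.Sph) (hQ : Q.Sph) : (P.tens Q).Sph := by
  obtain ⟨q, hq⟩ := hQ.hEquiv_zeroCx
  exact (hq.symm.tens_left P).sph (hP.tens_zeroCx q)

/-- The structure of a finitely generated free complex over `ℤ`: it is a direct sum of complexes
`ℤ z` with `D z = 0`, and `ℤ c → ℤ z` with `D c = n z` and `n ≠ 0`. -/
theorem exists_smith_splitting (Q : MatCx) :
    ∃ (J : Type) (_ : Fintype J) (_ : DecidableEq J) (z c : J → Q.ι → ℤ) (n : J → ℤ)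
      (φ γ : J → (Q.ι → ℤ) →ₗ[ℤ] ℤ),
      (∀ j, Q.D *ᵥ z j = 0) ∧ (∀ j, Q.D *ᵥ c j = n j • z j) ∧
      (∀ x, x = ∑ j, (φ j x • z j + γ j x • c j)) ∧ (∀ j x, φ j (Q.D *ᵥ x) = n j * γ j x) ∧
      (∀ j x, γ j (Q.D *ᵥ x) = 0) ∧ (∀ i j, φ i (z j) = if i = j then 1 else 0) ∧
      (∀ j, n j = 0 → c j = 0) := by
  classical
  set T := Q.D.mulVecLin with hT
  let Z := LinearMap.ker T
  obtain ⟨r, bZ⟩ := Submodule.basisOfPid (Pi.basisFun ℤ Q.ι) Z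
  -- Smith normal form of the boundaries inside the cycles: the basis `S.bM` of the cycles supplies
  -- the `z j`, and preimages of the basis `S.bN` of the boundaries supply the `c j`.
  obtain ⟨k, S⟩ := Submodule.smithNormalForm bZ ((LinearMap.range T).submoduleOf Z)
  have hTZ : ∀ x, T x ∈ Z := fun x => Q.D_mulVec_D x
  let T' : (Q.ι → ℤ) →ₗ[ℤ] ((LinearMap.range T).submoduleOf Z) :=
    (T.codRestrict Z hTZ).codRestrict _ fun x => ⟨x, rfl⟩
  have hbN : ∀ i, ∃ x, T x = (S.bN i : Z) := fun i => (S.bN i).2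
  choose c0 hc0 using hbN
  have hc0' : ∀ i, T (c0 i) = S.a i • (S.bM (S.f i) : Q.ι → ℤ) := by
    intro i
    rw [hc0, S.snf]
    rfl
  -- Indices outside the range of `S.f` are the free part of the homology; there `c`, `n` and `γ`
  -- all take the default value zero.
  let c : Fin r → Q.ι → ℤ := Function.extend S.f c0 0
  let n : Fin r → ℤ := Function.extend S.f S.a 0
  let γ : Fin r → (Q.ι → ℤ) →ₗ[ℤ] ℤ := Function.extend S.f (fun i => (S.bN.coord i).comp T') 0
  have hcf : ∀ i, c (S.f i) = c0 i := S.f.injective.extend_apply _ _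
  have hnf : ∀ i, n (S.f i) = S.a i := S.f.injective.extend_apply _ _
  have hγf : ∀ i, γ (S.f i) = (S.bN.coord i).comp T' := S.f.injective.extend_apply _ _
  have hc_of : ∀ j, (¬∃ i, S.f i = j) → c j = 0 := fun j hj => Function.extend_apply' _ _ _ hj
  have hn_of : ∀ j, (¬∃ i, S.f i = j) → n j = 0 := fun j hj => Function.extend_apply' _ _ _ hj
  have hγ_of : ∀ j, (¬∃ i, S.f i = j) → γ j = 0 := fun j hj => Function.extend_apply' _ _ _ hj
  have hDc : ∀ j, T (c j) = n j • (S.bM j : Q.ι → ℤ) := by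
    intro j
    by_cases hj : ∃ i, S.f i = j
    · obtain ⟨i, rfl⟩ := hj
      rw [hcf, hnf, hc0']
    · rw [hc_of j hj, hn_of j hj, map_zero, zero_smul]
  have hsumγ : ∀ x, ∑ j, γ j x • c j = ∑ i, (S.bN.coord i (T' x)) • c0 i := by
    intro x
    rw [← Finset.sum_subset (Finset.subset_univ (Finset.univ.map S.f))]
    · rw [Finset.sum_map]
      exact Finset.sum_congr rfl fun i _ => by rw [hcf, hγf]; rfl
    · intro j _ hj
      rw [hc_of j (by simpa using hj), smul_zero]
  have hTsum : ∀ x, T (∑ j, γ j x • c j) = T x := by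
    intro x
    rw [hsumγ, map_sum]
    have h1 := congrArg (fun v => ((v : (LinearMap.range T).submoduleOf Z) : Q.ι → ℤ))
      (S.bN.sum_repr (T' x))
    simp only [Submodule.coe_sum, Submodule.coe_smul] at h1
    refine Eq.trans (Finset.sum_congr rfl fun i _ => ?_) h1
    rw [map_smul, hc0]
    rfl
  -- Subtracting the `c`-part of a vector leaves a cycle, whose coordinates in `S.bM` are the `φ j`.
  let u0 : (Q.ι → ℤ) →ₗ[ℤ] (Q.ι → ℤ) :=
    LinearMap.id - ∑ j, (LinearMap.toSpanSingleton ℤ _ (c j)).comp (γ j)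
  have hu0 : ∀ x, u0 x = x - ∑ j, γ j x • c j := by
    intro x
    simp [u0, LinearMap.sub_apply, LinearMap.sum_apply]
  have hu0Z : ∀ x, u0 x ∈ Z := by
    intro x
    rw [LinearMap.mem_ker, hu0, map_sub, hTsum, sub_self]
  let u := u0.codRestrict Z hu0Z
  have hγT : ∀ j x, x ∈ Z → γ j x = 0 := by
    intro j x hx
    by_cases hj : ∃ i, S.f i = j
    · obtain ⟨i, rfl⟩ := hj
      have : T' x = 0 := Subtype.ext (Subtype.ext hx)
      rw [hγf, LinearMap.comp_apply, this, map_zero]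
    · rw [hγ_of j hj]; rfl
  have huZ : ∀ x (hx : x ∈ Z), u x = ⟨x, hx⟩ := by
    intro x hx
    refine Subtype.ext ?_
    change u0 x = x
    rw [hu0, Finset.sum_eq_zero, sub_zero]
    intro j _
    rw [hγT j x hx, zero_smul]
  refine ⟨Fin r, inferInstance, inferInstance, fun j => S.bM j, c, n,
    fun j => (S.bM.coord j).comp u, γ, fun j => (S.bM j).2, hDc, ?_, ?_, ?_, ?_, ?_⟩
  · intro x
    rw [Finset.sum_add_distrib]
    have h1 := congrArg (fun v : Z => (v : Q.ι → ℤ)) (S.bM.sum_repr (u x))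
    simp only [Submodule.coe_sum, Submodule.coe_smul] at h1
    have h2 : (u x : Q.ι → ℤ) = x - ∑ j, γ j x • c j := hu0 x
    rw [h2] at h1
    exact (eq_add_of_sub_eq h1.symm)
  · intro j x
    have h0 : u (Q.D *ᵥ x) = ⟨T x, hTZ x⟩ := huZ (T x) (hTZ x)
    rw [LinearMap.comp_apply, h0]
    have h1 : (⟨T x, hTZ x⟩ : Z) = (T' x : Z) := rfl
    rw [h1]
    by_cases hj : ∃ i, S.f i = j
    · obtain ⟨i, rfl⟩ := hj
      have := LinearMap.congr_fun (S.coord_apply_embedding_eq_smul_coord (i := i)) (T' x)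
      rw [hnf, hγf]
      exact this
    · rw [hn_of j hj, zero_mul]
      exact S.repr_eq_zero_of_notMem_range (T' x) (by simpa using hj)
  · exact fun j x => hγT j _ (hTZ x)
  · intro i j
    rw [LinearMap.comp_apply, huZ _ (S.bM j).2]
    simp [Finsupp.single_apply, eq_comm]
  · intro j hj
    by_cases h : ∃ i, S.f i = j
    · obtain ⟨i, rfl⟩ := h
      rw [hnf] at hj
      have h1 := S.snf i
      rw [hj, zero_smul] at h1
      -- A vanishing coefficient in the Smith form would make a basis vector of the boundaries zero.
      exact absurd (Subtype.ext h1) (S.bN.ne_zero i)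
    · exact hc_of j h

/-- Split `Q` by Smith normal form and decompose a generator `w` accordingly. The pieces with `n j ≠
0` are torsion, so a piece `x ⊗ z j` with `n j = 0` survives; contraction with `φ j` then shows that
`x` generates the homology of `P`. If some other `z i` were not a boundary, `x ⊗ z i` would
contribute more homology than ℤ. -/
theorem Sph.of_tens (h : (P.tens Q).Sph) : P.Sph ∧ Q.Sph := by
  obtain ⟨J, _, _, z, c, n, φ, γ, hz, hc, hsum, hφD, -, hφz, hn⟩ := exists_smith_splitting Q
  obtain ⟨w, hw, hw1, hw2⟩ := h
  have hφ : ∀ j v, contract (φ j) ((P.tens Q).D *ᵥ v) =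
      P.D *ᵥ contract (φ j) v + n j • (P.sgn *ᵥ contract (γ j) v) := by
    intro j v
    rw [contract_tens_D]
    have h1 : (φ j).comp Q.D.mulVecLin = n j • γ j := LinearMap.ext fun x => hφD j x
    rw [h1, ← Matrix.mulVec_smul]
    rfl
  have hwsum : w = ∑ j, (tmul (contract (φ j) w) (z j) + tmul (contract (γ j) w) (c j)) := by
    ext ⟨a, b⟩
    have := congrFun (hsum fun b => w (a, b)) b
    rw [this]
    simp [Finset.sum_apply, tmul, contract]
  have hwφ : ∀ j, P.D *ᵥ contract (φ j) w = -(n j • (P.sgn *ᵥ contract (γ j) w)) := by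
    intro j
    have := hφ j w
    rw [hw] at this
    exact eq_neg_of_add_eq_zero_left (this.symm.trans (funext fun _ => map_zero (φ j)))
  -- The chain `sgn x ⊗ c j`, with `x` the `φ j`-coefficient of `w`, has `n j` times the `j`-th
  -- piece of `w` as its boundary.
  have htor : ∀ j, Bdry (P.tens Q).D
      (n j • (tmul (contract (φ j) w) (z j) + tmul (contract (γ j) w) (c j))) := by
    intro j
    refine ⟨tmul (P.sgn *ᵥ contract (φ j) w) (c j), ?_⟩
    rw [tens_D_mulVec_tmul, D_mulVec_sgn, hwφ, Matrix.mulVec_neg, neg_neg, Matrix.mulVec_smul,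
      sgn_mulVec_sgn, sgn_mulVec_sgn, hc, tmul_smul_left, tmul_smul_right, smul_add, add_comm]
  obtain ⟨j, hj, hjb⟩ : ∃ j, n j = 0 ∧ ¬Bdry (P.tens Q).D (tmul (contract (φ j) w) (z j)) := by
    by_contra! hcon
    -- The product of the nonzero `n j` would otherwise make a multiple of `w` a boundary.
    have hN : (∏ j, if n j = 0 then 1 else n j) ≠ 0 := by
      refine Finset.prod_ne_zero_iff.mpr fun j _ => ?_
      split_ifs with h
      · exact one_ne_zero
      · exact h
    refine hN (hw1 _ ?_)
    rw [hwsum, Finset.smul_sum]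
    refine Bdry.sum _ fun j _ => ?_
    by_cases h0 : n j = 0
    · refine Bdry.smul _ ?_
      have h1 : tmul (contract (γ j) w) (c j) = 0 := by
        rw [hn j h0]
        ext p
        simp [tmul]
      rw [h1, add_zero]
      exact hcon j h0
    · obtain ⟨k, hk⟩ : n j ∣ ∏ j, if n j = 0 then 1 else n j := by
        have := Finset.dvd_prod_of_mem (fun j => if n j = 0 then 1 else n j) (Finset.mem_univ j)
        simpa [h0] using this
      rw [hk, mul_comm, mul_smul]
      exact (htor j).smul k
  set x := contract (φ j) w with hxdef
  have hx : P.D *ᵥ x = 0 := by rw [hwφ, hj, zero_smul, neg_zero]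
  have hcyc : ∀ y i, P.D *ᵥ y = 0 → (P.tens Q).D *ᵥ tmul y (z i) = 0 := by
    intro y i hy
    rw [tens_D_mulVec_tmul, hy, hz]
    ext p
    simp [tmul]
  have hGj : ∀ v, Bdry (P.tens Q).D v → Bdry P.D (contract (φ j) v) := by
    rintro _ ⟨v, rfl⟩
    rw [hφ, hj, zero_smul, add_zero]
    exact bdry_mulVec _ _
  have hFj : ∀ y i, Bdry P.D y → Bdry (P.tens Q).D (tmul y (z i)) := by
    rintro _ i ⟨y, rfl⟩
    refine ⟨tmul y (z i), ?_⟩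
    rw [tens_D_mulVec_tmul, hz]
    ext p
    simp [tmul]
  have hself : ∀ y : P.ι → ℤ, contract (φ j) (tmul y (z j)) = y := by
    intro y
    rw [contract_tmul, hφz, if_pos rfl, one_smul]
  obtain ⟨k, hk⟩ := hw2 _ (hcyc x j hx)
  have hk1 : Bdry P.D ((1 - k) • x) := by
    have := hGj _ hk
    rwa [contract_sub, contract_smul, hself, ← hxdef, ← one_smul ℤ x, smul_smul, mul_one,
      ← sub_smul] at this
  -- With `x ⊗ z j` homologous to `k • w`, contraction gives that `(1 - k) • x` is a boundary, so
  -- `(1 - k) * k = 0`. Since `x ⊗ z j` is not a boundary, `k` is not zero.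
  have hk2 : k = 1 := by
    have h1 := hFj _ j hk1
    rw [tmul_smul_left] at h1
    have h2 := h1.sub (hk.smul (1 - k))
    rw [smul_sub, sub_sub_cancel, smul_smul] at h2
    rcases mul_eq_zero.mp (hw1 _ h2) with h3 | h3
    · omega
    · rw [h3, zero_smul, sub_zero] at hk
      exact absurd hk hjb
  rw [hk2, one_smul] at hk
  have hgx : ∀ c : ℤ, Bdry P.D (c • x) → c = 0 := by
    intro c hc
    refine hw1 c ?_
    have h1 := hFj _ j hc
    rw [tmul_smul_left] at h1
    have h2 := h1.sub (hk.smul c)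
    rwa [smul_sub, sub_sub_cancel] at h2
  have hgen : ∀ y, P.D *ᵥ y = 0 → ∃ c : ℤ, Bdry P.D (y - c • x) := by
    intro y hy
    obtain ⟨c, hc⟩ := hw2 _ (hcyc y j hy)
    refine ⟨c, ?_⟩
    have := hGj _ hc
    rwa [contract_sub, contract_smul, hself] at this
  refine ⟨⟨x, hx, hgx, hgen⟩, z j, hz j, ?_, ?_⟩
  · rintro c ⟨v, hv⟩
    have h1 := hφD j v
    rw [hv, map_smul, hφz, if_pos rfl, hj] at h1
    simpa using h1
  -- Contracting with `φ j` shows that `x ⊗ z i` is itself a boundary. Contracting with `φ i` then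
  -- writes `x`, modulo boundaries, as `n i` times a cycle `y`, and `y` is homologous to `d • x`. As
  -- `x` is a generator, `n i * d = 1`, so `z i` is the boundary of `d • c i`.
  · have hother : ∀ i, i ≠ j → Bdry Q.D (z i) := by
      intro i hij
      obtain ⟨c', hc'⟩ := hw2 _ (hcyc x i hx)
      have h1 : Bdry (P.tens Q).D (tmul x (z i) - c' • tmul x (z j)) := by
        have := hc'.sub (hk.smul c')
        convert this using 1
        rw [smul_sub]
        abel
      have h2 : c' = 0 := by
        have := hGj _ h1
        rw [contract_sub, contract_smul, hself, contract_tmul, hφz, if_neg hij.symm, zero_smul,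
          zero_sub, ← neg_smul] at this
        have := hgx _ this
        omega
      rw [h2, zero_smul, sub_zero] at h1
      obtain ⟨v, hv⟩ := h1
      have h3 := hφ i v
      rw [hv, contract_tmul, hφz, if_pos rfl, one_smul] at h3
      have hn0 : n i ≠ 0 := by
        intro h0
        rw [h0, zero_smul, add_zero] at h3
        have h4 : Bdry P.D ((1 : ℤ) • x) := by
          rw [one_smul, h3]
          exact bdry_mulVec _ _
        exact one_ne_zero (hgx 1 h4)
      set y := P.sgn *ᵥ contract (γ i) v with hy
      have hycyc : P.D *ᵥ y = 0 := by
        have h4 := congrArg (P.D *ᵥ ·) h3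
        simp only [Matrix.mulVec_add, D_mulVec_D, hx, zero_add, Matrix.mulVec_smul] at h4
        exact (smul_eq_zero.mp h4.symm).resolve_left hn0
      obtain ⟨d, hd⟩ := hgen y hycyc
      have h5 : Bdry P.D ((1 - n i * d) • x) := by
        have : (1 - n i * d) • x = P.D *ᵥ contract (φ i) v + n i • (y - d • x) := by
          rw [sub_smul, one_smul, smul_sub, smul_smul]
          nth_rewrite 1 [h3]
          abel
        rw [this]
        exact (bdry_mulVec _ _).add (hd.smul _)
      have h6 := hgx _ h5
      refine ⟨d • c i, ?_⟩
      rw [Matrix.mulVec_smul, hc, smul_smul, mul_comm, show n i * d = 1 by omega, one_smul]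
    intro y hy
    have hγy : ∀ i, n i ≠ 0 → γ i y = 0 := by
      intro i hi
      have := hφD i y
      rw [hy, map_zero] at this
      exact (mul_eq_zero.mp this.symm).resolve_left hi
    refine ⟨φ j y, ?_⟩
    have h1 : y = φ j y • z j + ∑ i ∈ Finset.univ.erase j, φ i y • z i := by
      rw [Finset.add_sum_erase _ (fun i => φ i y • z i) (Finset.mem_univ j)]
      nth_rewrite 1 [hsum y]
      refine Finset.sum_congr rfl fun i _ => ?_
      by_cases hi : n i = 0
      · rw [hn i hi, smul_zero, add_zero]
      · rw [hγy i hi, zero_smul, add_zero]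
    have h2 : y - φ j y • z j = ∑ i ∈ Finset.univ.erase j, φ i y • z i := by
      nth_rewrite 1 [h1]
      abel
    rw [h2]
    exact Bdry.sum _ fun i hi => (hother i (Finset.ne_of_mem_erase hi)).smul _

theorem sph_tens_iff : (P.tens Q).Sph ↔ P.Sph ∧ Q.Sph :=
  ⟨Sph.of_tens, fun h => h.1.tens h.2⟩

end MatCx

/-! ### Removing contractible subcomplexes -/

namespace MatCx

/-- Killing a contractible subcomplex: `π` is the projection onto the quotient, `t` a section of
it, and `s` restricts to a contraction of the kernel of `π`. -/
theorem HEquiv.of_contraction {C C' : MatCx} (π : Matrix C'.ι C.ι ℤ) (t : Matrix C.ι C'.ι ℤ)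
    (s : Matrix C.ι C.ι ℤ) (hπt : π * t = 1) (hπ : π * C.D = C'.D * π) (hπs : π * s = 0)
    (hs : (C.D * s + s * C.D) * (1 - t * π) = 1 - t * π) (gπ : Homog C'.deg C.deg 0 π)
    (gt : Homog C.deg C'.deg 0 t) (gs : Homog C.deg C.deg 1 s) : HEquiv C C' := by
  obtain ⟨y, hy⟩ : ∃ y, y = C.D * t - t * C'.D := ⟨_, rfl⟩
  have hπy : π * y = 0 := by
    rw [hy, Matrix.mul_sub, ← Matrix.mul_assoc, hπ, Matrix.mul_assoc, hπt, ← Matrix.mul_assoc, hπt,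
      Matrix.mul_one, Matrix.one_mul, sub_self]
  have huy : (1 - t * π) * y = y := by
    rw [Matrix.sub_mul, Matrix.one_mul, Matrix.mul_assoc, hπy, Matrix.mul_zero, sub_zero]
  have hDsy : C.D * (s * y) = y - s * (C.D * y) := by
    have := congrArg (· * y) hs
    simp only [Matrix.mul_assoc] at this
    rw [huy, Matrix.add_mul, Matrix.mul_assoc, Matrix.mul_assoc] at this
    exact eq_sub_of_add_eq this
  have hDy : C.D * y = -(C.D * t * C'.D) := by
    rw [hy, Matrix.mul_sub, ← Matrix.mul_assoc, C.sq, Matrix.zero_mul, zero_sub, Matrix.mul_assoc]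
  have hyE : y * C'.D = C.D * t * C'.D := by
    rw [hy, Matrix.sub_mul, Matrix.mul_assoc t, C'.sq, Matrix.mul_zero, sub_zero]
  -- The section `t` need not be a chain map; its defect `y` takes values in the kernel of `π`,
  -- where `s` is a contraction, so subtracting `s * y` repairs it.
  refine ⟨π, t - s * y, -(s * (1 - t * π)), 0, hπ, ?_, ?_, ?_, gπ, ?_⟩
  · rw [Matrix.sub_mul, Matrix.mul_sub, hDsy, hDy, Matrix.mul_assoc s, hyE, Matrix.mul_neg, hy]
    abel
  · have h1 : (1 - t * π) * C.D = C.D * (1 - t * π) + y * π := by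
      rw [Matrix.sub_mul, Matrix.mul_sub, Matrix.one_mul, Matrix.mul_one, Matrix.mul_assoc t, hπ,
        hy, Matrix.sub_mul, Matrix.mul_assoc, Matrix.mul_assoc]
      abel
    have h2 : C.D * (s * (1 - t * π)) = (1 - t * π) - s * (C.D * (1 - t * π)) := by
      rw [Matrix.add_mul, Matrix.mul_assoc, Matrix.mul_assoc] at hs
      exact eq_sub_of_add_eq hs
    rw [Matrix.mul_neg, Matrix.neg_mul, h2, Matrix.mul_assoc s, h1, Matrix.mul_add,
      Matrix.sub_mul, Matrix.mul_assoc s]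
    abel
  · rw [Matrix.mul_sub, hπt, ← Matrix.mul_assoc, hπs]
    simp
  · have h1 : Homog C.deg C'.deg (-1) y := by
      intro a b hab
      by_cases h : (C.D * t) a b = 0
      · have h2 : (t * C'.D) a b ≠ 0 := by
          intro h0
          exact hab (by rw [hy, Matrix.sub_apply, h, h0, sub_zero])
        simpa using gt.mul C'.homog_D a b h2
      · simpa using C.homog_D.mul gt a b h
    intro a b hab
    by_cases h : (s * y) a b = 0
    · exact gt a b (by rwa [Matrix.sub_apply, h, sub_zero] at hab)
    · simpa using gs.mul h1 a b h

/-- Products of submatrices, when the terms outside of the subset vanish. -/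
theorem submatrix_mul_of_support {X α β : Type} [Fintype X] (J : Set X) [Fintype J]
    (A B : Matrix X X ℤ) (f : α → X) (g : β → X)
    (h : ∀ x ∉ J, ∀ a b, A (f a) x * B x (g b) = 0) :
    A.submatrix f (Subtype.val : J → X) * B.submatrix (Subtype.val : J → X) g =
      (A * B).submatrix f g := by
  classical
  ext a b
  simp only [Matrix.mul_apply, Matrix.submatrix_apply]
  rw [← Finset.sum_subset (Finset.subset_univ (J.toFinset))]
  · exact (Finset.sum_subtype J.toFinset (fun x => Set.mem_toFinset)
      (fun x => A (f a) x * B x (g b))).symm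
  · intro x _ hx
    exact h x (by simpa using hx) a b

end MatCx

/-! ### The simplicial boundary matrix and the removal of cones -/

namespace SimplicialCx

open MatCx

section Boundary

variable {V : Type} [LinearOrder V]

/-- The matrix of the simplicial boundary. -/
def bdMat (V : Type) [LinearOrder V] : Matrix (Finset V) (Finset V) ℤ :=
  fun ρ σ => simplexBdry V (Finsupp.single σ 1) ρ

theorem bdMat_apply (ρ σ : Finset V) : bdMat V ρ σ =
    ∑ v ∈ σ, if σ.erase v = ρ then (-1 : ℤ) ^ (σ.filter (· < v)).card else 0 := by
  rw [bdMat, simplexBdry_single, one_smul, Finsupp.finsetSum_apply]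
  exact Finset.sum_congr rfl fun v _ => Finsupp.single_apply

theorem bdMat_ne_zero {ρ σ : Finset V} (h : bdMat V ρ σ ≠ 0) : ∃ v ∈ σ, σ.erase v = ρ := by
  rw [bdMat_apply] at h
  obtain ⟨v, hv, hne⟩ := Finset.exists_ne_zero_of_sum_ne_zero h
  refine ⟨v, hv, ?_⟩
  by_contra h0
  exact hne (if_neg h0)

theorem bdMat_subset {ρ σ : Finset V} (h : bdMat V ρ σ ≠ 0) : ρ ⊆ σ := by
  obtain ⟨v, -, rfl⟩ := bdMat_ne_zero h
  exact Finset.erase_subset _ _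

theorem bdMat_card {ρ σ : Finset V} (h : bdMat V ρ σ ≠ 0) : σ.card = ρ.card + 1 := by
  obtain ⟨v, hv, rfl⟩ := bdMat_ne_zero h
  exact (Finset.card_erase_add_one hv).symm

/-- Adding the vertex `w` to the simplices that do not contain it. -/
def coneMat (w : V) : Matrix (Finset V) (Finset V) ℤ :=
  fun ρ σ => if w ∉ σ ∧ insert w σ = ρ then (-1 : ℤ) ^ (σ.filter (· < w)).card else 0

theorem coneMat_ne_zero {w : V} {ρ σ : Finset V} (h : coneMat w ρ σ ≠ 0) :
    w ∉ σ ∧ insert w σ = ρ := by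
  by_contra h0
  exact h (if_neg h0)

variable [Fintype V]

theorem simplexBdry_eq_mulVec (x : Finset V →₀ ℤ) (ρ : Finset V) :
    simplexBdry V x ρ = (bdMat V *ᵥ x) ρ := by
  induction x using Finsupp.induction_linear with
  | zero => simp
  | add x y hx hy => rw [map_add, Finsupp.add_apply, hx, hy, Finsupp.coe_add, Matrix.mulVec_add,
      Pi.add_apply]
  | single σ c =>
    classical
    have h : (Finsupp.single σ c : Finset V →₀ ℤ) = c • Finsupp.single σ 1 := by simp
    rw [h, map_smul, Finsupp.smul_apply, Finsupp.coe_smul, Matrix.mulVec_smul,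
      Finsupp.single_eq_pi_single, Matrix.mulVec_single_one]
    rfl

theorem bdMat_mul_bdMat : bdMat V * bdMat V = 0 := by
  ext ρ σ
  have h := congrArg (· ρ) (simplexBdry_simplexBdry (Finsupp.single σ (1 : ℤ)))
  simp only [simplexBdry_eq_mulVec] at h
  exact h

theorem mul_coneMat_apply (w : V) (A : Matrix (Finset V) (Finset V) ℤ) (ρ σ : Finset V) :
    (A * coneMat w) ρ σ =
      if w ∉ σ then A ρ (insert w σ) * (-1 : ℤ) ^ (σ.filter (· < w)).card else 0 := by
  rw [Matrix.mul_apply]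
  by_cases h : w ∉ σ
  · rw [if_pos h, Finset.sum_eq_single (insert w σ)]
    · rw [coneMat, if_pos ⟨h, rfl⟩]
    · intro τ _ hτ
      rw [coneMat, if_neg (fun h => hτ h.2.symm), mul_zero]
    · simp
  · rw [if_neg h]
    refine Finset.sum_eq_zero fun τ _ => ?_
    rw [coneMat, if_neg (fun h' => h h'.1), mul_zero]

theorem mul_bdMat_apply (A : Matrix (Finset V) (Finset V) ℤ) (ρ σ : Finset V) :
    (A * bdMat V) ρ σ =
      ∑ v ∈ σ, A ρ (σ.erase v) * (-1 : ℤ) ^ (σ.filter (· < v)).card := by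
  simp only [Matrix.mul_apply, bdMat_apply, Finset.mul_sum]
  rw [Finset.sum_comm]
  refine Finset.sum_congr rfl fun v _ => ?_
  simp

/-- Coning with apex `w` contracts the full simplex. If `w ∈ σ`, only the face opposite to `w`
contributes. If `w ∉ σ`, deleting `v` and inserting `w` commute up to the sign of
`simplexBdry_sign`, and all terms cancel but the one that deletes `w` again. -/
theorem bdMat_mul_coneMat_add (w : V) : bdMat V * coneMat w + coneMat w * bdMat V = 1 := by
  ext ρ σ
  rw [Matrix.add_apply, mul_coneMat_apply, mul_bdMat_apply, Matrix.one_apply]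
  by_cases hw : w ∈ σ
  · rw [if_neg (by simpa using hw), zero_add, Finset.sum_eq_single w]
    · have h1 : (σ.erase w).filter (· < w) = σ.filter (· < w) := by
        ext x
        simp only [Finset.mem_filter, Finset.mem_erase]
        exact ⟨fun h => ⟨h.1.2, h.2⟩, fun h => ⟨⟨h.2.ne, h.1⟩, h.2⟩⟩
      simp only [coneMat, Finset.notMem_erase, not_false_eq_true, true_and, Finset.insert_erase hw,
        h1, ite_mul, zero_mul, ← pow_add, ← two_mul, pow_mul, neg_one_sq, one_pow, eq_comm (a := ρ)]
    · intro v _ hv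
      rw [coneMat, if_neg, zero_mul]
      rintro ⟨h, -⟩
      exact h (Finset.mem_erase.mpr ⟨hv.symm, hw⟩)
    · exact fun h => absurd hw h
  · rw [if_pos hw, bdMat_apply, Finset.sum_insert hw, Finset.erase_insert hw, add_mul]
    have h1 : (insert w σ).filter (· < w) = σ.filter (· < w) := by
      rw [Finset.filter_insert, if_neg (lt_irrefl w)]
    have h2 : ∀ v ∈ σ, coneMat w ρ (σ.erase v) * (-1 : ℤ) ^ (σ.filter (· < v)).card =
        -((if (insert w σ).erase v = ρ then (-1 : ℤ) ^ ((insert w σ).filter (· < v)).card else 0) *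
          (-1 : ℤ) ^ (σ.filter (· < w)).card) := by
      intro v hv
      have hne : v ≠ w := fun h => hw (h ▸ hv)
      have hw' : w ∉ σ.erase v := fun h => hw (Finset.mem_of_mem_erase h)
      have hins : insert w (σ.erase v) = (insert w σ).erase v :=
        (Finset.erase_insert_of_ne hne.symm).symm
      rw [coneMat, hins]
      by_cases hρ : (insert w σ).erase v = ρ
      · rw [if_pos ⟨hw', hρ⟩, if_pos hρ]
        have e1 : (σ.erase v).filter (· < w) = ((insert w σ).erase v).filter (· < w) := by
          rw [← hins, Finset.filter_insert, if_neg (lt_irrefl w)]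
        have e2 : σ.filter (· < v) = ((insert w σ).erase w).filter (· < v) := by
          rw [Finset.erase_insert hw]
        have hw1 : w ∈ insert w σ := Finset.mem_insert_self _ _
        have hv1 : v ∈ insert w σ := Finset.mem_insert_of_mem hv
        rw [e1, e2, ← h1]
        set a := ((insert w σ).filter (· < w)).card
        set b := ((insert w σ).filter (· < v)).card
        set c := (((insert w σ).erase v).filter (· < w)).card
        set d := (((insert w σ).erase w).filter (· < v)).card
        have hsign : (-1 : ℤ) ^ b * (-1) ^ c + (-1) ^ a * (-1) ^ d = 0 := by
          rcases lt_or_gt_of_ne hne with h | h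
          · exact simplexBdry_sign _ hv1 h
          · rw [add_comm]
            exact simplexBdry_sign _ hw1 h
        have hc2 : ((-1 : ℤ) ^ a) * (-1) ^ a = 1 := by
          rw [← pow_add, ← two_mul, pow_mul, neg_one_sq, one_pow]
        have hd2 : ((-1 : ℤ) ^ c) * (-1) ^ c = 1 := by
          rw [← pow_add, ← two_mul, pow_mul, neg_one_sq, one_pow]
        linear_combination ((-1 : ℤ) ^ a * (-1) ^ c) * hsign - ((-1 : ℤ) ^ c * (-1) ^ d) * hc2 -
          ((-1 : ℤ) ^ a * (-1) ^ b) * hd2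
      · rw [if_neg (fun h => hρ h.2), if_neg hρ]
        simp
    rw [Finset.sum_congr rfl h2, Finset.sum_neg_distrib, ← Finset.sum_mul, add_neg_cancel_right, h1]
    simp only [ite_mul, zero_mul, ← pow_add, ← two_mul, pow_mul, neg_one_sq, one_pow,
      eq_comm (a := ρ)]

/-- The chain complex spanned by the simplices in an order-convex set. For a simplicial complex
this is the reduced chain complex, for a difference of two complexes it is the relative one. -/
abbrev relCx (T : Set (Finset V)) (hT : T.OrdConnected) : MatCx :=
  letI := Classical.decPred (· ∈ T)
  { ι := T
    fin := inferInstance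
    dec := inferInstance
    deg := fun σ => (σ.1.card : ℤ)
    D := (bdMat V).submatrix Subtype.val Subtype.val
    sq := by
      rw [submatrix_mul_of_support, bdMat_mul_bdMat]
      · rfl
      · intro x hx a b
        -- An intermediate simplex of a nonzero term lies between two members of `T`, so
        -- order-convexity is what keeps the square zero.
        by_contra h
        exact hx (hT.out a.2 b.2
          ⟨bdMat_subset (left_ne_zero_of_mul h), bdMat_subset (right_ne_zero_of_mul h)⟩)
    homog := fun a b h => by
      have := bdMat_card h
      omega }

/-- The reduced chain complex of a simplicial complex. -/
def toMatCx (K : SimplicialCx V) : MatCx := relCx (K : Set (Finset V)) K.lower.ordConnected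

/-- A subcomplex that is a cone can be removed. -/
theorem hEquiv_diff (J Z : SimplicialCx V) (hZJ : Z ≤ J) (w : V)
    (hw : ∀ σ ∈ Z, insert w σ ∈ Z) (T : Set (Finset V)) (hT : T.OrdConnected)
    (hTJ : ∀ σ, σ ∈ T ↔ σ ∈ J ∧ σ ∉ Z) : HEquiv J.toMatCx (relCx T hT) := by
  classical
  let C := J.toMatCx
  let C' := relCx T hT
  let π : Matrix C'.ι C.ι ℤ := (1 : Matrix (Finset V) (Finset V) ℤ).submatrix
    (Subtype.val : T → Finset V) (Subtype.val : ↥(J : Set (Finset V)) → Finset V)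
  let t : Matrix C.ι C'.ι ℤ := (1 : Matrix (Finset V) (Finset V) ℤ).submatrix
    (Subtype.val : ↥(J : Set (Finset V)) → Finset V) (Subtype.val : T → Finset V)
  -- The cone operator is applied to simplices of `Z` only: coning another simplex of `J` could
  -- leave `J`.
  let S : Matrix (Finset V) (Finset V) ℤ := fun ρ σ => if σ ∈ Z then coneMat w ρ σ else 0
  let s : Matrix C.ι C.ι ℤ := S.submatrix
    (Subtype.val : ↥(J : Set (Finset V)) → Finset V)
    (Subtype.val : ↥(J : Set (Finset V)) → Finset V)
  have hS : ∀ {ρ σ}, S ρ σ ≠ 0 → σ ∈ Z ∧ w ∉ σ ∧ insert w σ = ρ := by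
    intro ρ σ h
    by_cases hσ : σ ∈ Z
    · simp only [S, if_pos hσ] at h
      exact ⟨hσ, coneMat_ne_zero h⟩
    · simp only [S, if_neg hσ] at h
      exact absurd rfl h
  have hone : ∀ {ρ σ : Finset V}, (1 : Matrix (Finset V) (Finset V) ℤ) ρ σ ≠ 0 → ρ = σ := by
    intro ρ σ h
    by_contra h0
    exact h (Matrix.one_apply_ne h0)
  have hπt' : π * t = (1 * 1 : Matrix (Finset V) (Finset V) ℤ).submatrix
      (Subtype.val : T → Finset V) (Subtype.val : T → Finset V) := by
    refine submatrix_mul_of_support (J : Set (Finset V)) _ _ _ _ fun x hx a b => ?_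
    by_contra h
    exact hx (hone (left_ne_zero_of_mul h) ▸ ((hTJ _).mp a.2).1)
  have hπt : π * t = 1 := by
    rw [hπt', Matrix.one_mul]
    exact Matrix.submatrix_one _ Subtype.val_injective
  have hπD : π * C.D = (1 * bdMat V).submatrix
      (Subtype.val : T → Finset V) (Subtype.val : ↥(J : Set (Finset V)) → Finset V) := by
    refine submatrix_mul_of_support (J : Set (Finset V)) _ _ _ _ fun x hx a b => ?_
    by_contra h
    exact hx (hone (left_ne_zero_of_mul h) ▸ ((hTJ _).mp a.2).1)
  have hDπ : C'.D * π = (bdMat V * 1).submatrix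
      (Subtype.val : T → Finset V) (Subtype.val : ↥(J : Set (Finset V)) → Finset V) := by
    refine submatrix_mul_of_support T _ _ _ _ fun x hx a b => ?_
    by_contra h
    have hxb := hone (right_ne_zero_of_mul h)
    subst hxb
    have hbZ : b.1 ∈ Z := by
      by_contra hb
      exact hx ((hTJ _).mpr ⟨b.2, hb⟩)
    exact ((hTJ _).mp a.2).2 (Z.lower (bdMat_subset (left_ne_zero_of_mul h)) hbZ)
  have hπs : π * s = 0 := by
    have h1 : π * s = (1 * S).submatrix
        (Subtype.val : T → Finset V) (Subtype.val : ↥(J : Set (Finset V)) → Finset V) := by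
      refine submatrix_mul_of_support (J : Set (Finset V)) _ _ _ _ fun x hx a b => ?_
      by_contra h
      exact hx (hone (left_ne_zero_of_mul h) ▸ ((hTJ _).mp a.2).1)
    rw [h1, Matrix.one_mul]
    ext a b
    by_contra h
    obtain ⟨hb, -, hab⟩ := hS h
    exact ((hTJ _).mp a.2).2 (hab ▸ hw _ hb)
  -- So `1 - t * π` projects onto the span of the simplices of `Z`, where the cone operator is a
  -- contraction.
  have htπ : ∀ a b : C.ι, ((1 : Matrix C.ι C.ι ℤ) - t * π) a b =
      if b.1 ∈ Z then (1 : Matrix C.ι C.ι ℤ) a b else 0 := by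
    intro a b
    have h1 : (t * π) a b = if b.1 ∈ T then (1 : Matrix C.ι C.ι ℤ) a b else 0 := by
      rw [Matrix.mul_apply]
      have h2 : (1 : Matrix C.ι C.ι ℤ) a b =
          (1 : Matrix (Finset V) (Finset V) ℤ) a.1 b.1 := by
        rw [Matrix.one_apply, Matrix.one_apply]
        exact if_congr Subtype.ext_iff rfl rfl
      split_ifs with hb
      · rw [Finset.sum_eq_single (⟨b.1, hb⟩ : C'.ι)]
        · rw [h2]
          change (1 : Matrix (Finset V) (Finset V) ℤ) a.1 b.1 *
            (1 : Matrix (Finset V) (Finset V) ℤ) b.1 b.1 = _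
          rw [Matrix.one_apply_eq, mul_one]
        · intro x _ hx
          have : π x b = 0 := Matrix.one_apply_ne fun h => hx (Subtype.ext h)
          rw [this, mul_zero]
        · simp
      · refine Finset.sum_eq_zero fun x _ => ?_
        have : π x b = 0 := Matrix.one_apply_ne fun h => hb (h ▸ x.2)
        rw [this, mul_zero]
    rw [Matrix.sub_apply, h1]
    by_cases hb : b.1 ∈ Z
    · rw [if_pos hb, if_neg (fun h => ((hTJ _).mp h).2 hb), sub_zero]
    · rw [if_neg hb, if_pos ((hTJ _).mpr ⟨b.2, hb⟩), sub_self]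
  have hsZ : ∀ a b : C.ι, b.1 ∈ Z → s a b = coneMat w a.1 b.1 := fun a b hb => if_pos hb
  have hs : (C.D * s + s * C.D) * (1 - t * π) = 1 - t * π := by
    have key : ∀ a b : C.ι, b.1 ∈ Z → (C.D * s + s * C.D) a b = (1 : Matrix C.ι C.ι ℤ) a b := by
      intro a b hb
      have e1 : (C.D * s) a b = (bdMat V * coneMat w) a.1 b.1 := by
        have := submatrix_mul_of_support (J : Set (Finset V)) (bdMat V) (coneMat w)
          (fun _ : Unit => a.1) (fun _ : Unit => b.1) fun x hx _ _ => by
            by_contra h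
            obtain ⟨-, h1⟩ := coneMat_ne_zero (right_ne_zero_of_mul h)
            exact hx (hZJ (h1 ▸ hw _ hb))
        refine Eq.trans (Finset.sum_congr rfl fun x _ => ?_) (congrFun (congrFun this ()) ())
        exact congrArg (C.D a x * ·) (hsZ x b hb)
      have e2 : (s * C.D) a b = (coneMat w * bdMat V) a.1 b.1 := by
        have := submatrix_mul_of_support (J : Set (Finset V)) (coneMat w) (bdMat V)
          (fun _ : Unit => a.1) (fun _ : Unit => b.1) fun x hx _ _ => by
            by_contra h
            exact hx (J.lower (bdMat_subset (right_ne_zero_of_mul h)) b.2)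
        refine Eq.trans (Finset.sum_congr rfl fun x _ => ?_) (congrFun (congrFun this ()) ())
        by_cases hx : bdMat V x.1 b.1 = 0
        · exact (mul_eq_zero_of_right (s a x) hx).trans
            (mul_eq_zero_of_right (coneMat w a.1 x.1) hx).symm
        · have hxZ : x.1 ∈ Z := Z.lower (bdMat_subset hx) hb
          exact congrArg (· * C.D x b) (hsZ a x hxZ)
      rw [Matrix.add_apply, e1, e2, ← Matrix.add_apply, bdMat_mul_coneMat_add, Matrix.one_apply,
        Matrix.one_apply]
      exact if_congr Subtype.ext_iff.symm rfl rfl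
    ext a b
    rw [Matrix.mul_apply, htπ]
    simp only [htπ]
    split_ifs with hb
    · simp only [Matrix.one_apply, mul_ite, mul_one, mul_zero, Finset.sum_ite_eq', Finset.mem_univ,
        if_true]
      rw [key a b hb, Matrix.one_apply]
    · simp
  refine HEquiv.of_contraction π t s hπt ?_ hπs hs ?_ ?_ ?_
  · rw [hπD, hDπ, Matrix.one_mul, Matrix.mul_one]
  · intro a b h
    have h1 : a.1 = b.1 := hone h
    change (a.1.card : ℤ) = b.1.card + 0
    rw [h1, add_zero]
  · intro a b h
    have h1 : a.1 = b.1 := hone h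
    change (a.1.card : ℤ) = b.1.card + 0
    rw [h1, add_zero]
  · intro a b h
    obtain ⟨-, h1, h2⟩ := hS h
    change (a.1.card : ℤ) = b.1.card + 1
    rw [← h2, Finset.card_insert_of_notMem h1]
    push_cast
    rfl

end Boundary

end SimplicialCx

/-! ### Joins as tensor products, relabelling, and small complexes -/

namespace SimplicialCx

open MatCx

section Shuffle

variable {V : Type} [LinearOrder V]

/-- The number of inversions between two sets of vertices. -/
def inv (α β : Finset V) : ℕ := ∑ u ∈ α, (β.filter (· < u)).card

theorem inv_erase_left {α β : Finset V} {v : V} (hv : v ∈ α) :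
    inv α β = inv (α.erase v) β + (β.filter (· < v)).card :=
  (Finset.sum_erase_add α _ hv).symm

theorem inv_erase_right {α β : Finset V} {v : V} (hv : v ∈ β) :
    inv α β = inv α (β.erase v) + (α.filter (v < ·)).card := by
  rw [inv, inv, Finset.card_filter, ← Finset.sum_add_distrib]
  refine Finset.sum_congr rfl fun u _ => ?_
  rw [Finset.filter_erase]
  split_ifs with h
  · rw [Finset.card_erase_add_one (Finset.mem_filter.mpr ⟨hv, h⟩)]
  · rw [add_zero, Finset.erase_eq_of_notMem (a := v)
      (fun h' => h (Finset.mem_filter.mp h').2)]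

theorem card_filter_lt_union {α β : Finset V} (h : Disjoint α β) (v : V) :
    ((α ∪ β).filter (· < v)).card = (α.filter (· < v)).card + (β.filter (· < v)).card := by
  rw [Finset.filter_union, Finset.card_union_of_disjoint]
  exact Finset.disjoint_filter_filter h

theorem card_filter_lt_add_gt {α : Finset V} {v : V} (hv : v ∉ α) :
    (α.filter (· < v)).card + (α.filter (v < ·)).card = α.card := by
  rw [← Finset.card_filter_add_card_filter_not (s := α) (· < v)]
  congr 2
  refine Finset.filter_congr fun u hu => ?_
  have : u ≠ v := fun h => hv (h ▸ hu)
  rw [not_lt]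
  exact ⟨le_of_lt, fun h => lt_of_le_of_ne h this.symm⟩

/-- The boundary on a join of two sets of simplices with disjoint vertex sets. -/
theorem bdMat_union (W : Finset V) {α α' β β' : Finset V} (hα : Disjoint α W)
    (hα' : Disjoint α' W) (hβ : β ⊆ W) (hβ' : β' ⊆ W) :
    bdMat V (α ∪ β) (α' ∪ β') = (-1 : ℤ) ^ inv α β *
      (bdMat V α α' * (if β = β' then 1 else 0) +
        (if α = α' then (-1 : ℤ) ^ α.card else 0) * bdMat V β β') * (-1 : ℤ) ^ inv α' β' := by
  have hd : Disjoint α' β' := hα'.mono_right hβ'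
  have hcancel : ∀ {γ γ' δ δ' : Finset V}, Disjoint γ W → Disjoint γ' W → δ ⊆ W → δ' ⊆ W →
      (γ ∪ δ = γ' ∪ δ' ↔ γ = γ' ∧ δ = δ') := by
    intro γ γ' δ δ' h1 h2 h3 h4
    refine ⟨fun h => ?_, fun h => by rw [h.1, h.2]⟩
    have key : ∀ x, (x ∈ γ ↔ x ∈ γ') ∧ (x ∈ δ ↔ x ∈ δ') := by
      intro x
      have hx := Finset.ext_iff.mp h x
      have h1x := fun hx : x ∈ γ => Finset.disjoint_left.mp h1 hx
      have h2x := fun hx : x ∈ γ' => Finset.disjoint_left.mp h2 hx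
      have h3x := fun hx : x ∈ δ => h3 hx
      have h4x := fun hx : x ∈ δ' => h4 hx
      rw [Finset.mem_union, Finset.mem_union] at hx
      tauto
    exact ⟨Finset.ext fun x => (key x).1, Finset.ext fun x => (key x).2⟩
  have hsq : ∀ k : ℕ, (-1 : ℤ) ^ k * (-1) ^ k = 1 := fun k => by
    rw [← pow_add, ← two_mul, pow_mul, neg_one_sq, one_pow]
  rw [bdMat_apply, Finset.sum_union hd, mul_add, add_mul, bdMat_apply, bdMat_apply]
  congr 1
  · rw [Finset.sum_mul, Finset.mul_sum, Finset.sum_mul]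
    refine Finset.sum_congr rfl fun v hv => ?_
    have hvβ : v ∉ β' := Finset.disjoint_left.mp hd hv
    have h1 : (α' ∪ β').erase v = α'.erase v ∪ β' := by
      rw [Finset.erase_union_distrib, Finset.erase_eq_of_notMem hvβ]
    rw [h1]
    simp only [hcancel (hα'.mono_left (Finset.erase_subset v α')) hα hβ' hβ]
    by_cases h2 : α'.erase v = α ∧ β' = β
    · obtain ⟨rfl, rfl⟩ := h2
      -- The vertices of `β'` below `v` enter the sign of `v` in the union, and they are exactly the
      -- inversions lost by deleting `v`.
      rw [if_pos ⟨rfl, rfl⟩, if_pos rfl, if_pos rfl, card_filter_lt_union hd, inv_erase_left hv,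
        pow_add, pow_add]
      linear_combination -((-1 : ℤ) ^ (α'.filter (· < v)).card *
        (-1 : ℤ) ^ (β'.filter (· < v)).card) * hsq (inv (α'.erase v) β')
    · rw [if_neg h2]
      rcases not_and_or.mp h2 with h3 | h3
      · rw [if_neg h3]; ring
      · rw [if_neg (fun h : β = β' => h3 h.symm)]; ring
  · rw [Finset.mul_sum, Finset.mul_sum, Finset.sum_mul]
    refine Finset.sum_congr rfl fun v hv => ?_
    have hvα : v ∉ α' := Finset.disjoint_right.mp hd hv
    have h1 : (α' ∪ β').erase v = α' ∪ β'.erase v := by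
      rw [Finset.erase_union_distrib, Finset.erase_eq_of_notMem hvα]
    rw [h1]
    simp only [hcancel hα' hα ((Finset.erase_subset v β').trans hβ') hβ]
    by_cases h2 : α' = α ∧ β'.erase v = β
    · obtain ⟨rfl, rfl⟩ := h2
      -- Here the vertices of `α'` below `v` enter the sign and those above `v` are the lost
      -- inversions; together they give the Koszul sign of `α'`.
      rw [if_pos ⟨rfl, rfl⟩, if_pos rfl, if_pos rfl, card_filter_lt_union hd, inv_erase_right hv,
        ← card_filter_lt_add_gt hvα, pow_add, pow_add, pow_add]
      linear_combination -((-1 : ℤ) ^ (α'.filter (· < v)).card *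
        (-1 : ℤ) ^ (β'.filter (· < v)).card) * hsq (inv α' (β'.erase v)) -
        ((-1 : ℤ) ^ (α'.filter (· < v)).card * (-1 : ℤ) ^ (β'.filter (· < v)).card *
        (-1 : ℤ) ^ inv α' (β'.erase v) * (-1 : ℤ) ^ inv α' (β'.erase v)) *
          hsq ((α'.filter (v < ·)).card)
    · rw [if_neg h2]
      rcases not_and_or.mp h2 with h3 | h3
      · rw [if_neg (fun h : α = α' => h3 h.symm)]; ring
      · rw [if_neg h3]; ring

variable [Fintype V]

/-- The chain complex of a join is the tensor product of the chain complexes. -/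
theorem hEquiv_tens (W : Finset V) (A B T : Set (Finset V)) (hA : A.OrdConnected)
    (hB : B.OrdConnected) (hT : T.OrdConnected) (hAW : ∀ α ∈ A, Disjoint α W)
    (hBW : ∀ β ∈ B, β ⊆ W) (h : ∀ σ, σ ∈ T ↔ σ \ W ∈ A ∧ σ ∩ W ∈ B) :
    HEquiv ((relCx A hA).tens (relCx B hB)) (relCx T hT) := by
  have h1 : ∀ {α β : Finset V}, α ∈ A → β ∈ B → (α ∪ β) \ W = α := by
    intro α β hα hβ
    rw [Finset.union_sdiff_distrib, Finset.sdiff_eq_empty_iff_subset.mpr (hBW β hβ),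
      Finset.union_empty, Finset.sdiff_eq_self_of_disjoint (hAW α hα)]
  have h2 : ∀ {α β : Finset V}, α ∈ A → β ∈ B → (α ∪ β) ∩ W = β := by
    intro α β hα hβ
    rw [Finset.union_inter_distrib_right, Finset.inter_eq_left.mpr (hBW β hβ),
      Finset.disjoint_iff_inter_eq_empty.mp (hAW α hα), Finset.empty_union]
  let e : A × B ≃ T :=
    { toFun := fun p => ⟨p.1.1 ∪ p.2.1,
        (h _).mpr ⟨by rw [h1 p.1.2 p.2.2]; exact p.1.2, by rw [h2 p.1.2 p.2.2]; exact p.2.2⟩⟩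
      invFun := fun σ => (⟨σ.1 \ W, ((h _).mp σ.2).1⟩, ⟨σ.1 ∩ W, ((h _).mp σ.2).2⟩)
      left_inv := fun p => Prod.ext (Subtype.ext (h1 p.1.2 p.2.2)) (Subtype.ext (h2 p.1.2 p.2.2))
      right_inv := fun σ => Subtype.ext (Finset.sdiff_union_inter σ.1 W) }
  -- The sign of the shuffle that sorts the vertices of the first factor followed by those of the
  -- second.
  refine HEquiv.of_signed e (fun p => (-1 : ℤ) ^ inv p.1.1 p.2.1) ?_ ?_ ?_
  · intro p
    simp only
    rw [← pow_add, ← two_mul, pow_mul, neg_one_sq, one_pow]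
  · rintro ⟨α, β⟩
    change (((α.1 ∪ β.1).card : ℕ) : ℤ) = (α.1.card : ℤ) + β.1.card
    rw [Finset.card_union_of_disjoint ((hAW _ α.2).mono_right (hBW _ β.2))]
    push_cast
    rfl
  · rintro ⟨α, β⟩ ⟨α', β'⟩
    refine (bdMat_union W (hAW _ α.2) (hAW _ α'.2) (hBW _ β.2) (hBW _ β'.2)).trans ?_
    congr 2
    change _ = bdMat V α.1 α'.1 * (1 : Matrix B B ℤ) β β' +
      (relCx A hA).sgn α α' * bdMat V β.1 β'.1
    rw [sgn, Matrix.diagonal_apply, Matrix.one_apply]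
    refine congrArg₂ _ (congrArg _ (if_congr Subtype.ext_iff.symm rfl rfl))
      (congrArg (· * bdMat V β.1 β'.1) ?_)
    refine if_congr Subtype.ext_iff.symm ?_ rfl
    rw [Int.coe_negOnePow_natCast]

end Shuffle

section Relabel

variable {V V' : Type} [LinearOrder V] [LinearOrder V']

theorem bdMat_map (φ : V' ↪o V) (ρ σ : Finset V') :
    bdMat V (ρ.map φ.toEmbedding) (σ.map φ.toEmbedding) = bdMat V' ρ σ := by
  rw [bdMat_apply, bdMat_apply, Finset.sum_map]
  refine Finset.sum_congr rfl fun v _ => ?_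
  rw [← Finset.map_erase, Finset.filter_map, Finset.card_map]
  refine if_congr (Finset.map_injective _).eq_iff ?_ rfl
  congr 3
  ext x
  simp

/-- Chain complexes only depend on the simplices, not on the ambient vertex set. -/
theorem hEquiv_map [Fintype V] [Fintype V'] (φ : V' ↪o V) (T : Set (Finset V))
    (T' : Set (Finset V')) (hT : T.OrdConnected) (hT' : T'.OrdConnected)
    (h : ∀ σ, σ ∈ T ↔ ∃ σ' ∈ T', σ'.map φ.toEmbedding = σ) :
    HEquiv (relCx T' hT') (relCx T hT) := by
  let e : T' ≃ T := Equiv.ofBijective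
    (fun σ => ⟨σ.1.map φ.toEmbedding, (h _).mpr ⟨σ.1, σ.2, rfl⟩⟩)
    ⟨fun σ τ hστ => Subtype.ext (Finset.map_injective _ (congrArg Subtype.val hστ)),
      fun σ => by
        obtain ⟨σ', h1, h2⟩ := (h _).mp σ.2
        exact ⟨⟨σ', h1⟩, Subtype.ext h2⟩⟩
  refine HEquiv.of_signed e (fun _ => 1) (fun _ => one_mul 1) ?_ ?_
  · intro σ
    change (((σ.1.map φ.toEmbedding).card : ℕ) : ℤ) = σ.1.card
    rw [Finset.card_map]
  · intro σ τ
    rw [one_mul, mul_one]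
    exact bdMat_map φ σ.1 τ.1

end Relabel

section Small

variable {V : Type} [LinearOrder V] [Fintype V]

theorem hEquiv_singleton (τ : Finset V) (T : Set (Finset V)) (hT : T.OrdConnected)
    (h : ∀ σ, σ ∈ T ↔ σ = τ) : HEquiv (relCx T hT) (zeroCx Unit fun _ => (τ.card : ℤ)) := by
  let e : T ≃ Unit :=
    { toFun := fun _ => ()
      invFun := fun _ => ⟨τ, (h τ).mpr rfl⟩
      left_inv := fun σ => Subtype.ext ((h _).mp σ.2).symm
      right_inv := fun _ => rfl }
  refine HEquiv.of_signed e (fun _ => 1) (fun _ => one_mul 1) ?_ ?_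
  · intro σ
    change (τ.card : ℤ) = σ.1.card
    rw [(h _).mp σ.2]
  · intro σ σ'
    rw [one_mul, mul_one]
    change 0 = bdMat V σ.1 σ'.1
    by_contra h0
    have := bdMat_card (Ne.symm h0)
    rw [(h _).mp σ.2, (h _).mp σ'.2] at this
    omega

theorem sph_zeroCx_unit (q : ℤ) : (zeroCx Unit fun _ => q).Sph := by
  refine ⟨fun _ => 1, Matrix.zero_mulVec _, ?_, fun y _ => ⟨y (), ?_⟩⟩
  · rintro c ⟨w, hw⟩
    have := congrFun ((Matrix.zero_mulVec w).symm.trans hw) ()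
    simpa using this.symm
  · refine ⟨0, ?_⟩
    rw [Matrix.mulVec_zero]
    ext
    simp

/-- Removing the whole complex as a cone leaves no basis element at all. The void complex is
included. -/
theorem not_sph_of_cone (J : SimplicialCx V) (w : V) (hw : ∀ σ ∈ J, insert w σ ∈ J) :
    ¬J.toMatCx.Sph := by
  intro h
  have h1 := (hEquiv_diff J J le_rfl w hw ∅ Set.ordConnected_empty (by simp)).sph h
  obtain ⟨x, -, hx, -⟩ := h1
  exact one_ne_zero (hx 1 ⟨0, funext fun a => a.2.elim⟩)

end Small

end SimplicialCx

/-! ### Comparison with the homology of complexes of modules -/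

namespace MatCx

theorem Homog.mulVec_proj {β : Type} [Fintype β] {deg : β → ℤ} {k : ℤ} {D : Matrix β β ℤ}
    (hD : Homog deg deg k D) (r : ℤ) (x : β → ℤ) :
    D *ᵥ proj deg r x = proj deg (r + k) (D *ᵥ x) := by
  ext a
  simp only [proj, Matrix.mulVec, dotProduct]
  split_ifs with h
  · refine Finset.sum_congr rfl fun b _ => ?_
    by_cases hb : D a b = 0
    · simp [hb]
    · have := hD a b hb
      rw [if_pos (by omega)]
  · refine Finset.sum_eq_zero fun b _ => ?_
    by_cases hb : D a b = 0
    · simp [hb]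
    · have := hD a b hb
      rw [if_neg (by omega), mul_zero]

theorem eq_zero_of_mem_degPart {β : Type} {deg : β → ℤ} (hdeg : ∀ b, 0 ≤ deg b) {q : ℤ}
    (hq : q < 0) {x : β → ℤ} (hx : x ∈ degPart deg q) : x = 0 := by
  ext b
  by_contra h
  have := hx b h
  have := hdeg b
  omega

/-- Additive maps are `ℤ`-linear for any `ℤ`-module structures. -/
def intLinear {M N : Type} [AddCommGroup M] [AddCommGroup N] {mM : Module ℤ M} {mN : Module ℤ N}
    (f : M →+ N) : M →ₗ[ℤ] N where
  toFun := f
  map_add' := map_add f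
  map_smul' c x := by simpa using map_intCast_smul f ℤ ℤ c x

/-- The homology of a complex of modules as a subquotient. -/
theorem nonempty_homology_equiv {R : Type} [CommRing R] {c : ComplexShape ℕ}
    (C : HomologicalComplex (ModuleCat.{0} R) c) (q : ℕ) {Y : Type} [AddCommGroup Y] [Module R Y]
    (f : LinearMap.ker (C.d q (c.next q)).hom →ₗ[R] Y) (hf : Function.Surjective f)
    (hk : ∀ x, f x = 0 ↔ ∃ y, (C.d (c.prev q) q).hom y = x) :
    Nonempty (C.homology q ≃ₗ[R] Y) := by
  let f' : LinearMap.ker (C.sc q).g.hom →ₗ[R] Y := f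
  have h : LinearMap.range (C.sc q).moduleCatToCycles = LinearMap.ker f' := by
    ext x
    rw [LinearMap.mem_ker]
    refine Iff.trans ?_ (hk x).symm
    exact ⟨fun ⟨y, hy⟩ => ⟨y, congrArg Subtype.val hy⟩, fun ⟨y, hy⟩ => ⟨y, Subtype.ext hy⟩⟩
  exact ⟨((C.sc q).moduleCatHomologyIso.toLinearEquiv).trans
    ((Submodule.quotEquivOfEq _ _ h).trans (f'.quotKerEquivOfSurjective hf))⟩

/-- A complex of modules that is identified, degree by degree, with the homogeneous parts of a
matrix complex has the homology of the latter. -/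
theorem nonempty_homology_equiv_matHomology {c : ComplexShape ℕ}
    (C : HomologicalComplex (ModuleCat.{0} ℤ) c) (k : ℤ)
    (hc : ∀ i j : ℕ, c.Rel i j ↔ (j : ℤ) = i + k)
    {β : Type} [Fintype β] (deg : β → ℤ) (hdeg : ∀ b, 0 ≤ deg b) (D : Matrix β β ℤ)
    (hD : Homog deg deg k D) (e : ∀ q : ℕ, C.X q →+ (β → ℤ)) (he : ∀ q, Function.Injective (e q))
    (hmem : ∀ (q : ℕ) x, e q x ∈ degPart deg q)
    (hsurj : ∀ q : ℕ, ∀ v ∈ degPart deg q, ∃ x, e q x = v)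
    (hd : ∀ i j, c.Rel i j → ∀ x, e j ((C.d i j).hom x) = D *ᵥ e i x) (q : ℕ) :
    Nonempty (C.homology q ≃ₗ[ℤ] matHomology deg D q) := by
  have hcyc : ∀ x, (C.d q (c.next q)).hom x = 0 ↔ D *ᵥ e q x = 0 := by
    intro x
    by_cases h : c.Rel q (c.next q)
    · rw [← hd _ _ h, map_eq_zero_iff _ (he _)]
    · rw [C.shape _ _ h]
      -- At the end of the complex the differential is zero by convention; on the matrix side its
      -- value would lie in negative degree, where there are no basis elements.
      refine ⟨fun _ => ?_, fun _ => rfl⟩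
      refine eq_zero_of_mem_degPart hdeg ?_ (hD.mulVec_mem (hmem q x))
      by_contra hlt
      refine h ?_
      have hrel : c.Rel q (((q : ℤ) + k).toNat) := (hc _ _).mpr (by omega)
      rwa [c.next_eq' hrel]
  have hbd : ∀ x, (∃ y, (C.d (c.prev q) q).hom y = x) ↔ ∃ w, D *ᵥ w = e q x := by
    intro x
    -- A preimage of a homogeneous vector may be replaced by its component in the appropriate
    -- degree.
    have hproj : ∀ w, D *ᵥ w = e q x → D *ᵥ proj deg (q - k) w = e q x := by
      intro w hw
      rw [hD.mulVec_proj, sub_add_cancel, hw, proj_of_mem (hmem q x)]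
    by_cases h : c.Rel (c.prev q) q
    · constructor
      · rintro ⟨y, rfl⟩
        exact ⟨_, (hd _ _ h y).symm⟩
      · rintro ⟨w, hw⟩
        have hpq : (q : ℤ) - k = (c.prev q : ℕ) := by
          have := (hc _ _).mp h
          omega
        obtain ⟨y, hy⟩ := hsurj (c.prev q) (proj deg (q - k) w) (hpq ▸ proj_mem _ _ _)
        refine ⟨y, he q ?_⟩
        rw [hd _ _ h, hy, hproj w hw]
    · rw [C.shape _ _ h]
      constructor
      · rintro ⟨y, rfl⟩
        exact ⟨0, (Matrix.mulVec_zero D).trans (map_zero (e q)).symm⟩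
      · rintro ⟨w, hw⟩
        refine ⟨0, he q ?_⟩
        have h0 : proj deg (q - k) w = 0 := by
          refine eq_zero_of_mem_degPart hdeg ?_ (proj_mem deg (q - k) w)
          by_contra hlt
          refine h ?_
          have hrel : c.Rel (((q : ℤ) - k).toNat) q := (hc _ _).mpr (by omega)
          rwa [c.prev_eq' hrel]
        rw [← hproj w hw, h0, Matrix.mulVec_zero]
        exact map_zero (e q)
  have hker : ∀ x : LinearMap.ker (C.d q (c.next q)).hom,
      e q x ∈ LinearMap.ker D.mulVecLin ⊓ degPart deg q := fun x =>
    ⟨(hcyc x).mp x.2, hmem q x⟩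
  let g : LinearMap.ker (C.d q (c.next q)).hom →+
      ↥(LinearMap.ker D.mulVecLin ⊓ degPart deg q) :=
    { toFun := fun x => ⟨e q x, hker x⟩
      map_zero' := Subtype.ext (map_zero (e q))
      map_add' := fun x y => Subtype.ext (map_add (e q) x.1 y.1) }
  let f : LinearMap.ker (C.d q (c.next q)).hom →+ matHomology deg D q :=
    (Submodule.mkQ _).toAddMonoidHom.comp g
  refine nonempty_homology_equiv C q (intLinear f) ?_ ?_
  · refine (Submodule.mkQ_surjective _).comp ?_
    rintro ⟨v, hv, hvq⟩
    obtain ⟨x, rfl⟩ := hsurj q v hvq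
    exact ⟨⟨x, (hcyc x).mpr hv⟩, rfl⟩
  · intro x
    rw [hbd]
    exact Submodule.Quotient.mk_eq_zero _

end MatCx

/-! ### Reduced simplicial homology and cohomology by matrices -/

namespace SimplicialCx

open MatCx

section

variable {V : Type} (K : SimplicialCx V)

theorem chains_support {q : ℕ} (x : K.chains q) (σ : Finset V) (h : x.1 σ ≠ 0) :
    σ ∈ K ∧ σ.card = q :=
  (Finsupp.mem_supported ℤ x.1).mp x.2 (Finsupp.mem_support_iff.mpr h)

/-- The coordinates of a chain. -/
def chainCoord (q : ℕ) : K.chains q →ₗ[ℤ] (↥(K : Set (Finset V)) → ℤ) where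
  toFun x σ := x.1 σ.1
  map_add' _ _ := rfl
  map_smul' _ _ := rfl

open Classical in
/-- The chain of a simplex, if it has the right dimension. -/
def simplexChain (q : ℕ) (σ : ↥(K : Set (Finset V))) : K.chains q :=
  if h : σ.1.card = q then ⟨Finsupp.single σ.1 1, Finsupp.single_mem_supported ℤ _ ⟨σ.2, h⟩⟩ else 0

theorem simplexChain_val {q : ℕ} {σ : ↥(K : Set (Finset V))} (h : σ.1.card = q) :
    (K.simplexChain q σ).1 = Finsupp.single σ.1 1 := by
  rw [simplexChain, dif_pos h]

theorem simplexChain_eq_zero {q : ℕ} {σ : ↥(K : Set (Finset V))} (h : σ.1.card ≠ q) :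
    K.simplexChain q σ = 0 := by
  rw [simplexChain, dif_neg h]

/-- The values of a cochain on the simplices. -/
def cochainCoord (q : ℕ) : Module.Dual ℤ (K.chains q) →ₗ[ℤ] (↥(K : Set (Finset V)) → ℤ) where
  toFun φ σ := φ (K.simplexChain q σ)
  map_add' _ _ := rfl
  map_smul' _ _ := rfl

end

variable {V : Type} [LinearOrder V] [Fintype V] (K : SimplicialCx V)

theorem sum_toMatCx (f : Finset V → ℤ) (hf : ∀ σ, f σ ≠ 0 → σ ∈ K) :
    ∑ σ : K.toMatCx.ι, f σ.1 = ∑ σ, f σ := by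
  classical
  rw [← Finset.sum_subset (Finset.subset_univ (Finset.univ.filter (· ∈ K)))]
  · exact (@Finset.sum_subtype _ _ _ (· ∈ K) K.toMatCx.fin _ (fun x => by simp) f).symm
  · intro τ _ hτ
    by_contra h
    exact hτ (by simpa using hf τ h)

theorem toMatCx_mulVec (x : Finset V →₀ ℤ) (hx : ∀ σ, x σ ≠ 0 → σ ∈ K) (σ : K.toMatCx.ι) :
    (K.toMatCx.D *ᵥ fun τ : K.toMatCx.ι => x τ.1) σ = simplexBdry V x σ.1 := by
  rw [simplexBdry_eq_mulVec]
  exact K.sum_toMatCx (fun τ => bdMat V σ.1 τ * x τ) fun τ h => hx τ (right_ne_zero_of_mul h)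

theorem redHomology_equiv (q : ℕ) :
    Nonempty (K.redHomology q ≃ₗ[ℤ] matHomology K.toMatCx.deg K.toMatCx.D q) := by
  classical
  refine nonempty_homology_equiv_matHomology K.chainComplex (-1) ?_ K.toMatCx.deg
    (fun σ => Int.natCast_nonneg _) K.toMatCx.D K.toMatCx.homog_D
    (fun q => (K.chainCoord q).toAddMonoidHom) ?_ ?_ ?_ ?_ q
  · intro i j
    rw [ComplexShape.down_Rel]
    omega
  · intro q x y h
    refine Subtype.ext (Finsupp.ext fun σ => ?_)
    by_cases hσ : σ ∈ K
    · exact congrFun h ⟨σ, hσ⟩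
    · have hx : ∀ z : K.chains q, z.1 σ = 0 := fun z => by
        by_contra h0
        exact hσ (K.chains_support z σ h0).1
      exact (hx x).trans (hx y).symm
  · intro q x σ h
    exact congrArg Nat.cast (K.chains_support x σ.1 h).2
  · intro q v hv
    let x : Finset V →₀ ℤ := Finsupp.onFinset Finset.univ
      (fun σ => if h : σ ∈ K then v ⟨σ, h⟩ else 0) fun _ _ => Finset.mem_univ _
    have hx : x ∈ K.chains q := by
      rw [chains, Finsupp.mem_supported]
      intro σ hσ
      have hσ' : x σ ≠ 0 := Finsupp.mem_support_iff.mp hσ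
      simp only [x, Finsupp.onFinset_apply] at hσ'
      by_cases h : σ ∈ K
      · rw [dif_pos h] at hσ'
        exact ⟨h, Nat.cast_injective (R := ℤ) (hv ⟨σ, h⟩ hσ')⟩
      · rw [dif_neg h] at hσ'
        exact absurd rfl hσ'
    refine ⟨⟨x, hx⟩, funext fun σ => ?_⟩
    change x σ.1 = v σ
    exact dif_pos σ.2
  · intro i j h x
    obtain rfl : j + 1 = i := h
    have hd : (K.chainComplex.d (j + 1) j) = ModuleCat.ofHom (K.boundary j) :=
      ChainComplex.of_d (fun q => ModuleCat.of ℤ (K.chains q))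
        (fun q => ModuleCat.ofHom (K.boundary q)) j
    rw [hd]
    ext σ
    exact (K.toMatCx_mulVec x.1 (fun τ hτ => (K.chains_support x τ hτ).1) σ).symm

theorem sum_simplexChain {q : ℕ} (x : K.chains q) :
    ∑ σ : K.toMatCx.ι, x.1 σ.1 • K.simplexChain q σ = x := by
  classical
  refine Subtype.ext (Finsupp.ext fun τ => ?_)
  rw [Submodule.coe_sum, Finsupp.finsetSum_apply]
  have hval : ∀ σ : K.toMatCx.ι, (x.1 σ.1 • K.simplexChain q σ).1 τ =
      if σ.1 = τ then x.1 τ else 0 := by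
    intro σ
    rw [Submodule.coe_smul, Finsupp.smul_apply, smul_eq_mul]
    by_cases hx : x.1 σ.1 = 0
    · rw [hx, zero_mul]
      split_ifs with h
      · rw [← h, hx]
      · rfl
    · rw [K.simplexChain_val (K.chains_support x _ hx).2, Finsupp.single_apply, mul_ite, mul_one,
        mul_zero]
      split_ifs with h
      · rw [h]
      · rfl
  refine (Finset.sum_congr rfl fun σ _ => hval σ).trans
    ((K.sum_toMatCx (fun σ => if σ = τ then x.1 τ else 0) fun σ hσ => ?_).trans (by simp))
  by_cases h : σ = τ
  · rw [if_pos h] at hσ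
    exact h ▸ (K.chains_support x τ hσ).1
  · exact absurd (if_neg h) hσ

theorem dual_apply {q : ℕ} (φ : Module.Dual ℤ (K.chains q)) (x : K.chains q) :
    φ x = ∑ σ : K.toMatCx.ι, x.1 σ.1 * K.cochainCoord q φ σ := by
  conv_lhs => rw [← K.sum_simplexChain x, map_sum]
  exact Finset.sum_congr rfl fun σ _ => map_smul φ _ _

theorem cochainCoord_injective (q : ℕ) : Function.Injective (K.cochainCoord q) := by
  intro φ ψ h
  refine LinearMap.ext fun x => ?_
  rw [dual_apply, dual_apply, h]

theorem cochainCoord_mem (q : ℕ) (φ : Module.Dual ℤ (K.chains q)) :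
    K.cochainCoord q φ ∈ degPart K.toMatCx.deg q := by
  intro σ h
  by_contra hσ
  refine h ?_
  change φ (K.simplexChain q σ) = 0
  rw [K.simplexChain_eq_zero (fun h' => hσ (congrArg Nat.cast h')), map_zero]

theorem exists_cochainCoord_eq (q : ℕ) (v : K.toMatCx.ι → ℤ) (hv : v ∈ degPart K.toMatCx.deg q) :
    ∃ φ, K.cochainCoord q φ = v := by
  let φ : Module.Dual ℤ (K.chains q) :=
    { toFun := fun x => ∑ σ : K.toMatCx.ι, x.1 σ.1 * v σ
      map_add' := fun x y => by
        simp only [Submodule.coe_add, Finsupp.add_apply, add_mul, Finset.sum_add_distrib]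
      map_smul' := fun c x => by
        simp only [Submodule.coe_smul, Finsupp.smul_apply, smul_eq_mul, mul_assoc,
          Finset.mul_sum, RingHom.id_apply] }
  refine ⟨φ, funext fun σ => ?_⟩
  change ∑ τ : K.toMatCx.ι, (K.simplexChain q σ).1 τ.1 * v τ = v σ
  by_cases h : σ.1.card = q
  · rw [K.simplexChain_val h]
    refine (Finset.sum_eq_single (M := ℤ) (σ : K.toMatCx.ι) ?_ ?_).trans ?_
    · intro τ _ hτ
      rw [Finsupp.single_apply, if_neg (fun h' => hτ (Subtype.ext h'.symm)), zero_mul]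
    · exact fun h' => absurd (@Finset.mem_univ K.toMatCx.ι _ _) h'
    · simp
  · rw [K.simplexChain_eq_zero h]
    have : v σ = 0 := by
      by_contra h0
      exact h (Nat.cast_injective (R := ℤ) (hv σ h0))
    simp [this]

theorem cochainCoord_dualMap (i : ℕ) (φ : Module.Dual ℤ (K.chains i)) :
    K.cochainCoord (i + 1) ((K.boundary i).dualMap φ) = K.toMatCx.Dᵀ *ᵥ K.cochainCoord i φ := by
  ext σ
  change φ (K.boundary i (K.simplexChain (i + 1) σ)) = _
  rw [dual_apply]
  refine Finset.sum_congr rfl fun τ _ => ?_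
  by_cases h0 : K.cochainCoord i φ τ = 0
  · exact (mul_eq_zero_of_right _ h0).trans (mul_eq_zero_of_right _ h0).symm
  · refine congrArg (· * K.cochainCoord i φ τ) ?_
    have hτ : τ.1.card = i := Nat.cast_injective (R := ℤ) (K.cochainCoord_mem i φ τ h0)
    change simplexBdry V (K.simplexChain (i + 1) σ).1 τ.1 = bdMat V τ.1 σ.1
    by_cases hσ : σ.1.card = i + 1
    · rw [K.simplexChain_val hσ]
      rfl
    · rw [K.simplexChain_eq_zero hσ, Submodule.coe_zero, map_zero]
      by_contra h1
      have := bdMat_card (Ne.symm h1)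
      omega

theorem redCohomology_equiv (q : ℕ) :
    Nonempty (K.redCohomology q ≃ₗ[ℤ] matHomology K.toMatCx.deg K.toMatCx.Dᵀ q) := by
  refine nonempty_homology_equiv_matHomology K.cochainComplex 1 ?_ K.toMatCx.deg
    (fun σ => Int.natCast_nonneg _) K.toMatCx.Dᵀ (by simpa using K.toMatCx.homog_D.transpose)
    (fun q => (K.cochainCoord q).toAddMonoidHom) K.cochainCoord_injective K.cochainCoord_mem
    K.exists_cochainCoord_eq ?_ q
  · intro i j
    rw [ComplexShape.up_Rel]
    omega
  · intro i j h φ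
    obtain rfl : i + 1 = j := h
    have hd : (K.cochainComplex.d i (i + 1)) = ModuleCat.ofHom (K.boundary i).dualMap :=
      CochainComplex.of_d (fun q => ModuleCat.of ℤ (Module.Dual ℤ (K.chains q)))
        (fun q => ModuleCat.ofHom (K.boundary q).dualMap) i
    rw [hd]
    exact K.cochainCoord_dualMap i φ

/-- A cycle is the sum of its homogeneous components, so vanishing homology outside one degree
leaves only the class in that degree. Conversely, an ungraded generator can be chosen homogeneous by
`Sph.exists_homog`. -/
theorem homologySpherical_iff : K.HomologySpherical ↔ K.toMatCx.Sph := by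
  constructor
  · rintro ⟨d, ⟨E⟩, hne⟩
    obtain ⟨E'⟩ := K.redHomology_equiv d
    let F := E'.symm.trans E
    obtain ⟨⟨x, hx, hxd⟩, hx1⟩ := Submodule.mkQ_surjective _ (F.symm 1)
    have hF : F (Submodule.mkQ _ ⟨x, hx, hxd⟩) = 1 := by rw [hx1, F.apply_symm_apply]
    refine ⟨x, hx, fun c hc => ?_, fun y hy => ?_⟩
    · have h1 : Submodule.mkQ ((LinearMap.range K.toMatCx.D.mulVecLin).submoduleOf _)
          (c • (⟨x, hx, hxd⟩ :
            ↥(LinearMap.ker K.toMatCx.D.mulVecLin ⊓ degPart K.toMatCx.deg d))) = 0 := by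
        rw [Submodule.mkQ_apply, Submodule.Quotient.mk_eq_zero, mem_submoduleOf]
        exact hc
      have h2 := congrArg F h1
      rwa [map_smul, map_smul, hF, map_zero, smul_eq_mul, mul_one] at h2
    · have hp : ∀ r : ℤ, proj K.toMatCx.deg r y ∈
          LinearMap.ker K.toMatCx.D.mulVecLin ⊓ degPart K.toMatCx.deg r := fun r =>
        ⟨D_mulVec_proj_eq_zero hy r, proj_mem _ _ _⟩
      let cls : ∀ r : ℤ, matHomology K.toMatCx.deg K.toMatCx.D r := fun r =>
        Submodule.mkQ _ ⟨_, hp r⟩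
      refine ⟨F (cls d), ?_⟩
      have hmain : Bdry K.toMatCx.D (proj K.toMatCx.deg d y - F (cls d) • x) := by
        have h1 : cls d - F (cls d) • Submodule.mkQ _ ⟨x, hx, hxd⟩ = 0 := by
          refine F.injective ?_
          rw [map_sub, map_smul, hF, map_zero, smul_eq_mul, mul_one, sub_self]
        rw [← map_smul, ← map_sub, Submodule.mkQ_apply, Submodule.Quotient.mk_eq_zero,
          mem_submoduleOf] at h1
        exact h1
      have hy' : y = proj K.toMatCx.deg d y +
          ∑ r ∈ (Finset.univ.image K.toMatCx.deg).erase d, proj K.toMatCx.deg r y := by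
        by_cases hd : (d : ℤ) ∈ Finset.univ.image K.toMatCx.deg
        · rw [Finset.add_sum_erase _ (fun r => proj K.toMatCx.deg r y) hd, sum_proj]
        · rw [Finset.erase_eq_of_notMem hd, sum_proj, right_eq_add]
          ext b
          exact if_neg fun h => hd (Finset.mem_image.mpr ⟨b, Finset.mem_univ _, h⟩)
      have hrest : Bdry K.toMatCx.D
          (∑ r ∈ (Finset.univ.image K.toMatCx.deg).erase d, proj K.toMatCx.deg r y) := by
        refine Bdry.sum _ fun r hr => ?_
        obtain ⟨hrd, hr⟩ := Finset.mem_erase.mp hr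
        obtain ⟨b, -, rfl⟩ := Finset.mem_image.mp hr
        obtain ⟨E2⟩ := K.redHomology_equiv b.1.card
        have := hne b.1.card fun h => hrd (congrArg Nat.cast h)
        have hs : Subsingleton (matHomology K.toMatCx.deg K.toMatCx.D (b.1.card : ℤ)) :=
          E2.symm.injective.subsingleton
        have h1 : cls (b.1.card : ℤ) = 0 := hs.elim _ _
        exact (Submodule.Quotient.mk_eq_zero _).mp h1
      have h2 := hmain.add hrest
      convert h2 using 1
      nth_rewrite 1 [hy']
      abel
  · intro h
    obtain ⟨q, x, hq, hx, hx1, hx2⟩ := h.exists_homog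
    have hx0 : x ≠ 0 := by
      rintro rfl
      exact one_ne_zero (hx1 1 (by rw [smul_zero]; exact bdry_zero _))
    obtain ⟨b, hb⟩ := Function.ne_iff.mp hx0
    -- The degree of a nonzero homogeneous vector is the cardinality of a simplex, hence a natural
    -- number.
    obtain rfl : (b.1.card : ℤ) = q := hq b hb
    refine ⟨b.1.card, ?_, fun r hr => ?_⟩
    · obtain ⟨E⟩ := K.redHomology_equiv b.1.card
      let f : ℤ →ₗ[ℤ] matHomology K.toMatCx.deg K.toMatCx.D (b.1.card : ℤ) :=
        (Submodule.mkQ _).comp (LinearMap.toSpanSingleton ℤ _ ⟨x, hx, hq⟩)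
      refine ⟨E.trans (LinearEquiv.ofBijective f ⟨?_, ?_⟩).symm⟩
      · rw [injective_iff_map_eq_zero]
        intro c hc
        rw [LinearMap.comp_apply, Submodule.mkQ_apply, Submodule.Quotient.mk_eq_zero,
          mem_submoduleOf] at hc
        exact hx1 c hc
      · intro y
        obtain ⟨⟨y, hy, hyq⟩, rfl⟩ := Submodule.mkQ_surjective _ y
        obtain ⟨c, hc⟩ := hx2 y hy
        refine ⟨c, ?_⟩
        rw [LinearMap.comp_apply, eq_comm, ← sub_eq_zero, ← map_sub, Submodule.mkQ_apply,
          Submodule.Quotient.mk_eq_zero, mem_submoduleOf]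
        exact hc
    · obtain ⟨E⟩ := K.redHomology_equiv r
      have : Subsingleton (matHomology K.toMatCx.deg K.toMatCx.D (r : ℤ)) := by
        refine subsingleton_of_forall_eq 0 fun y => ?_
        obtain ⟨⟨y, hy, hyq⟩, rfl⟩ := Submodule.mkQ_surjective _ y
        rw [Submodule.mkQ_apply, Submodule.Quotient.mk_eq_zero, mem_submoduleOf]
        obtain ⟨c, hc⟩ := hx2 y hy
        have h1 := hc.proj r
        rw [proj_sub, proj_smul, proj_of_mem hyq,
          proj_of_mem_ne hq (fun h => hr (Nat.cast_injective h)), smul_zero, sub_zero] at h1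
        exact h1
      exact E.injective.subsingleton

end SimplicialCx

/-! ### Polyhedral joins, one block at a time -/

namespace SimplicialCx

open MatCx

section Blocks

variable {m : ℕ} {n : Fin m → ℕ}

/-- Equality of vertices is decided by their order. -/
instance vertexDecidableEq : DecidableEq (Σₗ k, Fin (n k)) := LinearOrder.toDecidableEq

/-- The inclusion of the `k`-th block into the disjoint union. -/
def blockEmb (n : Fin m → ℕ) (k : Fin m) : Fin (n k) ↪o Σₗ k, Fin (n k) :=
  OrderEmbedding.ofStrictMono (fun i => toLex ⟨k, i⟩) fun _ _ h =>
    Sigma.Lex.lt_def.mpr (Or.inr ⟨rfl, h⟩)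

/-- The set of all vertices of the `k`-th block. -/
def blockVerts (n : Fin m → ℕ) (k : Fin m) : Finset (Σₗ k, Fin (n k)) :=
  Finset.univ.map (blockEmb n k).toEmbedding

theorem mem_block {σ : Finset (Σₗ k, Fin (n k))} {k : Fin m} {i : Fin (n k)} :
    i ∈ block σ k ↔ blockEmb n k i ∈ σ := by
  simp only [block, Finset.mem_filter, Finset.mem_univ, true_and]
  rfl

theorem blockEmb_injective {k j : Fin m} {i : Fin (n k)} {i' : Fin (n j)}
    (h : blockEmb n k i = blockEmb n j i') : k = j :=
  congrArg (fun x : Σₗ k, Fin (n k) => x.1) h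

theorem blockEmb_inj {k : Fin m} {i i' : Fin (n k)} :
    blockEmb n k i = blockEmb n k i' ↔ i = i' := (blockEmb n k).injective.eq_iff

theorem exists_blockEmb (x : Σₗ k, Fin (n k)) : ∃ k i, blockEmb n k i = x := ⟨x.1, x.2, rfl⟩

theorem block_mono {σ ρ : Finset (Σₗ k, Fin (n k))} (h : σ ⊆ ρ) (k : Fin m) :
    block σ k ⊆ block ρ k := fun _ hi => mem_block.mpr (h (mem_block.mp hi))

theorem mem_blockVerts {j k : Fin m} {i : Fin (n j)} : blockEmb n j i ∈ blockVerts n k ↔ j = k := by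
  simp only [blockVerts, Finset.mem_map, Finset.mem_univ, true_and]
  constructor
  · rintro ⟨a, h⟩
    exact (blockEmb_injective h).symm
  · rintro rfl
    exact ⟨i, rfl⟩

theorem block_sdiff_blockVerts (σ : Finset (Σₗ k, Fin (n k))) {j k : Fin m} (h : j ≠ k) :
    block (σ \ blockVerts n k) j = block σ j := by
  ext i
  simp [mem_block, mem_blockVerts, h]

theorem inter_blockVerts (σ : Finset (Σₗ k, Fin (n k))) (k : Fin m) :
    σ ∩ blockVerts n k = (block σ k).map (blockEmb n k).toEmbedding := by
  ext x
  obtain ⟨j, i, rfl⟩ := exists_blockEmb x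
  simp only [Finset.mem_inter, mem_blockVerts, Finset.mem_map, mem_block]
  constructor
  · rintro ⟨h, rfl⟩
    exact ⟨i, h, rfl⟩
  · rintro ⟨a, h, h'⟩
    obtain rfl := blockEmb_injective h'
    obtain rfl := blockEmb_inj.mp h'
    exact ⟨h, rfl⟩

theorem block_insert_same (σ : Finset (Σₗ k, Fin (n k))) (k : Fin m) (w : Fin (n k)) :
    block (insert (blockEmb n k w) σ) k = insert w (block σ k) := by
  ext i
  simp [mem_block]

theorem insert_sdiff_blockVerts (σ : Finset (Σₗ k, Fin (n k))) (k : Fin m) (w : Fin (n k)) :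
    insert (blockEmb n k w) σ \ blockVerts n k = σ \ blockVerts n k :=
  Finset.insert_sdiff_of_mem _ (mem_blockVerts.mpr rfl)

theorem mem_polyhedralJoin {K : SimplicialCx (Fin m)} {X A : ∀ k, SimplicialCx (Fin (n k))}
    {σ : Finset (Σₗ k, Fin (n k))} :
    σ ∈ polyhedralJoin K X A ↔ ∃ τ ∈ K, ∀ k, block σ k ∈ if k ∈ τ then X k else A k := Iff.rfl

end Blocks

theorem ordConnected_diff {V : Type} (J Z : SimplicialCx V) :
    {σ | σ ∈ J ∧ σ ∉ Z}.OrdConnected :=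
  ⟨fun _ ha _ hb _ hc => ⟨J.lower hc.2 hb.1, fun h => ha.2 (Z.lower hc.1 h)⟩⟩

section Removal

variable {m : ℕ} {n : Fin m → ℕ} (K : SimplicialCx (Fin m))
  (X A : ∀ k, SimplicialCx (Fin (n k)))

/-- The part of a polyhedral join outside the `k`-th block: simplices that come from a `τ ∈ K`
satisfying `p τ`. -/
def outside (k : Fin m) (p : Finset (Fin m) → Prop) : SimplicialCx (Σₗ k, Fin (n k)) where
  carrier := {σ | Disjoint σ (blockVerts n k) ∧ ∃ τ ∈ K, p τ ∧
    ∀ j, j ≠ k → block σ j ∈ if j ∈ τ then X j else A j}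
  lower' := by
    rintro σ ρ hρ ⟨hσ, τ, hτ, hp, h⟩
    exact ⟨hσ.mono_left hρ, τ, hτ, hp, fun j hj => LowerSet.lower _ (block_mono hρ j) (h j hj)⟩

theorem mem_outside {k : Fin m} {p : Finset (Fin m) → Prop} {σ : Finset (Σₗ k, Fin (n k))} :
    σ ∈ outside K X A k p ↔ Disjoint σ (blockVerts n k) ∧ ∃ τ ∈ K, p τ ∧
      ∀ j, j ≠ k → block σ j ∈ if j ∈ τ then X j else A j := Iff.rfl

theorem sdiff_mem_outside {k : Fin m} {p : Finset (Fin m) → Prop} {σ : Finset (Σₗ k, Fin (n k))} :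
    σ \ blockVerts n k ∈ outside K X A k p ↔ ∃ τ ∈ K, p τ ∧
      ∀ j, j ≠ k → block σ j ∈ if j ∈ τ then X j else A j := by
  rw [mem_outside, and_iff_right Finset.sdiff_disjoint]
  refine exists_congr fun τ => and_congr_right fun _ => and_congr_right fun _ =>
    forall_congr' fun j => imp_congr_right fun hj => ?_
  rw [block_sdiff_blockVerts σ hj]

theorem outside_congr {X' A' : ∀ k, SimplicialCx (Fin (n k))} (k : Fin m)
    (p : Finset (Fin m) → Prop) (hX : ∀ j, j ≠ k → X j = X' j) (hA : ∀ j, j ≠ k → A j = A' j) :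
    outside K X A k p = outside K X' A' k p := by
  refine SetLike.ext fun σ => ?_
  rw [mem_outside, mem_outside]
  refine and_congr_right fun _ => exists_congr fun τ => and_congr_right fun _ =>
    and_congr_right fun _ => forall_congr' fun j => imp_congr_right fun hj => ?_
  rw [hX j hj, hA j hj]

/-- Once it is known whether `τ` contains `k`, the condition on the `k`-th block is independent of
the conditions on the others. -/
theorem mem_polyhedralJoin_iff (k : Fin m) (σ : Finset (Σₗ k, Fin (n k))) :
    σ ∈ polyhedralJoin K X A ↔
      (σ \ blockVerts n k ∈ outside K X A k (k ∉ ·) ∧ block σ k ∈ A k) ∨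
      (σ \ blockVerts n k ∈ outside K X A k (k ∈ ·) ∧ block σ k ∈ X k) := by
  rw [sdiff_mem_outside, sdiff_mem_outside, mem_polyhedralJoin]
  constructor
  · rintro ⟨τ, hτ, h⟩
    have hk := h k
    by_cases hkτ : k ∈ τ
    · rw [if_pos hkτ] at hk
      exact Or.inr ⟨⟨τ, hτ, hkτ, fun j _ => h j⟩, hk⟩
    · rw [if_neg hkτ] at hk
      exact Or.inl ⟨⟨τ, hτ, hkτ, fun j _ => h j⟩, hk⟩
  · rintro (⟨⟨τ, hτ, hkτ, h⟩, hk⟩ | ⟨⟨τ, hτ, hkτ, h⟩, hk⟩)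
    · refine ⟨τ, hτ, fun j => ?_⟩
      by_cases hj : j = k
      · subst hj
        rwa [if_neg hkτ]
      · exact h j hj
    · refine ⟨τ, hτ, fun j => ?_⟩
      by_cases hj : j = k
      · subst hj
        rwa [if_pos hkτ]
      · exact h j hj

/-- The factor of the `k`-th block splits off from the complex of a polyhedral join. -/
theorem hEquiv_polyhedralJoin (k : Fin m) (w : Fin (n k))
    (hk : {k} ∈ K → A k ≤ X k ∧ ∀ τ ∈ X k, insert w τ ∈ X k) :
    HEquiv (polyhedralJoin K X A).toMatCx ((relCx _ (ordConnected_diff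
      (outside K X A k (k ∉ ·)) (outside K X A k (k ∈ ·)))).tens (A k).toMatCx) := by
  -- If `k` is a ghost vertex, nothing has to be removed and the pair at `k` may be arbitrary.
  have hkK : ∀ {σ}, σ ∈ outside K X A k (k ∈ ·) → {k} ∈ K := fun ⟨_, τ, hτ, hkτ, _⟩ =>
    K.lower (Finset.singleton_subset_iff.mpr hkτ) hτ
  -- The subcomplex to be removed: a join whose factor in block `k` is the cone `X k` with apex `w`.
  let Z : SimplicialCx (Σₗ k, Fin (n k)) :=
    { carrier := {σ | σ \ blockVerts n k ∈ outside K X A k (k ∈ ·) ∧ block σ k ∈ X k}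
      lower' := fun σ ρ hρ h => ⟨LowerSet.lower _ (Finset.sdiff_subset_sdiff hρ subset_rfl) h.1,
        LowerSet.lower _ (block_mono hρ k) h.2⟩ }
  have hZ : ∀ {σ}, σ ∈ Z ↔ σ \ blockVerts n k ∈ outside K X A k (k ∈ ·) ∧ block σ k ∈ X k := Iff.rfl
  have hZJ : Z ≤ polyhedralJoin K X A := fun σ h =>
    (mem_polyhedralJoin_iff K X A k σ).mpr (Or.inr h)
  have h1 := hEquiv_diff _ Z hZJ (blockEmb n k w) (fun σ hσ => by
    rw [hZ, insert_sdiff_blockVerts, block_insert_same]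
    exact ⟨hσ.1, (hk (hkK hσ.1)).2 _ hσ.2⟩) _ (ordConnected_diff _ Z) fun σ => Iff.rfl
  let B : Set (Finset (Σₗ k, Fin (n k))) :=
    {σ | ∃ σ' ∈ A k, σ'.map (blockEmb n k).toEmbedding = σ}
  have hB : IsLowerSet B := by
    rintro _ ρ hρ ⟨σ, hσ, rfl⟩
    obtain ⟨u, hu, rfl⟩ := Finset.subset_map_iff.mp hρ
    exact ⟨u, (A k).lower hu hσ, rfl⟩
  have h2 := hEquiv_map (blockEmb n k) B (A k) hB.ordConnected (A k).lower.ordConnected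
    fun σ => Iff.rfl
  have h3 := hEquiv_tens (blockVerts n k) _ B _ (ordConnected_diff
      (outside K X A k (k ∉ ·)) (outside K X A k (k ∈ ·))) hB.ordConnected
    (ordConnected_diff (polyhedralJoin K X A) Z) (fun σ hσ => hσ.1.1) ?_ ?_
  · exact h1.trans (h3.symm.trans (h2.symm.tens_left _))
  · rintro _ ⟨σ, -, rfl⟩
    exact Finset.map_subset_map.mpr (Finset.subset_univ _)
  · intro σ
    have hBσ : σ ∩ blockVerts n k ∈ B ↔ block σ k ∈ A k := by
      rw [inter_blockVerts]
      constructor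
      · rintro ⟨σ', h, h'⟩
        rwa [← Finset.map_injective _ h']
      · exact fun h => ⟨_, h, rfl⟩
    rw [hBσ]
    simp only [Set.mem_ofPred_eq]
    rw [mem_polyhedralJoin_iff K X A k, hZ]
    constructor
    · rintro ⟨⟨h, h'⟩ | h, hn⟩
      · exact ⟨⟨h, fun h0 => hn ⟨h0, (hk (hkK h0)).1 h'⟩⟩, h'⟩
      · exact absurd h hn
    · rintro ⟨⟨h, h'⟩, h0⟩
      exact ⟨Or.inl ⟨h, h0⟩, fun h'' => h' h''.1⟩

end Removal

/-- The complex with the empty simplex only. -/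
def emptySimplex (V : Type) : SimplicialCx V := LowerSet.Iic ∅

theorem hEquiv_emptySimplex {V : Type} [LinearOrder V] [Fintype V] :
    HEquiv (emptySimplex V).toMatCx (zeroCx Unit fun _ => 0) :=
  hEquiv_singleton ∅ _ (emptySimplex V).lower.ordConnected fun _ => Finset.subset_empty

/-- Only the chosen vertices `v k` can occur, and `k ↦ v k` is an order embedding since the blocks
are ordered one after the other. -/
theorem hEquiv_polyhedralJoin_point {m : ℕ} {n : Fin m → ℕ} (v : ∀ k, Fin (n k))
    (K : SimplicialCx (Fin m)) :
    HEquiv (polyhedralJoin K (fun k => LowerSet.Iic {v k}) fun _ => emptySimplex _).toMatCx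
      K.toMatCx := by
  let φ : Fin m ↪o Σₗ k, Fin (n k) := OrderEmbedding.ofStrictMono (fun k => toLex ⟨k, v k⟩)
    fun _ _ h => Sigma.Lex.lt_def.mpr (Or.inl h)
  refine (hEquiv_map φ _ (K : Set (Finset (Fin m)))
    (polyhedralJoin K _ _).lower.ordConnected K.lower.ordConnected fun σ => ?_).symm
  constructor
  · rintro ⟨τ, hτ, h⟩
    have hsub : σ ⊆ τ.map φ.toEmbedding := by
      intro x hx
      obtain ⟨k, i, rfl⟩ := exists_blockEmb x
      have hi := mem_block.mpr hx
      have := h k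
      by_cases hk : k ∈ τ
      · rw [if_pos hk] at this
        rw [Finset.mem_singleton.mp (this hi)]
        exact Finset.mem_map_of_mem _ hk
      · rw [if_neg hk] at this
        exact absurd (this hi) (Finset.notMem_empty _)
    obtain ⟨u, hu, rfl⟩ := Finset.subset_map_iff.mp hsub
    exact ⟨u, K.lower hu hτ, rfl⟩
  · rintro ⟨τ, hτ, rfl⟩
    refine ⟨τ, hτ, fun k => ?_⟩
    have hb : ∀ i ∈ block (τ.map φ.toEmbedding) k, k ∈ τ ∧ i = v k := by
      intro i hi
      obtain ⟨j, hj, h⟩ := Finset.mem_map.mp (mem_block.mp hi)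
      obtain rfl := blockEmb_injective h
      exact ⟨hj, (blockEmb_inj.mp h).symm⟩
    by_cases hk : k ∈ τ
    · rw [if_pos hk]
      exact fun i hi => Finset.mem_singleton.mpr (hb i hi).2
    · rw [if_neg hk]
      exact fun i hi => absurd (hb i hi).1 hk

section Induction

variable {m : ℕ} {n : Fin m → ℕ} (K : SimplicialCx (Fin m))
  (X A : ∀ k, SimplicialCx (Fin (n k))) (v : ∀ k, Fin (n k))

/-- The polyhedral join in which the pairs of the blocks outside `s` are replaced by
(point, empty simplex). -/
def partialJoin (s : Finset (Fin m)) : SimplicialCx (Σₗ k, Fin (n k)) :=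
  polyhedralJoin K (fun k => if k ∈ s then X k else LowerSet.Iic {v k})
    fun k => if k ∈ s then A k else emptySimplex _

theorem partialJoin_univ : partialJoin K X A v Finset.univ = polyhedralJoin K X A := by
  simp only [partialJoin, Finset.mem_univ, if_true]

theorem hEquiv_partialJoin_empty : HEquiv (partialJoin K X A v ∅).toMatCx K.toMatCx := by
  have h : partialJoin K X A v ∅ =
      polyhedralJoin K (fun k => LowerSet.Iic {v k}) fun _ => emptySimplex _ := by
    simp only [partialJoin, Finset.notMem_empty, if_false]
  rw [h]
  exact hEquiv_polyhedralJoin_point v K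

/-- The factor `P` depends on the other blocks only (`outside_congr`), so it is the same before and
after the exchange at `k`. Before it, the second factor is the chain complex of `{∅}`, that is, ℤ in
degree zero. -/
theorem hEquiv_partialJoin_insert {s : Finset (Fin m)} {k : Fin m} (hks : k ∉ s) (w : Fin (n k))
    (hk : {k} ∈ K → A k ≤ X k ∧ ∀ τ ∈ X k, insert w τ ∈ X k) :
    ∃ P : MatCx, HEquiv (partialJoin K X A v (insert k s)).toMatCx (P.tens (A k).toMatCx) ∧
      HEquiv (partialJoin K X A v s).toMatCx (P.tens (zeroCx Unit fun _ => 0)) := by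
  have h1 := hEquiv_polyhedralJoin K
    (fun j => if j ∈ insert k s then X j else LowerSet.Iic {v j})
    (fun j => if j ∈ insert k s then A j else emptySimplex _) k w (by simpa using hk)
  have h2 := hEquiv_polyhedralJoin K
    (fun j => if j ∈ s then X j else LowerSet.Iic {v j})
    (fun j => if j ∈ s then A j else emptySimplex _) k (v k) (by
      simp only [hks, if_false]
      exact fun _ => ⟨LowerSet.Iic_le.mpr (Finset.empty_subset _), fun τ hτ =>
        Finset.insert_subset (Finset.mem_singleton_self _) hτ⟩)
  have hc : ∀ p, outside K (fun j => if j ∈ insert k s then X j else LowerSet.Iic {v j})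
      (fun j => if j ∈ insert k s then A j else emptySimplex _) k p =
      outside K (fun j => if j ∈ s then X j else LowerSet.Iic {v j})
      (fun j => if j ∈ s then A j else emptySimplex _) k p := fun p => by
    refine outside_congr K _ _ k p ?_ ?_ <;>
    · intro j hj
      simp only [Finset.mem_insert, hj, false_or]
  simp only [hc] at h1
  rw [if_pos (Finset.mem_insert_self k s)] at h1
  rw [if_neg hks] at h2
  exact ⟨_, h1, h2.trans (hEquiv_emptySimplex.tens_left _)⟩

/-- Induction on the set of exchanged blocks: the factor `P` is spherical exactly when the join
before the exchange is, and `sph_tens_iff` adds the condition on `A k`. -/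
theorem sph_polyhedralJoin_iff (hn : ∀ k, 0 < n k)
    (hXA : ∀ k, {k} ∈ K → A k ≤ X k ∧ ∃ w, ∀ τ ∈ X k, insert w τ ∈ X k) :
    (polyhedralJoin K X A).toMatCx.Sph ↔ K.toMatCx.Sph ∧ ∀ k, (A k).toMatCx.Sph := by
  let v : ∀ k, Fin (n k) := fun k => ⟨0, hn k⟩
  have hw : ∀ k, ∃ w, {k} ∈ K → A k ≤ X k ∧ ∀ τ ∈ X k, insert w τ ∈ X k := fun k => by
    by_cases h : {k} ∈ K
    · obtain ⟨h1, w, h2⟩ := hXA k h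
      exact ⟨w, fun _ => ⟨h1, h2⟩⟩
    · exact ⟨v k, fun h' => absurd h' h⟩
  choose w hw using hw
  have main : ∀ s, (partialJoin K X A v s).toMatCx.Sph ↔
      K.toMatCx.Sph ∧ ∀ k ∈ s, (A k).toMatCx.Sph := by
    intro s
    induction s using Finset.induction_on with
    | empty => simpa using (hEquiv_partialJoin_empty K X A v).sph_iff
    | insert k s hk ih =>
      obtain ⟨P, h1, h2⟩ := hEquiv_partialJoin_insert K X A v hk (w k) (hw k)
      rw [h2.sph_iff, sph_tens_iff, and_iff_left (sph_zeroCx_unit 0)] at ih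
      rw [h1.sph_iff, sph_tens_iff, ih, Finset.forall_mem_insert]
      tauto
  rw [← partialJoin_univ K X A v, main]
  simp

end Induction

end SimplicialCx

/-! ### Homology and cohomology of polyhedral joins in terms of bases -/

/-- Reindexing a product of modules. -/
def LinearEquiv.piReindex {R : Type} [CommRing R] {α β : Type} {M : α → Type} {N : β → Type}
    [∀ a, AddCommGroup (M a)]
    [∀ a, Module R (M a)] [∀ b, AddCommGroup (N b)] [∀ b, Module R (N b)] (e : β ≃ α)
    (g : ∀ b, M (e b) ≃ₗ[R] N b) : (∀ a, M a) ≃ₗ[R] ∀ b, N b :=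
  (LinearEquiv.piCongrLeft R M e).symm.trans (LinearEquiv.piCongrRight g)

/-- Modules of a family with equal indices. -/
def LinearEquiv.ofIndexEq {R : Type} [CommRing R] {α : Type} (M : α → Type)
    [∀ a, AddCommGroup (M a)]
    [∀ a, Module R (M a)] {a b : α} (h : a = b) : M a ≃ₗ[R] M b := by
  subst h
  exact LinearEquiv.refl R _

/-- Trivial factors can be removed from a product. -/
theorem nonempty_pi_equiv_of_injective {R : Type} [CommRing R] {α β : Type} (N : β → Type)
    [∀ b, AddCommGroup (N b)]
    [∀ b, Module R (N b)] (g : α → β) (hg : Function.Injective g)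
    (hN : ∀ b, b ∉ Set.range g → Subsingleton (N b)) :
    Nonempty ((∀ a, N (g a)) ≃ₗ[R] ∀ b, N b) := by
  classical
  let F : (∀ b, N b) →ₗ[R] ∀ a, N (g a) :=
    { toFun := fun x a => x (g a)
      map_add' := fun _ _ => rfl
      map_smul' := fun _ _ => rfl }
  refine ⟨(LinearEquiv.ofBijective F ⟨?_, ?_⟩).symm⟩
  · intro x y h
    funext b
    by_cases hb : b ∈ Set.range g
    · obtain ⟨a, rfl⟩ := hb
      exact congrFun h a
    · have := hN b hb
      exact Subsingleton.elim _ _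
  · intro y
    refine ⟨fun b => if h : ∃ a, g a = b then h.choose_spec ▸ y h.choose else 0, ?_⟩
    funext a
    change (if h : ∃ a', g a' = g a then h.choose_spec ▸ y h.choose else 0) = y a
    have hex : ∃ a', g a' = g a := ⟨a, rfl⟩
    rw [dif_pos hex]
    have key : ∀ (a' : α) (h : g a' = g a), (h ▸ y a' : N (g a)) = y a := by
      intro a' h
      obtain rfl := hg h
      rfl
    exact key _ _

namespace MatCx

theorem matHomology_zero {I : Type} [Fintype I] [DecidableEq I] (d : I → ℤ) (q : ℤ) :
    Nonempty (matHomology d (0 : Matrix I I ℤ) q ≃ₗ[ℤ] ({i // d i = q} → ℤ)) := by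
  let f : ↥(LinearMap.ker (0 : Matrix I I ℤ).mulVecLin ⊓ degPart d q) →ₗ[ℤ] ({i // d i = q} → ℤ) :=
    { toFun := fun x i => x.1 i.1
      map_add' := fun _ _ => rfl
      map_smul' := fun _ _ => rfl }
  refine nonempty_subquotient_equiv _ _ f ?_ ?_
  · intro y
    refine ⟨⟨fun i => if h : d i = q then y ⟨i, h⟩ else 0, Matrix.zero_mulVec _, ?_⟩, ?_⟩
    · intro i hi
      by_contra h
      exact hi (dif_neg h)
    · funext i
      exact dif_pos i.2
  · intro x
    constructor
    · intro h
      refine ⟨0, ?_⟩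
      rw [map_zero]
      funext i
      by_contra hi
      have hi' : x.1 i ≠ 0 := fun h0 => hi h0.symm
      exact hi' (congrFun h ⟨i, x.2.2 i hi'⟩)
    · rintro ⟨w, hw⟩
      funext i
      have h1 : x.1 = 0 := hw.symm.trans (Matrix.zero_mulVec w)
      exact congrFun h1 i.1

theorem subsingleton_matHomology_of_neg {β : Type} [Fintype β] {deg : β → ℤ} (D : Matrix β β ℤ)
    (hdeg : ∀ b, 0 ≤ deg b) {q : ℤ} (hq : q < 0) : Subsingleton (matHomology deg D q) := by
  refine subsingleton_of_forall_eq 0 fun y => ?_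
  obtain ⟨y, rfl⟩ := Submodule.mkQ_surjective _ y
  rw [Submodule.mkQ_apply, Submodule.Quotient.mk_eq_zero, mem_submoduleOf,
    eq_zero_of_mem_degPart hdeg hq y.2.2]
  exact Submodule.zero_mem _

end MatCx

namespace SimplicialCx

open MatCx

/-- The common properties of homology and cohomology used to compute them for polyhedral joins:
`H C q` depends on the homotopy type of `C` only, and is computed for a product with a complex
without differential. -/
structure IsHomology (R : Type) [CommRing R] (H : MatCx → ℤ → Type) [∀ C q, AddCommGroup (H C q)]
    [∀ C q, Module R (H C q)] : Prop where
  hEquiv : ∀ {C C' : MatCx}, HEquiv C C' → ∀ q, Nonempty (H C q ≃ₗ[R] H C' q)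
  tens : ∀ (P : MatCx) (I : Type) [Fintype I] [DecidableEq I] (d : I → ℤ) (q : ℤ),
    Nonempty (H (P.tens (zeroCx I d)) q ≃ₗ[R] ∀ i, H P (q - d i))

theorem isHomology_homology : IsHomology ℤ fun C q => matHomology C.deg C.D q :=
  ⟨HEquiv.homology, fun P I _ _ d q => homology_tens_zeroCx P I d q⟩

theorem isHomology_cohomology : IsHomology ℤ fun C q => matHomology C.deg C.Dᵀ q :=
  ⟨HEquiv.cohomology, fun P I _ _ d q => cohomology_tens_zeroCx P I d q⟩

/-- A family `f` picks one basis class in every block; it contributes a copy of the homology of `K`,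
shifted by the total degree of the picked classes. -/
theorem IsHomology.polyhedralJoin {R : Type} [CommRing R] {H : MatCx → ℤ → Type}
    [∀ C q, AddCommGroup (H C q)]
    [∀ C q, Module R (H C q)] (hH : IsHomology R H) {m : ℕ} {n : Fin m → ℕ}
    (K : SimplicialCx (Fin m)) (X A : ∀ k, SimplicialCx (Fin (n k))) (w : ∀ k, Fin (n k))
    (hXA : ∀ k, {k} ∈ K → A k ≤ X k ∧ ∀ τ ∈ X k, insert (w k) τ ∈ X k)
    (I : Fin m → Type) [∀ k, Fintype (I k)] [∀ k, DecidableEq (I k)] (d : ∀ k, I k → ℤ)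
    (hI : ∀ k, HEquiv (A k).toMatCx (zeroCx (I k) (d k))) (N : ℤ) :
    Nonempty (H (polyhedralJoin K X A).toMatCx N ≃ₗ[R]
      ∀ f : (∀ k, I k), H K.toMatCx (N - ∑ k, d k (f k))) := by
  have main : ∀ s : Finset (Fin m), ∀ N, Nonempty (H (partialJoin K X A w s).toMatCx N ≃ₗ[R]
      ∀ f : (∀ k ∈ s, I k), H K.toMatCx (N - ∑ k, if h : k ∈ s then d k (f k h) else 0)) := by
    intro s
    induction s using Finset.induction_on with
    | empty =>
      intro N
      obtain ⟨e⟩ := hH.hEquiv (hEquiv_partialJoin_empty K X A w) N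
      let u : Unit ≃ (∀ k ∈ (∅ : Finset (Fin m)), I k) :=
        { toFun := fun _ k hk => absurd hk (Finset.notMem_empty k)
          invFun := fun _ => ()
          left_inv := fun _ => rfl
          right_inv := fun _ => by
            funext k hk
            exact absurd hk (Finset.notMem_empty k) }
      refine ⟨e.trans ((LinearEquiv.funUnique Unit R _).symm.trans
        (LinearEquiv.piReindex u.symm fun f => LinearEquiv.ofIndexEq (H K.toMatCx) ?_))⟩
      simp
    | insert k s hk ih =>
      intro N
      obtain ⟨P, h1, h2⟩ := hEquiv_partialJoin_insert K X A w hk (w k) (hXA k)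
      obtain ⟨e1⟩ := hH.hEquiv (h1.trans ((hI k).tens_left P)) N
      obtain ⟨e2⟩ := hH.tens P (I k) (d k) N
      -- Tensoring with ℤ in degree zero changes nothing, so `P` has the homology known by
      -- induction.
      have e3 : ∀ M, Nonempty (H P M ≃ₗ[R] ∀ f : (∀ k ∈ s, I k), H K.toMatCx
          (M - ∑ k, if h : k ∈ s then d k (f k h) else 0)) := by
        intro M
        obtain ⟨a⟩ := hH.tens P Unit (fun _ => 0) M
        obtain ⟨b⟩ := hH.hEquiv h2 M
        obtain ⟨c⟩ := ih M
        exact ⟨(LinearEquiv.ofIndexEq (H P) (sub_zero M).symm).trans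
          ((LinearEquiv.funUnique Unit R _).symm.trans (a.symm.trans (b.symm.trans c)))⟩
      let e4 := LinearEquiv.piCongrRight fun i : I k => (e3 (N - d k i)).some
      let e5 := (LinearEquiv.piCurry R (ι := I k) (κ := fun _ => ∀ k ∈ s, I k) fun i f =>
        H K.toMatCx (N - d k i - ∑ k, if h : k ∈ s then d k (f k h) else 0)).symm
      refine ⟨e1.trans (e2.trans (e4.trans (e5.trans (LinearEquiv.piReindex
        ((Finset.insertPiProdEquiv I hk).trans (Equiv.sigmaEquivProd _ _).symm) fun f =>
          LinearEquiv.ofIndexEq (H K.toMatCx) ?_))))⟩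
      have hs : ∀ j, (if h : j ∈ insert k s then d j (f j h) else 0) =
          (if j = k then d k (f k (Finset.mem_insert_self k s)) else 0) +
            if h : j ∈ s then d j (f j (Finset.mem_insert_of_mem h)) else 0 := by
        intro j
        by_cases hj : j = k
        · subst hj
          simp [hk]
        · simp [hj]
      rw [Finset.sum_congr rfl fun j _ => hs j, Finset.sum_add_distrib, Finset.sum_ite_eq' ,
        if_pos (Finset.mem_univ k), ← sub_sub]
      rfl
  obtain ⟨e⟩ := main Finset.univ N
  rw [partialJoin_univ] at e
  let u : (∀ k ∈ (Finset.univ : Finset (Fin m)), I k) ≃ ∀ k, I k :=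
    { toFun := fun f k => f k (Finset.mem_univ k)
      invFun := fun f k _ => f k
      left_inv := fun _ => rfl
      right_inv := fun _ => rfl }
  refine ⟨e.trans (LinearEquiv.piReindex u.symm fun f => LinearEquiv.ofIndexEq (H K.toMatCx) ?_)⟩
  simp [u]

end SimplicialCx

/-! ### The Künneth formula -/

section Kunneth

/-- The tensor product of finitely generated free modules. -/
def piTensorEquiv {R : Type} [CommRing R] {m : ℕ} (Q : Fin m → Type)
    [∀ k, AddCommGroup (Q k)] [∀ k, Module R (Q k)] (J : Fin m → Type) [∀ k, Finite (J k)]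
    (e : ∀ k, Q k ≃ₗ[R] (J k → R)) : (⨂[R] k, Q k) ≃ₗ[R] ((∀ k, J k) → R) := by
  classical
  exact ((PiTensorProduct.congr fun k =>
    (e k).trans (Finsupp.linearEquivFunOnFinite R R (J k)).symm).trans
      PiTensorProduct.ofFinsuppEquiv').trans (Finsupp.linearEquivFunOnFinite R R (∀ k, J k))

/-- Tensoring with a finitely generated free module. -/
def tensorFunEquiv {R : Type} [CommRing R] (M T : Type) [AddCommGroup M] [Module R M]
    [AddCommGroup T] [Module R T] (J : Type) [Finite J] (e : T ≃ₗ[R] (J → R)) :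
    M ⊗[R] T ≃ₗ[R] (J → M) := by
  classical
  exact (TensorProduct.congr (LinearEquiv.refl R M)
    (e.trans (Finsupp.linearEquivFunOnFinite R R J).symm)).trans
    ((TensorProduct.finsuppScalarRight R R M J).trans (Finsupp.linearEquivFunOnFinite R M J))

/-- Expanding the free factors in bases turns each summand into copies of `M`, indexed by families
of basis elements of the prescribed degrees. The degrees of a family together with `N` determine the
summand, so all summands together run once through the families of total degree at most `N`. -/
theorem nonempty_directSum_tensor_equiv {R : Type} [CommRing R] {m : ℕ} (M : ℕ → Type)
    [∀ q, AddCommGroup (M q)]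
    [∀ q, Module R (M q)] (M' : ℤ → Type) [∀ q, AddCommGroup (M' q)] [∀ q, Module R (M' q)]
    (hM : ∀ q : ℕ, Nonempty (M q ≃ₗ[R] M' q)) (hM' : ∀ q < 0, Subsingleton (M' q))
    (T : (Fin m → ℕ) → Type) [∀ q, AddCommGroup (T q)] [∀ q, Module R (T q)]
    (I : Fin m → Type) [∀ k, Finite (I k)] (d : ∀ k, I k → ℤ) (hd : ∀ k i, 0 ≤ d k i)
    (hT : ∀ q, Nonempty (T q ≃ₗ[R] ((∀ k, {i // d k i = (q k : ℕ)}) → R))) (N : ℕ) :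
    Nonempty ((⨁ p : {p : ℕ × (Fin m → ℕ) // p.1 + ∑ k, p.2 k = N},
        M p.1.1 ⊗[R] T p.1.2) ≃+
      ∀ f : (∀ k, I k), M' (N - ∑ k, d k (f k))) := by
  classical
  let S := {p : ℕ × (Fin m → ℕ) // p.1 + ∑ k, p.2 k = N}
  -- All the degrees involved are natural numbers with sum `N`.
  have : Finite S := by
    refine Finite.of_injective (fun p : S => (⟨p.1.1, ?_⟩, fun k => ⟨p.1.2 k, ?_⟩) :
      S → Fin (N + 1) × (Fin m → Fin (N + 1))) ?_
    · have := p.2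
      omega
    · have h1 := p.2
      have h2 := Finset.single_le_sum (fun j _ => Nat.zero_le (p.1.2 j)) (Finset.mem_univ k)
      omega
    · rintro ⟨⟨a, b⟩, h⟩ ⟨⟨a', b'⟩, h'⟩ hab
      simp only [Prod.mk.injEq, Fin.mk.injEq, funext_iff] at hab
      exact Subtype.ext (Prod.ext hab.1 (funext hab.2))
  have : Fintype S := Fintype.ofFinite S
  let J : S → Type := fun p => ∀ k, {i // d k i = (p.1.2 k : ℕ)}
  let g : (Σ p, J p) → ∀ k, I k := fun x k => (x.2 k).1
  have hgd : ∀ x : Σ p, J p, ((x.1.1.1 : ℕ) : ℤ) = N - ∑ k, d k (g x k) := by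
    rintro ⟨p, x⟩
    have h : ∑ k, d k (g ⟨p, x⟩ k) = ((∑ k, p.1.2 k : ℕ) : ℤ) := by
      rw [Nat.cast_sum]
      exact Finset.sum_congr rfl fun k _ => (x k).2
    rw [h]
    have := p.2
    simp only
    omega
  have hg : Function.Injective g := by
    rintro ⟨p, x⟩ ⟨p', x'⟩ h
    have hk : ∀ k, (x k).1 = (x' k).1 := congrFun h
    have hp : p = p' := by
      refine Subtype.ext (Prod.ext ?_ (funext fun k => ?_))
      · have h1 := hgd ⟨p, x⟩
        have h2 := hgd ⟨p', x'⟩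
        rw [h, ← h2] at h1
        exact Nat.cast_injective (R := ℤ) h1
      · refine Nat.cast_injective (R := ℤ) ?_
        rw [← (x k).2, ← (x' k).2, hk]
    subst hp
    exact congrArg _ (funext fun k => Subtype.ext (hk k))
  obtain ⟨e⟩ := nonempty_pi_equiv_of_injective (R := R)
    (fun f : (∀ k, I k) => M' (N - ∑ k, d k (f k))) g hg
    (by
      intro f hf
      refine hM' _ ?_
      -- A family outside the range of `g` has total degree above `N`, where `M'` is taken in
      -- negative degree and vanishes.
      by_contra hlt
      refine hf ⟨⟨⟨((N - ∑ k, d k (f k)).toNat, fun k => (d k (f k)).toNat), ?_⟩,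
        fun k => ⟨f k, (Int.toNat_of_nonneg (hd k (f k))).symm⟩⟩, rfl⟩
      have h : ((∑ k, (d k (f k)).toNat : ℕ) : ℤ) = ∑ k, d k (f k) := by
        rw [Nat.cast_sum]
        exact Finset.sum_congr rfl fun k _ => Int.toNat_of_nonneg (hd k (f k))
      simp only
      omega)
  exact ⟨((DirectSum.linearEquivFunOnFintype R S _).trans
    ((LinearEquiv.piCongrRight fun p => tensorFunEquiv _ _ _ (hT p.1.2).some).trans
      ((LinearEquiv.piCurry R (ι := S) (κ := J) fun p _ => M p.1.1).symm.trans
        ((LinearEquiv.piCongrRight fun x => (hM x.1.1.1).some.trans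
          (LinearEquiv.ofIndexEq M' (hgd x))).trans e)))).toAddEquiv⟩

end Kunneth

/-- Additive equivalences are `ℤ`-linear for any `ℤ`-module structures. -/
def AddEquiv.toIntLinear {M N : Type} [AddCommGroup M] [AddCommGroup N] {mM : Module ℤ M}
    {mN : Module ℤ N} (f : M ≃+ N) : M ≃ₗ[ℤ] N :=
  { MatCx.intLinear f.toAddMonoidHom with
    invFun := f.symm
    left_inv := f.left_inv
    right_inv := f.right_inv }

namespace SimplicialCx

open MatCx

section

variable {m : ℕ} {n : Fin m → ℕ} (K : SimplicialCx (Fin m)) (L : ∀ k, SimplicialCx (Fin (n k)))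

theorem exists_hEquiv_zeroCx_of_free {V : Type} [LinearOrder V] [Fintype V] (K : SimplicialCx V)
    (h : ∀ q, Module.Free ℤ (K.redHomology q)) :
    ∃ (I : Type) (_ : Fintype I) (_ : DecidableEq I) (d : I → ℤ), (∀ i, 0 ≤ d i) ∧
      HEquiv K.toMatCx (zeroCx I d) := by
  have hdeg : ∀ b, 0 ≤ K.toMatCx.deg b := fun σ => Int.natCast_nonneg _
  obtain ⟨I, i1, i2, d, H⟩ := exists_hEquiv_zeroCx K.toMatCx fun q => by
    obtain hq | hq := lt_or_ge q 0
    · have := subsingleton_matHomology_of_neg K.toMatCx.D hdeg hq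
      exact Module.Free.of_subsingleton ℤ _
    · lift q to ℕ using hq
      obtain ⟨e⟩ := K.redHomology_equiv q
      have := h q
      exact Module.Free.of_equiv e
  refine ⟨I, i1, i2, d, fun i => ?_, H⟩
  -- A basis element of negative degree would give nonzero homology there.
  by_contra hi
  have := subsingleton_matHomology_of_neg K.toMatCx.D hdeg (not_le.mp hi)
  obtain ⟨e⟩ := H.homology (d i)
  obtain ⟨e'⟩ := matHomology_zero d (d i)
  have h1 := (e.trans e').symm.injective.subsingleton
  exact zero_ne_one (congrFun (h1.elim 0 1) ⟨i, rfl⟩)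

theorem nonempty_directSum_tensor_equiv_int {m : ℕ} (M : ℕ → ModuleCat.{0} ℤ)
    (M' : ℤ → Type) [∀ q, AddCommGroup (M' q)] [∀ q, Module ℤ (M' q)]
    (hM : ∀ q : ℕ, Nonempty (M q ≃ₗ[ℤ] M' q)) (hM' : ∀ q < 0, Subsingleton (M' q))
    (Q : Fin m → ℕ → ModuleCat.{0} ℤ)
    (I : Fin m → Type) [∀ k, Finite (I k)] (d : ∀ k, I k → ℤ) (hd : ∀ k i, 0 ≤ d k i)
    (hQ : ∀ k (q : ℕ), Nonempty (Q k q ≃ₗ[ℤ] ({i // d k i = q} → ℤ))) (N : ℕ) (Y : ModuleCat.{0} ℤ)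
    (hY : Nonempty (Y ≃ₗ[ℤ] ∀ f : (∀ k, I k), M' (N - ∑ k, d k (f k)))) :
    Nonempty (Y ≃ₗ[ℤ] ⨁ p : {p : ℕ × (Fin m → ℕ) // p.1 + ∑ k, p.2 k = N},
        M p.1.1 ⊗[ℤ] (⨂[ℤ] k, Q k (p.1.2 k))) := by
  obtain ⟨e⟩ := nonempty_directSum_tensor_equiv (R := ℤ) (fun q => M q) M' hM hM'
    (fun q => ⨂[ℤ] k, Q k (q k)) I d hd (fun q =>
      ⟨(piTensorEquiv (R := ℤ) (fun k => Q k (q k)) _ fun k =>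
        ((hQ k (q k)).some.toAddEquiv.toIntLinear)).toAddEquiv.toIntLinear⟩) N
  obtain ⟨f⟩ := hY
  exact ⟨(f.toAddEquiv.trans e.symm).toIntLinear⟩

/-- Each `L k` is replaced by its homology up to homotopy, and the same graded basis `(I k, d k)`
computes its cohomology, so no separate freeness of cohomology is needed. The full simplex on a
nonempty block is a cone over any of its vertices. -/
theorem kunneth (hn : ∀ k, 0 < n k) (h : ∀ k q, Module.Free ℤ ((L k).redHomology q)) (N : ℕ) :
    Nonempty ((K.composition L).redHomology N ≃ₗ[ℤ]
      ⨁ p : {p : ℕ × (Fin m → ℕ) // p.1 + ∑ k, p.2 k = N},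
        K.redHomology p.1.1 ⊗[ℤ] (⨂[ℤ] k : Fin m, (L k).redHomology (p.1.2 k))) ∧
    Nonempty ((K.composition L).redCohomology N ≃ₗ[ℤ]
      ⨁ p : {p : ℕ × (Fin m → ℕ) // p.1 + ∑ k, p.2 k = N},
        K.redCohomology p.1.1 ⊗[ℤ] (⨂[ℤ] k : Fin m, (L k).redCohomology (p.1.2 k))) := by
  have hdeg : ∀ b, 0 ≤ K.toMatCx.deg b := fun σ => Int.natCast_nonneg _
  choose I i1 i2 d hd H using fun k => exists_hEquiv_zeroCx_of_free (L k) (h k)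
  have hXA : ∀ k, {k} ∈ K → L k ≤ ⊤ ∧ ∀ τ ∈ (⊤ : SimplicialCx (Fin (n k))),
      insert (⟨0, hn k⟩ : Fin (n k)) τ ∈ (⊤ : SimplicialCx (Fin (n k))) :=
    fun k _ => ⟨le_top, fun _ _ => LowerSet.mem_top⟩
  constructor
  · refine nonempty_directSum_tensor_equiv_int (fun q => K.redHomology q) _ K.redHomology_equiv
      (fun q hq => subsingleton_matHomology_of_neg _ hdeg hq) (fun k q => (L k).redHomology q) I d
      hd (fun k q => ?_) N _ ?_
    · obtain ⟨a⟩ := (L k).redHomology_equiv q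
      obtain ⟨b⟩ := (H k).homology q
      obtain ⟨c⟩ := matHomology_zero (d k) q
      exact ⟨a.trans (b.trans c)⟩
    · obtain ⟨a⟩ := (K.composition L).redHomology_equiv N
      obtain ⟨b⟩ := isHomology_homology.polyhedralJoin K _ L _ hXA I d H N
      exact ⟨(a.toAddEquiv.trans b.toAddEquiv).toIntLinear⟩
  · refine nonempty_directSum_tensor_equiv_int (fun q => K.redCohomology q) _
      K.redCohomology_equiv (fun q hq => subsingleton_matHomology_of_neg _ hdeg hq)
      (fun k q => (L k).redCohomology q) I d hd (fun k q => ?_) N _ ?_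
    · obtain ⟨a⟩ := (L k).redCohomology_equiv q
      obtain ⟨b⟩ := (H k).cohomology q
      have h0 : (zeroCx (I k) (d k)).Dᵀ = 0 := Matrix.transpose_zero
      rw [h0] at b
      obtain ⟨c⟩ := matHomology_zero (d k) q
      exact ⟨a.trans (b.trans c)⟩
    · obtain ⟨a⟩ := (K.composition L).redCohomology_equiv N
      obtain ⟨b⟩ := isHomology_cohomology.polyhedralJoin K _ L _ hXA I d H N
      exact ⟨(a.toAddEquiv.trans b.toAddEquiv).toIntLinear⟩

theorem homologySpherical_composition_iff (hn : ∀ k, 0 < n k) :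
    (K.composition L).HomologySpherical ↔
      K.HomologySpherical ∧ ∀ k, (L k).HomologySpherical := by
  simp only [homologySpherical_iff]
  exact sph_polyhedralJoin_iff K _ L hn fun k _ =>
    ⟨le_top, ⟨0, hn k⟩, fun _ _ => LowerSet.mem_top⟩

end

end SimplicialCx

/-! ### Links and homological spheres -/

namespace SimplicialCx

open MatCx

section Link

theorem ne_bot_iff {V : Type} {K : SimplicialCx V} : K ≠ ⊥ ↔ ∅ ∈ K := by
  constructor
  · intro h
    by_contra h0
    refine h (SetLike.ext fun σ => ⟨fun hσ => ?_, fun hσ => absurd hσ LowerSet.notMem_bot⟩)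
    exact absurd (K.lower (Finset.empty_subset σ) hσ) h0
  · rintro h rfl
    exact LowerSet.notMem_bot h

variable {V : Type} [LinearOrder V]

/-- The link in a complex on an ordered vertex set. -/
abbrev lk (K : SimplicialCx V) (σ : Finset V) : SimplicialCx V := K.link σ

theorem mem_lk {K : SimplicialCx V} {σ τ : Finset V} [D : DecidableEq V] :
    τ ∈ K.lk σ ↔ σ ∪ τ ∈ K ∧ Disjoint σ τ := by
  rw [Subsingleton.elim D LinearOrder.toDecidableEq]
  exact Iff.rfl

theorem lk_empty (K : SimplicialCx V) : K.lk ∅ = K := by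
  refine SetLike.ext fun τ => ?_
  rw [mem_lk, Finset.empty_union]
  exact and_iff_left (Finset.disjoint_empty_left τ)

theorem mem_lk_top {σ τ : Finset V} : τ ∈ (⊤ : SimplicialCx V).lk σ ↔ Disjoint σ τ := by
  rw [mem_lk]
  exact and_iff_right LowerSet.mem_top

theorem insert_mem_lk_top {σ τ : Finset V} {w : V} (hw : w ∉ σ)
    (h : τ ∈ (⊤ : SimplicialCx V).lk σ) : insert w τ ∈ (⊤ : SimplicialCx V).lk σ := by
  rw [mem_lk_top] at h ⊢
  exact Finset.disjoint_insert_right.mpr ⟨hw, h⟩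

variable [Fintype V]

theorem homologicalSphere_iff (K : SimplicialCx V) :
    K.HomologicalSphere ↔ ∅ ∈ K ∧ ∀ σ ∈ K, (K.lk σ).toMatCx.Sph := by
  rw [HomologicalSphere, ne_bot_iff]
  exact and_congr_right fun _ => forall_congr' fun σ => imp_congr_right fun _ =>
    homologySpherical_iff _

theorem HomologicalSphere.sph {K : SimplicialCx V} (h : K.HomologicalSphere) : K.toMatCx.Sph := by
  obtain ⟨h0, h1⟩ := (homologicalSphere_iff K).mp h
  have h2 := h1 ∅ h0
  rwa [lk_empty] at h2

theorem ne_top_of_sph [Nonempty V] {K : SimplicialCx V} (h : K.toMatCx.Sph) : Finset.univ ∉ K := by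
  intro hK
  exact not_sph_of_cone K (Classical.arbitrary V)
    (fun σ _ => K.lower (Finset.subset_univ _) hK) h

theorem empty_mem_of_sph [Nonempty V] {K : SimplicialCx V} (h : K.toMatCx.Sph) : ∅ ∈ K := by
  by_contra h0
  exact not_sph_of_cone K (Classical.arbitrary V)
    (fun σ hσ => absurd (K.lower (Finset.empty_subset σ) hσ) h0) h

/-- The link of `σ` in the full simplex is the simplex on the complement: a cone, unless the
complement is empty and the link is `{∅}`. -/
theorem sph_lk_top_iff {σ : Finset V} :
    ((⊤ : SimplicialCx V).lk σ).toMatCx.Sph ↔ σ = Finset.univ := by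
  constructor
  · intro h
    by_contra hσ
    obtain ⟨w, hw⟩ : ∃ w, w ∉ σ := by
      by_contra! hall
      exact hσ (Finset.eq_univ_iff_forall.mpr hall)
    exact not_sph_of_cone _ w (fun τ hτ => insert_mem_lk_top hw hτ) h
  · rintro rfl
    have h : (⊤ : SimplicialCx V).lk Finset.univ = emptySimplex V := by
      refine SetLike.ext fun τ => ?_
      rw [mem_lk_top]
      constructor
      · intro h x hx
        exact absurd hx (Finset.disjoint_left.mp h (Finset.mem_univ x))
      · intro h
        rw [Finset.subset_empty.mp h]
        exact Finset.disjoint_empty_right _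
    rw [h]
    exact hEquiv_emptySimplex.sph_iff.mpr (sph_zeroCx_unit 0)

/-- This link is the boundary of the simplex on the complement of `σ`. For a vertex `w` of the
complement, the sets to which `w` can be added form a cone, and its removal leaves one simplex, the
face opposite to `w`. -/
theorem sph_lk_simplexBoundary {σ : Finset V} (hσ : σ ≠ Finset.univ) :
    ((simplexBoundary V).lk σ).toMatCx.Sph := by
  obtain ⟨w, hw⟩ : ∃ w, w ∉ σ := by
    by_contra! hall
    exact hσ (Finset.eq_univ_iff_forall.mpr hall)
  let Z : SimplicialCx V :=
    { carrier := {τ | insert w τ ∈ (simplexBoundary V).lk σ}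
      lower' := fun τ ρ h hτ => ((simplexBoundary V).lk σ).lower
        (Finset.insert_subset_insert w h) hτ }
  have hZ : ∀ τ, τ ∈ Z ↔ insert w τ ∈ (simplexBoundary V).lk σ := fun _ => Iff.rfl
  have hmem : ∀ τ, τ ∈ (simplexBoundary V).lk σ ↔ σ ∪ τ ≠ Finset.univ ∧ Disjoint σ τ :=
    fun _ => Iff.rfl
  have h1 := hEquiv_diff ((simplexBoundary V).lk σ) Z
    (fun τ hτ => LowerSet.lower _ (Finset.subset_insert w τ) hτ) w
    (fun τ hτ => by rwa [hZ, Finset.insert_idem]) _ (ordConnected_diff _ Z) fun _ => Iff.rfl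
  have h2 := hEquiv_singleton (σᶜ.erase w) _ (ordConnected_diff ((simplexBoundary V).lk σ) Z)
    fun τ => by
      rw [Set.mem_ofPred_eq, hZ, hmem, hmem, Finset.disjoint_insert_right]
      constructor
      · rintro ⟨⟨h3, h4⟩, h5⟩
        have h6 : σ ∪ insert w τ = Finset.univ := by
          by_contra h
          exact h5 ⟨h, hw, h4⟩
        have hwτ : w ∉ τ := fun h => h3 (by rwa [Finset.insert_eq_of_mem h] at h6)
        ext x
        have hx : x ∈ σ ∪ insert w τ := h6 ▸ Finset.mem_univ x
        rw [Finset.mem_union, Finset.mem_insert] at hx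
        rw [Finset.mem_erase, Finset.mem_compl]
        constructor
        · intro h
          exact ⟨fun h' => hwτ (h' ▸ h), Finset.disjoint_right.mp h4 h⟩
        · rintro ⟨h, h'⟩
          tauto
      · rintro rfl
        refine ⟨⟨fun h => ?_, ?_⟩, fun h => h.1 ?_⟩
        · have := Finset.mem_univ w
          rw [← h, Finset.mem_union, Finset.mem_erase] at this
          tauto
        · exact disjoint_compl_right.mono_right (Finset.erase_subset _ _)
        · rw [Finset.insert_erase (Finset.mem_compl.mpr hw), Finset.union_compl]
  exact (h1.trans h2).sph_iff.mpr (sph_zeroCx_unit _)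

end Link

section Composition

variable {m : ℕ} {n : Fin m → ℕ} (K : SimplicialCx (Fin m)) (L : ∀ k, SimplicialCx (Fin (n k)))

theorem mem_composition {σ : Finset (Σₗ k, Fin (n k))} :
    σ ∈ K.composition L ↔ ∃ τ ∈ K, ∀ k, k ∉ τ → block σ k ∈ L k := by
  refine exists_congr fun τ => and_congr_right fun _ => forall_congr' fun k => ?_
  by_cases h : k ∈ τ
  · simp [h]
  · simp [h]

open Classical in
/-- The blocks in which `σ` is not a simplex. -/
def missing (σ : Finset (Σₗ k, Fin (n k))) : Finset (Fin m) :=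
  Finset.univ.filter fun k => block σ k ∉ L k

theorem mem_missing {σ : Finset (Σₗ k, Fin (n k))} {k : Fin m} :
    k ∈ missing L σ ↔ block σ k ∉ L k := by
  simp [missing]

open Classical in
/-- The smaller one of `L k` and `⊤` that contains the `k`-th block of `σ`. -/
def hull (σ : Finset (Σₗ k, Fin (n k))) (k : Fin m) : SimplicialCx (Fin (n k)) :=
  if block σ k ∈ L k then L k else ⊤

theorem block_union (σ τ : Finset (Σₗ k, Fin (n k))) (k : Fin m) :
    block (σ ∪ τ) k = block σ k ∪ block τ k := by
  ext i
  simp [mem_block]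

theorem disjoint_iff_block {σ τ : Finset (Σₗ k, Fin (n k))} :
    Disjoint σ τ ↔ ∀ k, Disjoint (block σ k) (block τ k) := by
  simp only [Finset.disjoint_left, mem_block]
  constructor
  · intro h k i
    exact fun h' => h h'
  · intro h x
    obtain ⟨k, i, rfl⟩ := exists_blockEmb x
    exact fun h' => h k h'

/-- A witness `ρ ∈ K` for `σ ∪ τ` must contain all missing blocks of `σ`, and removing them gives a
simplex of the link in `K`. In a missing block, `τ` only has to be disjoint from `σ`; `hull` puts
this into the form of a polyhedral join. -/
theorem lk_composition (σ : Finset (Σₗ k, Fin (n k))) :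
    (K.composition L).lk σ = polyhedralJoin (K.lk (missing L σ))
      (fun k => (⊤ : SimplicialCx (Fin (n k))).lk (block σ k))
      (fun k => (hull L σ k).lk (block σ k)) := by
  refine SetLike.ext fun τ => ?_
  rw [mem_lk, mem_composition, mem_polyhedralJoin]
  constructor
  · rintro ⟨⟨ρ, hρ, h⟩, hd⟩
    rw [disjoint_iff_block] at hd
    have hsub : missing L σ ⊆ ρ := by
      intro k hk
      by_contra hkρ
      have := h k hkρ
      rw [block_union] at this
      exact mem_missing L |>.mp hk ((L k).lower Finset.subset_union_left this)
    refine ⟨ρ \ missing L σ, ?_, fun k => ?_⟩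
    · rw [mem_lk, Finset.union_sdiff_of_subset hsub]
      exact ⟨hρ, Finset.disjoint_sdiff⟩
    · by_cases hk : k ∈ ρ \ missing L σ
      · rw [if_pos hk, mem_lk_top]
        exact hd k
      · rw [if_neg hk]
        by_cases hσ : block σ k ∈ L k
        · rw [hull, if_pos hσ, mem_lk]
          have hkρ : k ∉ ρ := fun h' => hk (Finset.mem_sdiff.mpr
            ⟨h', fun h'' => mem_missing L |>.mp h'' hσ⟩)
          have := h k hkρ
          rw [block_union] at this
          exact ⟨this, hd k⟩
        · rw [hull, if_neg hσ, mem_lk_top]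
          exact hd k
  · rintro ⟨ρ, hρ, h⟩
    rw [mem_lk] at hρ
    refine ⟨⟨_, hρ.1, fun k hk => ?_⟩, disjoint_iff_block.mpr fun k => ?_⟩
    · rw [Finset.mem_union, not_or] at hk
      have hσ : block σ k ∈ L k := by
        by_contra h'
        exact hk.1 ((mem_missing L).mpr h')
      have := h k
      rw [if_neg hk.2, hull, if_pos hσ, mem_lk] at this
      rw [block_union]
      exact this.1
    · have := h k
      by_cases hk : k ∈ ρ
      · rw [if_pos hk, mem_lk] at this
        exact this.2
      · rw [if_neg hk, mem_lk] at this
        exact this.2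

theorem sph_lk_composition_iff (hn : ∀ k, 0 < n k) (hL : ∀ k, (L k).toMatCx.Sph)
    (σ : Finset (Σₗ k, Fin (n k))) :
    ((K.composition L).lk σ).toMatCx.Sph ↔ (K.lk (missing L σ)).toMatCx.Sph ∧
      (∀ k, block σ k ∈ L k → ((L k).lk (block σ k)).toMatCx.Sph) ∧
      ∀ k, block σ k ∉ L k → block σ k = Finset.univ := by
  have hne : ∀ k, Nonempty (Fin (n k)) := fun k => ⟨⟨0, hn k⟩⟩
  rw [lk_composition, sph_polyhedralJoin_iff _ _ _ hn, ← forall_and]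
  · refine and_congr_right fun _ => forall_congr' fun k => ?_
    by_cases h : block σ k ∈ L k
    · simp [hull, h]
    · simp [hull, h, sph_lk_top_iff]
  · intro k hk
    refine ⟨fun τ hτ => mem_lk_top.mpr (mem_lk.mp hτ).2, ?_⟩
    -- A non-ghost vertex of the link in `K` is not a missing block. As a spherical `L k` does not
    -- contain its full vertex set, some vertex `w` is left to be the apex. At missing blocks, which
    -- are ghost vertices here, no cone is required.
    have hσ : block σ k ∈ L k := by
      by_contra h
      rw [mem_lk, Finset.disjoint_singleton_right] at hk
      exact hk.2 ((mem_missing L).mpr h)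
    obtain ⟨w, hw⟩ : ∃ w, w ∉ block σ k := by
      by_contra! hall
      exact ne_top_of_sph (hL k) (Finset.eq_univ_iff_forall.mpr hall ▸ hσ)
    exact ⟨w, fun τ hτ => insert_mem_lk_top hw hτ⟩

/-- The vertex set with given blocks. -/
def ofBlocks (τ : ∀ k, Finset (Fin (n k))) : Finset (Σₗ k, Fin (n k)) :=
  Finset.univ.filter fun x => x.2 ∈ τ x.1

theorem block_ofBlocks (τ : ∀ k, Finset (Fin (n k))) (k : Fin m) : block (ofBlocks τ) k = τ k := by
  ext i
  rw [mem_block, ofBlocks, Finset.mem_filter]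
  exact and_iff_right (Finset.mem_univ _)

theorem block_update_same (k : Fin m) (τ : Finset (Fin (n k))) :
    block (ofBlocks (Function.update (fun _ => ∅) k τ)) k = τ := by
  rw [block_ofBlocks, Function.update_self]

theorem block_update_of_ne {j k : Fin m} (τ : Finset (Fin (n k))) (h : j ≠ k) :
    block (ofBlocks (Function.update (fun _ => ∅) k τ)) j = ∅ := by
  rw [block_ofBlocks, Function.update_of_ne h]

theorem homologicalSphere_composition_iff (hn : ∀ k, 0 < n k) :
    (K.composition L).HomologicalSphere ↔ K.HomologicalSphere ∧
      (∀ k, {k} ∈ K → L k = simplexBoundary (Fin (n k))) ∧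
      (∀ k, {k} ∉ K → (L k).HomologicalSphere) := by
  have hne : ∀ k, Nonempty (Fin (n k)) := fun k => ⟨⟨0, hn k⟩⟩
  constructor
  · intro h
    have hS := (homologySpherical_iff _).mpr h.sph
    rw [homologySpherical_composition_iff K L hn] at hS
    simp only [homologySpherical_iff] at hS
    obtain ⟨-, hL⟩ := hS
    obtain ⟨h0, h1⟩ := (homologicalSphere_iff _).mp h
    obtain ⟨τ, hτ, -⟩ := (mem_composition K L).mp h0
    have hK0 : ∅ ∈ K := K.lower (Finset.empty_subset τ) hτ
    have hL0 : ∀ k, ∅ ∈ L k := fun k => empty_mem_of_sph (hL k)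
    have hL1 : ∀ k, Finset.univ ∉ L k := fun k => ne_top_of_sph (hL k)
    simp only [sph_lk_composition_iff K L hn hL] at h1
    refine ⟨(homologicalSphere_iff _).mpr ⟨hK0, fun τ hτ => ?_⟩, fun k hk => ?_, fun k _ =>
      (homologicalSphere_iff _).mpr ⟨hL0 k, fun τ hτ => ?_⟩⟩
    -- Filling exactly the blocks in `τ` gives a simplex whose set of missing blocks is `τ`, so
    -- links in `K` are seen by links in the composition.
    · have hb := fun k => block_ofBlocks (fun k : Fin m => if k ∈ τ then
        (Finset.univ : Finset (Fin (n k))) else ∅) k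
      have hm : missing L (ofBlocks fun k : Fin m => if k ∈ τ then
          (Finset.univ : Finset (Fin (n k))) else ∅) = τ := by
        ext k
        rw [mem_missing, hb]
        by_cases hk : k ∈ τ
        · simp [hk, hL1]
        · simp [hk, hL0]
      have h2 := (h1 _ ((mem_composition K L).mpr ⟨τ, hτ, fun k hk => by
        rw [hb, if_neg hk]
        exact hL0 k⟩)).1
      rwa [hm] at h2
    · refine SetLike.ext fun τ => ?_
      change _ ↔ τ ≠ Finset.univ
      refine ⟨fun h' h'' => hL1 k (h'' ▸ h'), fun h' => ?_⟩
      by_contra hτ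
      -- As `{k} ∈ K`, any subset `τ` of the block is a simplex; one outside `L k` has to fill the
      -- block.
      have h2 := (h1 (ofBlocks (Function.update (fun _ => ∅) k τ))
        ((mem_composition K L).mpr ⟨{k}, hk, fun j hj => by
          rw [block_update_of_ne τ (Finset.notMem_singleton.mp hj)]
          exact hL0 j⟩)).2.2 k
      rw [block_update_same] at h2
      exact h' (h2 hτ)
    · have h2 := (h1 (ofBlocks (Function.update (fun _ => ∅) k τ))
        ((mem_composition K L).mpr ⟨∅, hK0, fun j _ => by
          by_cases hj : j = k
          · subst hj
            rwa [block_update_same]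
          · rw [block_update_of_ne τ hj]
            exact hL0 j⟩)).2.1 k
      rw [block_update_same] at h2
      exact h2 hτ
  · rintro ⟨hK, hk1, hk2⟩
    obtain ⟨hK0, hK1⟩ := (homologicalSphere_iff _).mp hK
    have hlk : ∀ k, ∀ σ ∈ L k, ((L k).lk σ).toMatCx.Sph := by
      intro k σ hσ
      by_cases hk : {k} ∈ K
      · rw [hk1 k hk] at hσ ⊢
        exact sph_lk_simplexBoundary hσ
      · exact ((homologicalSphere_iff _).mp (hk2 k hk)).2 σ hσ
    have hL0 : ∀ k, ∅ ∈ L k := by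
      intro k
      by_cases hk : {k} ∈ K
      · rw [hk1 k hk]
        exact (Finset.univ_nonempty.ne_empty).symm
      · exact ((homologicalSphere_iff _).mp (hk2 k hk)).1
    have hL : ∀ k, (L k).toMatCx.Sph := fun k => by
      have := hlk k ∅ (hL0 k)
      rwa [lk_empty] at this
    refine (homologicalSphere_iff _).mpr
      ⟨(mem_composition K L).mpr ⟨∅, hK0, fun k _ => ?_⟩, fun σ hσ => ?_⟩
    · exact (L k).lower (fun i hi => absurd (mem_block.mp hi) (Finset.notMem_empty _)) (hL0 k)
    · obtain ⟨τ, hτ, h⟩ := (mem_composition K L).mp hσ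
      have hm : missing L σ ∈ K := K.lower (fun k hk => by
        by_contra hkτ
        exact (mem_missing L).mp hk (h k hkτ)) hτ
      refine (sph_lk_composition_iff K L hn hL σ).mpr ⟨hK1 _ hm, fun k hk => hlk k _ hk,
        fun k hk => ?_⟩
      -- Missing blocks of a simplex are never ghost vertices, so `L k` is the boundary there and
      -- the only non-simplex is the full block.
      have hkK : {k} ∈ K := K.lower (Finset.singleton_subset_iff.mpr ((mem_missing L).mpr hk)) hm
      rw [hk1 k hkK] at hk
      by_contra hne'
      exact hk hne'

end Composition

end SimplicialCx

end

theorem mainTheorem7 (m : ℕ) (n : Fin m → ℕ) (hn : ∀ k, 0 < n k)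
    (K : SimplicialCx (Fin m)) (L : ∀ k : Fin m, SimplicialCx (Fin (n k))) :
    -- the reduced homology and cohomology of the composition complex
    ((∀ (k : Fin m) (q : ℕ), Module.Free ℤ ((L k).redHomology q)) →
      ∀ N : ℕ,
        Nonempty ((K.composition L).redHomology N ≃ₗ[ℤ]
          ⨁ p : {p : ℕ × (Fin m → ℕ) // p.1 + ∑ k, p.2 k = N},
            K.redHomology p.1.1 ⊗[ℤ] (⨂[ℤ] k : Fin m, (L k).redHomology (p.1.2 k))) ∧
        Nonempty ((K.composition L).redCohomology N ≃ₗ[ℤ]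
          ⨁ p : {p : ℕ × (Fin m → ℕ) // p.1 + ∑ k, p.2 k = N},
            K.redCohomology p.1.1 ⊗[ℤ] (⨂[ℤ] k : Fin m, (L k).redCohomology (p.1.2 k)))) ∧
    -- the homology spherical composition complexes
    ((K.composition L).HomologySpherical ↔
      K.HomologySpherical ∧ ∀ k, (L k).HomologySpherical) ∧
    -- the homological spheres among the composition complexes, if `K` has no ghost vertices
    ((∀ k : Fin m, {k} ∈ K) →
      ((K.composition L).HomologicalSphere ↔
        K.HomologicalSphere ∧ ∀ k, L k = SimplicialCx.simplexBoundary (Fin (n k)))) ∧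
    -- and in general
    ((K.composition L).HomologicalSphere ↔
      K.HomologicalSphere ∧
        (∀ k : Fin m, {k} ∈ K → L k = SimplicialCx.simplexBoundary (Fin (n k))) ∧
        (∀ k : Fin m, {k} ∉ K → (L k).HomologicalSphere)) := by
  refine ⟨SimplicialCx.kunneth K L hn, SimplicialCx.homologySpherical_composition_iff K L hn,
    fun hK => ?_, SimplicialCx.homologicalSphere_composition_iff K L hn⟩
  rw [SimplicialCx.homologicalSphere_composition_iff K L hn]
  exact and_congr_right fun _ => ⟨fun h k => h.1 k (hK k),
    fun h => ⟨fun k _ => h k, fun k hk => absurd (hK k) hk⟩⟩
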